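/- **Setup.** Let $D$ be a compact connected Kähler manifold, let $\gamma\colon D\to D$ be a biholomorphism of finite order $m>1$, and let $\Gamma\cong\mathbb Z_m$ be the group of transformations of $\mathbb C\times D$ generated by $(z,w)\mapsto(e^{2\pi i/m}z,\gamma(w))$. Put $M_{orb}=(\mathbb C\times D)/\Gamma$, and let $M_{orb}^{sing}$ be the set of orbits of points with nontrivial stabilizer. Let $\pi\colon M\to M_{orb}$ be a resolution: $M$ is a complex manifold, $\pi$ is a proper surjective holomorphic map, which is biholomorphic over $M_{orb}\setminus M_{orb}^{sing}$, and the preimage of $M_{orb}\setminus M_{orb}^{sing}$ is dense in $M$. Through $\pi$ we view $(\mathbb C^*\times D)/\Gamma$ as an open complex submanifold of $M$. On $\mathbb C^*\times D$ put $t(z,w)=\log|z|$ and, for a $\gamma$-invariant Kähler metric $g_D$ on $D$, let $g_{cyl}=e^{-2t}g_{\mathbb C}+g_D$, where $g_{\mathbb C}$ is the Euclidean metric of $\mathbb C$; $t$ and $g_{cyl}$ descend to $(\mathbb C^*\times D)/\Gamma$. A class $\kappa\in H^2(M,\mathbb R)$ is *Kähler* if it contains a Kähler form. A Kähler class $\kappa$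 is *ACyl* if it contains a Kähler form whose Riemannian metric $g$ is asymptotically cylindrical with end $\{t\ge 0\}\subset(\mathbb C^*\times D)/\Gamma$ and model $g_{cyl}$ for some $\gamma$-invariant Kähler metric $g_D$ on $D$, that is: $g$ is complete, $M\setminus\{t\ge 0\}$ is open and bounded for $g$, and there is $\delta>0$ such that for all $k\in\mathbb N_0$ $$\bigl|(\nabla^{g_{cyl}})^k(g-g_{cyl})\bigr|_{g_{cyl}}=O(e^{-\delta t})\qquad\text{as } t\to\infty .$$ **Corollary 4.4.** Suppose that the $\mathbb C^*$-action $\lambda*[z,w]=[\lambda z,w]$ on $M_{orb}$ extends $\pi$-equivariantly to a holomorphic action of $\mathbb C^*$ on $M$. If every closed $\gamma$-invariant real smooth $1$-form on $D$ is exact, then every Kähler class on $M$ is ACyl. -/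

import Mathlib

open scoped Manifold ContDiff Topology

noncomputable section

namespace ACylKahler

/-! ### Differential forms and de Rham cohomology on a manifold without boundary

A complex manifold is a space charted on a complex vector space `E` with holomorphic transition
maps.  The same charts make it a smooth real manifold, so real smooth tensors on it are tensors for
the model `𝓘(ℝ, E)`.  The tangent space `TangentSpace I x` of Mathlib is by definition the
model space `E`, through the preferred chart at `x`; so the tensors at `x` are
functions of vectors of `E`, and the derivatives `mfderiv` act on such vectors. -/

section Forms

variable {E : Type*} [NormedAddCommGroup E] [NormedSpace ℝ E]
  {H : Type*} [TopologicalSpace H] (I : ModelWithCorners ℝ E H)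
  (N : Type*) [TopologicalSpace N] [ChartedSpace H N]

variable (E) in
/-- Real `k`-forms on `N`, without any regularity: a value `α x` is an alternating `k`-linear form
on the tangent space `E` at `x`. -/
def DiffForm (k : ℕ) : Type _ := N → E [⋀^Fin k]→L[ℝ] ℝ

instance (k : ℕ) : AddCommGroup (DiffForm E N k) :=
  inferInstanceAs (AddCommGroup (N → E [⋀^Fin k]→L[ℝ] ℝ))

instance (k : ℕ) : Module ℝ (DiffForm E N k) :=
  inferInstanceAs (Module ℝ (N → E [⋀^Fin k]→L[ℝ] ℝ))

variable {N}

/-- A `k`-form read in the preferred chart at `x₀`: its pullback under the inverse chart. -/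
def formInChart {k : ℕ} (α : DiffForm E N k) (x₀ : N) : E → E [⋀^Fin k]→L[ℝ] ℝ := fun y =>
  (α ((extChartAt I x₀).symm y)).compContinuousLinearMap
    (mfderiv 𝓘(ℝ, E) I (extChartAt I x₀).symm y)

/-- A form is smooth when it is smooth in all the charts. -/
def IsSmoothForm {k : ℕ} (α : DiffForm E N k) : Prop :=
  ∀ x₀ : N, ContDiffOn ℝ ∞ (formInChart I α x₀) (extChartAt I x₀).target

/-- The exterior derivative, computed at each point in the preferred chart at that point. -/
def extD {k : ℕ} (α : DiffForm E N k) : DiffForm E N (k + 1) := fun x =>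
  extDeriv (formInChart I α x) (extChartAt I x x)

variable {I}

theorem formInChart_add {k : ℕ} (α β : DiffForm E N k) (x₀ : N) :
    formInChart I (α + β) x₀ = formInChart I α x₀ + formInChart I β x₀ := rfl

theorem formInChart_smul {k : ℕ} (c : ℝ) (α : DiffForm E N k) (x₀ : N) :
    formInChart I (c • α) x₀ = c • formInChart I α x₀ := rfl

theorem formInChart_zero {k : ℕ} (x₀ : N) :
    formInChart I (0 : DiffForm E N k) x₀ = 0 := rfl

theorem IsSmoothForm.add {k : ℕ} {α β : DiffForm E N k} (hα : IsSmoothForm I α)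
    (hβ : IsSmoothForm I β) : IsSmoothForm I (α + β) := fun x₀ => by
  rw [formInChart_add]; exact (hα x₀).add (hβ x₀)

theorem IsSmoothForm.smul {k : ℕ} (c : ℝ) {α : DiffForm E N k} (hα : IsSmoothForm I α) :
    IsSmoothForm I (c • α) := fun x₀ => by
  rw [formInChart_smul]; exact (hα x₀).const_smul c

theorem isSmoothForm_zero {k : ℕ} : IsSmoothForm I (0 : DiffForm E N k) := fun x₀ => by
  rw [formInChart_zero]; exact contDiffOn_const

theorem IsSmoothForm.differentiableAt [I.Boundaryless] {k : ℕ} {α : DiffForm E N k}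
    (hα : IsSmoothForm I α) (x : N) :
    DifferentiableAt ℝ (formInChart I α x) (extChartAt I x x) :=
  ((hα x).differentiableOn (by simp)).differentiableAt
    ((isOpen_extChartAt_target x).mem_nhds (mem_extChartAt_target x))

theorem extD_add [I.Boundaryless] {k : ℕ} {α β : DiffForm E N k} (hα : IsSmoothForm I α)
    (hβ : IsSmoothForm I β) : extD I (α + β) = extD I α + extD I β := by
  funext x
  have h := extDeriv_add (hα.differentiableAt x) (hβ.differentiableAt x)
  rw [← formInChart_add] at h
  exact h

theorem extD_smul {k : ℕ} (c : ℝ) (α : DiffForm E N k) : extD I (c • α) = c • extD I α := by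
  funext x
  have h := extDeriv_smul (x := extChartAt I x x) c (formInChart I α x)
  rw [← formInChart_smul] at h
  exact h

theorem extD_zero {k : ℕ} : extD I (0 : DiffForm E N k) = 0 := by
  have h := extD_smul (I := I) 0 (0 : DiffForm E N k)
  rwa [zero_smul, zero_smul] at h

variable (I N) [I.Boundaryless]

/-- The smooth closed `k`-forms. -/
def closedForms (k : ℕ) : Submodule ℝ (DiffForm E N k) where
  carrier := {α | IsSmoothForm I α ∧ extD I α = 0}
  add_mem' := fun ha hb => ⟨ha.1.add hb.1, by rw [extD_add ha.1 hb.1, ha.2, hb.2, add_zero]⟩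
  zero_mem' := ⟨isSmoothForm_zero, extD_zero⟩
  smul_mem' := fun c _ ha => ⟨ha.1.smul c, by rw [extD_smul, ha.2, smul_zero]⟩

/-- The exact `(k+1)`-forms: exterior derivatives of smooth `k`-forms. -/
def exactForms (k : ℕ) : Submodule ℝ (DiffForm E N (k + 1)) where
  carrier := {α | ∃ η : DiffForm E N k, IsSmoothForm I η ∧ extD I η = α}
  add_mem' := by
    rintro _ _ ⟨η, hη, rfl⟩ ⟨θ, hθ, rfl⟩
    exact ⟨η + θ, hη.add hθ, extD_add hη hθ⟩
  zero_mem' := ⟨0, isSmoothForm_zero, extD_zero⟩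
  smul_mem' := by
    rintro c _ ⟨η, hη, rfl⟩
    exact ⟨c • η, hη.smul c, extD_smul c η⟩

/-- The second de Rham cohomology `H²(N, ℝ)`: closed `2`-forms modulo exact `2`-forms. -/
abbrev DeRhamH2 : Type _ :=
  closedForms I N 2 ⧸ (exactForms I N 1).submoduleOf (closedForms I N 2)

end Forms

/-! ### Covariant tensors and the Levi-Civita connection -/

section Tensors

variable {E : Type*} [NormedAddCommGroup E] [NormedSpace ℝ E]
  {H : Type*} [TopologicalSpace H] (I : ModelWithCorners ℝ E H)
  {E' : Type*} [NormedAddCommGroup E'] [NormedSpace ℝ E']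
  {H' : Type*} [TopologicalSpace H'] (I' : ModelWithCorners ℝ E' H')
  (N : Type*) [TopologicalSpace N] [ChartedSpace H N]
  {N' : Type*} [TopologicalSpace N'] [ChartedSpace H' N']

variable (E) in
/-- Covariant tensors of rank `r`, as functions of `r` tangent vectors (all the tensors used below
are multilinear; this is not part of the type). -/
abbrev CovTensor (r : ℕ) : Type _ := N → (Fin r → E) → ℝ

variable {N}

/-- The pullback of a covariant tensor under a map. -/
def CovTensor.pullback {r : ℕ} (f : N → N') (T : CovTensor E' N' r) : CovTensor E N r :=
  fun x v => T (f x) fun i => mfderiv I I' f x (v i)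

/-- The pullback of a differential form under a map. -/
def DiffForm.pullback {k : ℕ} (f : N → N') (α : DiffForm E' N' k) : DiffForm E N k :=
  fun x => (α (f x)).compContinuousLinearMap (mfderiv I I' f x)

/-- A covariant tensor read in the preferred chart at `x₀`. -/
def tensorInChart {r : ℕ} (T : CovTensor E N r) (x₀ : N) (y : E) (w : Fin r → E) : ℝ :=
  T ((extChartAt I x₀).symm y) fun i => mfderiv 𝓘(ℝ, E) I (extChartAt I x₀).symm y (w i)

/-- The derivative at `x`, in the direction `u`, of the component `T(w₁, …, w_r)` of the tensor `T`
in the preferred chart at `x`. -/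
def chartDeriv {r : ℕ} (T : CovTensor E N r) (x : N) (u : E) (w : Fin r → E) : ℝ :=
  fderiv ℝ (fun y => tensorInChart I T x y w) (extChartAt I x x) u

/-- The Christoffel symbols of the first kind of the metric `g`. -/
def christoffelFirst (g : CovTensor E N 2) (x : N) (u v w : E) : ℝ :=
  (chartDeriv I g x u ![v, w] + chartDeriv I g x v ![u, w] - chartDeriv I g x w ![u, v]) / 2

/-- The Christoffel symbols `Γ(u, v)` of the Levi-Civita connection of the Riemannian metric `g`
at `x`, in the preferred chart at `x`: the vector which represents the Christoffel symbols of the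
first kind with respect to `g`. -/
def christoffel (g : CovTensor E N 2) (x : N) (u v : E) : E :=
  Classical.epsilon fun z : E => ∀ w : E, g x ![z, w] = christoffelFirst I g x u v w

/-- The covariant derivative `∇T` for the Levi-Civita connection of `g`; the new argument, the
direction of differentiation, is the first one. -/
def covDeriv (g : CovTensor E N 2) {r : ℕ} (T : CovTensor E N r) : CovTensor E N (r + 1) :=
  fun x v => chartDeriv I T x (v 0) (Fin.tail v) -
    ∑ i : Fin r, T x (Function.update (Fin.tail v) i (christoffel I g x (v 0) (Fin.tail v i)))

/-- The iterated covariant derivative `∇ᵏ T`. -/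
def iterCovDeriv (g : CovTensor E N 2) {r : ℕ} (T : CovTensor E N r) :
    (k : ℕ) → CovTensor E N (r + k)
  | 0 => T
  | k + 1 => covDeriv I g (iterCovDeriv g T k)

/-- The Riemannian distance of the metric `g`: the infimum of the lengths of the `C¹` paths. -/
def riemDist (g : CovTensor E N 2) (x y : N) : ENNReal :=
  letI : ∀ p : N, ENorm (TangentSpace I p) := fun p =>
    ⟨fun v => ENNReal.ofReal (Real.sqrt (g p ![v, v]))⟩
  Manifold.riemannianEDist I x y

/-- The metric `g` is complete: Cauchy sequences for its distance converge. -/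
def IsCompleteMetric (g : CovTensor E N 2) : Prop :=
  ∀ u : ℕ → N, (∀ ε : ENNReal, 0 < ε → ∃ n₀, ∀ i ≥ n₀, ∀ j ≥ n₀, riemDist I g (u i) (u j) < ε) →
    ∃ x, Filter.Tendsto (fun i => riemDist I g (u i) x) Filter.atTop (𝓝 0)

/-- The set `s` is bounded for the distance of `g`. -/
def IsBoundedFor (g : CovTensor E N 2) (s : Set N) : Prop :=
  ∃ C : NNReal, ∀ x ∈ s, ∀ y ∈ s, riemDist I g x y ≤ C

end Tensors

/-! ### Kähler forms on complex manifolds -/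

section Kahler

variable {W : Type*} [NormedAddCommGroup W] [NormedSpace ℂ W]
  {M : Type*} [TopologicalSpace M] [ChartedSpace W M]

/-- The complex structure `J` of a complex manifold: multiplication by `i` on tangent spaces. -/
def cplxJ (v : W) : W := Complex.I • v

/-- Kähler forms: smooth, closed, real forms of type `(1,1)` which are positive. -/
structure IsKahlerForm (σ : DiffForm W M 2) : Prop where
  closed : σ ∈ closedForms 𝓘(ℝ, W) M 2
  invariant : ∀ (x : M) (u v : W), σ x ![cplxJ u, cplxJ v] = σ x ![u, v]
  pos : ∀ (x : M) (u : W), u ≠ 0 → 0 < σ x ![u, cplxJ u]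

/-- The Riemannian metric `g(u, v) = σ(u, Jv)` of a Kähler form `σ`. -/
def kahlerMetric (σ : DiffForm W M 2) : CovTensor W M 2 :=
  fun x v => σ x ![v 0, cplxJ (v 1)]

/-- The de Rham class of a Kähler form. -/
def IsKahlerForm.deRhamClass {σ : DiffForm W M 2} (h : IsKahlerForm σ) :
    DeRhamH2 𝓘(ℝ, W) M :=
  Submodule.Quotient.mk ⟨σ, h.closed⟩

/-- A class in `H²(M, ℝ)` is Kähler if it contains a Kähler form. -/
def IsKahlerClass (κ : DeRhamH2 𝓘(ℝ, W) M) : Prop :=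
  ∃ (σ : DiffForm W M 2) (h : IsKahlerForm σ), h.deRhamClass = κ

end Kahler

/-! ### The orbifold `(ℂ × D) / ⟨γ⟩` and its resolutions -/

section Orbifold

variable {D : Type*}

/-- The map `(z, w) ↦ (e^{2πi/m} z, γ(w))` of `ℂ × D`. -/
def deck (m : ℕ) (γ : Equiv.Perm D) : Equiv.Perm (ℂ × D) :=
  Equiv.prodCongr
    (Equiv.mulLeft₀ (Complex.exp (2 * Real.pi * Complex.I / m)) (Complex.exp_ne_zero _)) γ

/-- The orbit space `M_orb = (ℂ × D) / Γ`, where `Γ` is generated by `deck m γ`. -/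
abbrev Orbifold (m : ℕ) (γ : Equiv.Perm D) : Type _ :=
  Quotient (MulAction.orbitRel (Subgroup.zpowers (deck m γ)) (ℂ × D))

/-- The quotient map `ℂ × D → M_orb`. -/
def Orbifold.mk (m : ℕ) (γ : Equiv.Perm D) (p : ℂ × D) : Orbifold m γ := Quotient.mk _ p

/-- The singular part of the orbifold: the orbits of the points with nontrivial isotropy. -/
def singularPart (m : ℕ) (γ : Equiv.Perm D) : Set (Orbifold m γ) :=
  Orbifold.mk m γ '' {p | MulAction.stabilizer (Subgroup.zpowers (deck m γ)) p ≠ ⊥}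

variable {V : Type*} [NormedAddCommGroup V] [NormedSpace ℂ V] [TopologicalSpace D]
  [ChartedSpace V D]
  {W : Type*} [NormedAddCommGroup W] [NormedSpace ℂ W]

/-- A resolution `π : M → M_orb`: a proper surjective holomorphic map from a complex manifold which
is biholomorphic over the regular part of `M_orb`, the preimage of the regular part being dense.

Holomorphic functions on `M_orb` are the functions whose composition with the quotient map
`q : ℂ × D → M_orb` is holomorphic. Over the regular part, `q` is a holomorphic covering, so that
`π` is biholomorphic there if and only if it is injective there and
`π⁻¹ ∘ q` is locally biholomorphic. -/
structure Resolution (V W : Type*) [NormedAddCommGroup V] [NormedSpace ℂ V]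
    [NormedAddCommGroup W] [NormedSpace ℂ W] [ChartedSpace V D]
    (m : ℕ) (γ : Equiv.Perm D) (M : Type*) [TopologicalSpace M] [ChartedSpace W M] where
  /-- The map `π`. -/
  proj : M → Orbifold m γ
  proper : IsProperMap proj
  surjective : Function.Surjective proj
  holomorphic : ∀ (U : Set (Orbifold m γ)) (f : Orbifold m γ → ℂ), IsOpen U →
    ContMDiffOn (𝓘(ℂ, ℂ).prod 𝓘(ℂ, V)) 𝓘(ℂ, ℂ) ω (f ∘ Orbifold.mk m γ)
      (Orbifold.mk m γ ⁻¹' U) →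
    ContMDiffOn 𝓘(ℂ, W) 𝓘(ℂ, ℂ) ω (f ∘ proj) (proj ⁻¹' U)
  dense : Dense (proj ⁻¹' (singularPart m γ)ᶜ)
  injOn : Set.InjOn proj (proj ⁻¹' (singularPart m γ)ᶜ)
  /-- The map `π⁻¹ ∘ q`, on the points of `ℂ × D` over the regular part of `M_orb` (its other
  values are irrelevant). -/
  lift : ℂ × D → M
  proj_lift : ∀ p, Orbifold.mk m γ p ∉ singularPart m γ → proj (lift p) = Orbifold.mk m γ p
  lift_biholomorphic : IsLocalDiffeomorphOn (𝓘(ℂ, ℂ).prod 𝓘(ℂ, V)) 𝓘(ℂ, W) ω lift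
    {p | Orbifold.mk m γ p ∉ singularPart m γ}

variable {m : ℕ} {γ : Equiv.Perm D} {M : Type*} [TopologicalSpace M] [ChartedSpace W M]

/-- The action `λ * [z, w] = [λ z, w]` of `ℂ*` on the orbifold extends, equivariantly for the
projection, to a holomorphic action of `ℂ*` on the resolution. -/
def Resolution.ActionExtends (R : Resolution V W m γ M) : Prop :=
  ∃ _ : MulAction ℂˣ M,
    ContMDiff (𝓘(ℂ, ℂ).prod 𝓘(ℂ, W)) 𝓘(ℂ, W) ω (fun p : ℂˣ × M => p.1 • p.2) ∧
    ∀ (c : ℂˣ) (x : M) (z : ℂ) (w : D), R.proj x = Orbifold.mk m γ (z, w) →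
      R.proj (c • x) = Orbifold.mk m γ ((c : ℂ) * z, w)

/-- The cylindrical parameter `t(z, w) = log |z|` on `ℂ* × D`. -/
def cylParam (p : ℂ × D) : ℝ := Real.log ‖p.1‖

/-- The metric `g_cyl = e^{-2t} g_ℂ + g_D` on `ℂ* × D` (a subset of `ℂ × D`). -/
def cylMetric (gD : CovTensor V D 2) : CovTensor (ℂ × V) (ℂ × D) 2 :=
  fun p v =>
    Real.exp (-2 * cylParam p) * inner ℝ (v 0).1 (v 1).1 + gD p.2 ![(v 0).2, (v 1).2]

/-- The metric `g` on the resolution is asymptotic, on the end `(ℂ* × D) / Γ`, to the cylindrical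
metric `gc`: for some `δ > 0` and all `k`, `|∇ᵏ (g - gc)| = O(e^{-δ t})` as `t → ∞`, with `∇` and
the norm of `gc`.  Tensors are lifted to the covering `ℂ* × D`.  The norm is
the operator norm of multilinear forms, which is equivalent to the Hilbert-Schmidt norm up to
constants depending on the dimension and the rank. -/
def Resolution.IsAsymptotic (R : Resolution V W m γ M) (g : CovTensor W M 2)
    (gc : CovTensor (ℂ × V) (ℂ × D) 2) : Prop :=
  ∃ δ : ℝ, 0 < δ ∧ ∀ k : ℕ, ∃ C t₀ : ℝ, ∀ p : ℂ × D, p.1 ≠ 0 → t₀ ≤ cylParam p →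
    ∀ v : Fin (2 + k) → ℂ × V,
      |iterCovDeriv (𝓘(ℝ, ℂ).prod 𝓘(ℝ, V)) gc
          (CovTensor.pullback (𝓘(ℝ, ℂ).prod 𝓘(ℝ, V)) 𝓘(ℝ, W) R.lift g - gc) k p v| ≤
        C * Real.exp (-δ * cylParam p) * ∏ i, Real.sqrt (gc p ![v i, v i])

/-- The complement of the cylindrical end `{t ≥ 0}`, that is of the image of
`[0, ∞) × (𝕊¹ × D) / Γ` under the ACyl map `(t, e^{iθ}, w) ↦ (e^{t + iθ}, w)`. -/
def Resolution.core (R : Resolution V W m γ M) : Set M :=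
  (R.lift '' {p : ℂ × D | p.1 ≠ 0 ∧ 0 ≤ cylParam p})ᶜ

/-- The class `κ` is an ACyl Kähler class: it contains a Kähler form whose metric `g` is ACyl
(complete, with an open bounded set whose complement is the cylindrical end,
on which `g` is exponentially asymptotic to the cylinder), with asymptotic cylinder
`g_cyl = e^{-2t} g_ℂ + g_D` for some `γ`-invariant Kähler metric `g_D` on `D`. -/
def Resolution.IsACylKahlerClass (R : Resolution V W m γ M) (κ : DeRhamH2 𝓘(ℝ, W) M) : Prop :=
  ∃ (σ : DiffForm W M 2) (h : IsKahlerForm σ), h.deRhamClass = κ ∧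
    IsCompleteMetric 𝓘(ℝ, W) (kahlerMetric σ) ∧
    IsOpen R.core ∧ IsBoundedFor 𝓘(ℝ, W) (kahlerMetric σ) R.core ∧
    ∃ σD : DiffForm V D 2, IsKahlerForm σD ∧
      CovTensor.pullback 𝓘(ℝ, V) 𝓘(ℝ, V) γ (kahlerMetric σD) = kahlerMetric σD ∧
      R.IsAsymptotic (kahlerMetric σ) (cylMetric (kahlerMetric σD))

end Orbifold

end ACylKahler

end

/-!
The idea is to replace a given Kähler form `σ₀` on the resolution, within its class, by one which
is exactly a product far out on the end.

The circle in `ℂ*` acts on the resolution by biholomorphic maps isotopic to the identity, so the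
average `α` of `σ₀` over this action is a Kähler form in the class of `σ₀`
(`IsCircleAction.isKahlerForm_average`; the difference is `d` of `averagePrimitive`).  The map
`e(ζ, w) = [exp ζ, w]` is a holomorphic covering of the part `z ≠ 0` of the resolution by `ℂ × D`
(`Resolution.isCylindricalEnd_expLift`), and with `ζ = t + iθ` the coefficients of `e^* α` do not
depend on `θ`.  Contracting `α` with `∂_θ` and restricting to the cross-section `{0} × D` gives a
closed `γ`-invariant `1`-form; by hypothesis it is exact, and then it has a `γ`-invariant primitive
`f` (`IsCylindricalEnd.exists_invariant_primitive`).

The function `F(t, w) = ∫₀ᵗ (t - s) α(∂ₜ, ∂_θ)(s, w) ds - t f(w)` satisfies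
`e^* α = pr^* α|_D + ddᶜF` on the whole of `ℂ × D`: the difference of the two sides is closed, of
type `(1,1)`, independent of `θ`, and has no component involving `∂_θ`, so it does not depend on
`t` either, and it vanishes at `t = 0` (`eq_zero_of_closed_of_invariant`,
`eq_restriction_add_ddc`).

Let `χ` be a cutoff function equal to `1` for `t ≤ 1` and to `0` for `t ≥ 2`, and let `h(t)` be a
function with `h'' ≥ 0` vanishing for `t ≤ 0`, with `h'' = L` for `1 ≤ t ≤ 2` and `h'' = 1` for
`t ≥ 3`.  The function `G = (χ - 1) F + h` extends by `0` to the resolution, and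
`σ = α + ddᶜG` is in the class of `α`.  On the end `σ = pr^* α|_D + ddᶜ(χF) + h'' dt ∧ dθ`.  In the
directions of `D` the sum of the first two terms is `χ α + (1 - χ) α|_D`, which is positive, so by
compactness of `{1 ≤ t ≤ 2}` the form `σ` is positive for `L` large
(`IsCylindricalEnd.exists_isKahlerForm_correction`).  For `t ≥ 3` it is `pr^* α|_D + dt ∧ dθ`,
whose metric is exactly `e^{-2t} g_ℂ + g_D` in the coordinate `z = exp ζ`; so the metric of `σ` is
asymptotic to the cylinder for every rate (`Resolution.isAsymptotic_cylMetric`).  It is complete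
because a smoothing of `t` is a proper function with bounded differential
(`IsCylindricalEnd.isCompleteMetric`), and the part `|z| < 1` of the resolution is bounded because
it is relatively compact in a connected manifold (`isBoundedFor_of_isCompact`).
-/

noncomputable section

namespace ACylKahler


/-! ### Holomorphic maps as real smooth maps -/

section RealOfComplex

open Set

/-- A complex model with corners and a real one with the same underlying maps. -/
structure SameModel {E H : Type*} [NormedAddCommGroup E] [NormedSpace ℂ E] [TopologicalSpace H]
    (I : ModelWithCorners ℂ E H) (I' : ModelWithCorners ℝ E H) : Prop where
  coe_eq : (I : H → E) = I'
  symm_eq : (I.symm : E → H) = I'.symm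

theorem sameModel_self (E : Type*) [NormedAddCommGroup E] [NormedSpace ℂ E] :
    SameModel 𝓘(ℂ, E) 𝓘(ℝ, E) := ⟨rfl, rfl⟩

variable {E H E' H' : Type*} [NormedAddCommGroup E] [NormedSpace ℂ E] [TopologicalSpace H]
  [NormedAddCommGroup E'] [NormedSpace ℂ E'] [TopologicalSpace H']
  {I : ModelWithCorners ℂ E H} {I' : ModelWithCorners ℝ E H}
  {J : ModelWithCorners ℂ E' H'} {J' : ModelWithCorners ℝ E' H'}
  {N N' : Type*} [TopologicalSpace N] [ChartedSpace H N] [TopologicalSpace N'] [ChartedSpace H' N']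

theorem SameModel.prod (hI : SameModel I I') (hJ : SameModel J J') :
    SameModel (I.prod J) (I'.prod J') := by
  constructor
  · ext p <;> simp [hI.coe_eq, hJ.coe_eq]
  · funext p
    simp [ModelWithCorners.prod, hI.symm_eq, hJ.symm_eq]

theorem SameModel.extChartAt_eq (hI : SameModel I I') (x : N) :
    (extChartAt I x : N → E) = extChartAt I' x := by
  simp [hI.coe_eq]

theorem SameModel.extChartAt_symm_eq (hI : SameModel I I') (x : N) :
    ((extChartAt I x).symm : E → N) = (extChartAt I' x).symm := by
  simp [hI.symm_eq]

theorem SameModel.range_eq (hI : SameModel I I') : range I = range I' := by rw [hI.coe_eq]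

theorem SameModel.isManifold (hI : SameModel I I') {n : WithTop ℕ∞} [IsManifold I n N] :
    IsManifold I' n N := by
  refine isManifold_of_contDiffOn I' n N fun e e' he he' => ?_
  have h := HasGroupoid.compatible (G := contDiffGroupoid n I) he he'
  rw [contDiffGroupoid, mem_groupoid_of_pregroupoid] at h
  have h1 : ContDiffOn ℂ n (I ∘ (e.symm.trans e') ∘ I.symm)
    (I.symm ⁻¹' (e.symm.trans e').source ∩ range I) := h.1
  have h2 := h1.restrict_scalars ℝ
  rwa [hI.range_eq, hI.coe_eq, hI.symm_eq] at h2

theorem SameModel.contMDiffAt (hI : SameModel I I') (hJ : SameModel J J') {n : WithTop ℕ∞}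
    {f : N → N'} {x : N} (hf : ContMDiffAt I J n f x) : ContMDiffAt I' J' n f x := by
  rw [contMDiffAt_iff] at hf ⊢
  refine ⟨hf.1, ?_⟩
  have h := hf.2.restrict_scalars ℝ
  rwa [hI.range_eq, hJ.extChartAt_eq, hI.extChartAt_eq, hI.extChartAt_symm_eq] at h

theorem SameModel.hasMFDerivAt (hI : SameModel I I') (hJ : SameModel J J')
    {f : N → N'} {x : N} {f' : E →L[ℂ] E'} (hf : HasMFDerivAt I J f x f') :
    HasMFDerivAt I' J' f x (f'.restrictScalars ℝ : E →L[ℝ] E') := by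
  refine ⟨hf.1, ?_⟩
  have h : HasFDerivWithinAt (writtenInExtChartAt I J x f) f' (range I) ((extChartAt I x) x) := hf.2
  have h2 := h.restrictScalars ℝ
  simp only [writtenInExtChartAt] at h2 ⊢
  rwa [hI.range_eq, hJ.extChartAt_eq, hI.extChartAt_eq, hI.extChartAt_symm_eq] at h2

/-- A real linear map of complex vector spaces commutes with the complex structures. -/
def IsJLinear (L : E →L[ℝ] E') : Prop := ∀ v : E, L (cplxJ v) = cplxJ (L v)

theorem cplxJ_cplxJ (v : E) : cplxJ (cplxJ v) = -v := by
  simp [cplxJ, smul_smul]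

theorem SameModel.isJLinear_mfderiv (hI : SameModel I I') (hJ : SameModel J J')
    {f : N → N'} {x : N} (hf : MDifferentiableAt I J f x) :
    IsJLinear (E := E) (E' := E') (mfderiv I' J' f x) := fun v => by
  rw [(hI.hasMFDerivAt hJ (f' := mfderiv I J f x) hf.hasMFDerivAt).mfderiv]
  exact (mfderiv I J f x : E →L[ℂ] E').map_smul _ _

end RealOfComplex

/-! ### Derivatives between manifolds as linear maps of the model spaces -/

section RealDeriv

open Set Filter

variable {E : Type*} [NormedAddCommGroup E] [NormedSpace ℝ E]
  {H : Type*} [TopologicalSpace H] {I : ModelWithCorners ℝ E H}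
  {N : Type*} [TopologicalSpace N] [ChartedSpace H N]
  {E' : Type*} [NormedAddCommGroup E'] [NormedSpace ℝ E']
  {H' : Type*} [TopologicalSpace H'] {I' : ModelWithCorners ℝ E' H'}
  {N' : Type*} [TopologicalSpace N'] [ChartedSpace H' N']
  {E'' : Type*} [NormedAddCommGroup E''] [NormedSpace ℝ E'']
  {H'' : Type*} [TopologicalSpace H''] {I'' : ModelWithCorners ℝ E'' H''}
  {N'' : Type*} [TopologicalSpace N''] [ChartedSpace H'' N'']

variable (I I') in
/-- The derivative `mfderiv` as a linear map between the model spaces. -/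
def realDeriv (f : N → N') (x : N) : E →L[ℝ] E' := mfderiv I I' f x

theorem realDeriv_comp {g : N' → N''} {f : N → N'} {x : N}
    (hg : MDifferentiableAt I' I'' g (f x)) (hf : MDifferentiableAt I I' f x) :
    realDeriv I I'' (g ∘ f) x = realDeriv I' I'' g (f x) ∘L realDeriv I I' f x :=
  mfderiv_comp x hg hf

theorem realDeriv_congr {f g : N → N'} {x : N} (h : f =ᶠ[𝓝 x] g) :
    realDeriv I I' f x = realDeriv I I' g x := by
  have h1 := h.self_of_nhds
  by_cases hf : MDifferentiableAt I I' f x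
  · have := (hf.hasMFDerivAt.congr_of_eventuallyEq h.symm).mfderiv
    exact this.symm
  · have hg : ¬ MDifferentiableAt I I' g x := fun hg => hf (hg.congr_of_eventuallyEq h)
    rw [realDeriv, realDeriv, mfderiv_zero_of_not_mdifferentiableAt hf,
      mfderiv_zero_of_not_mdifferentiableAt hg]
    rfl

theorem realDeriv_eq_fderiv (f : E → E') (x : E) :
    realDeriv 𝓘(ℝ, E) 𝓘(ℝ, E') f x = fderiv ℝ f x := mfderiv_eq_fderiv

theorem realDeriv_id (x : N) : realDeriv I I id x = ContinuousLinearMap.id ℝ E := mfderiv_id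

theorem realDeriv_const (c : N') (x : N) : realDeriv I I' (fun _ : N => c) x = 0 := mfderiv_const

theorem realDeriv_extChartAt_self [IsManifold I 1 N] (x : N) :
    realDeriv I 𝓘(ℝ, E) (extChartAt I x) x = ContinuousLinearMap.id ℝ E := mfderiv_extChartAt_self

theorem mdifferentiableAt_extChartAt_symm [I.Boundaryless] [IsManifold I 1 N] (x : N) {y : E}
    (hy : y ∈ (extChartAt I x).target) :
    MDifferentiableAt 𝓘(ℝ, E) I (extChartAt I x).symm y := by
  have := mdifferentiableWithinAt_extChartAt_symm (I := I) hy
  rwa [I.range_eq_univ, mdifferentiableWithinAt_univ] at this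

/-- Derivatives into a manifold, computed in a chart. -/
theorem realDeriv_eq_comp_chart [I.Boundaryless] [IsManifold I 1 N] {f : N' → N} {y : N'} (x : N)
    (hf : MDifferentiableAt I' I f y) (hx : f y ∈ (extChartAt I x).source) :
    realDeriv I' I f y = realDeriv 𝓘(ℝ, E) I (extChartAt I x).symm (extChartAt I x (f y)) ∘L
      realDeriv I' 𝓘(ℝ, E) (extChartAt I x ∘ f) y := by
  have hφ : MDifferentiableAt I 𝓘(ℝ, E) (extChartAt I x) (f y) :=
    mdifferentiableAt_extChartAt (by simpa using hx)
  have hφs := mdifferentiableAt_extChartAt_symm x ((extChartAt I x).map_source hx)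
  refine Eq.trans (realDeriv_congr ?_)
    (realDeriv_comp (g := (extChartAt I x).symm) (f := extChartAt I x ∘ f) hφs (hφ.comp y hf))
  filter_upwards [hf.continuousAt.eventually
    ((isOpen_extChartAt_source x).mem_nhds hx)] with z hz
  exact ((extChartAt I x).left_inv hz).symm

theorem realDeriv_extChartAt_symm_self [I.Boundaryless] [IsManifold I 1 N] (x : N) :
    realDeriv 𝓘(ℝ, E) I (extChartAt I x).symm (extChartAt I x x) =
      ContinuousLinearMap.id ℝ E := by
  have h := realDeriv_eq_comp_chart (I := I) (I' := I) (f := id) (y := x) x mdifferentiableAt_id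
    (mem_extChartAt_source x)
  rw [realDeriv_id, Function.comp_id, realDeriv_extChartAt_self, ContinuousLinearMap.comp_id] at h
  exact h.symm

end RealDeriv


/-! ### Pullbacks of differential forms -/

section AlternatingMaps

variable {E F G : Type*} [NormedAddCommGroup E] [NormedSpace ℝ E] [NormedAddCommGroup F]
  [NormedSpace ℝ F] [NormedAddCommGroup G] [NormedSpace ℝ G]

variable (E G) in
/-- Alternatization as a continuous linear map.  On alternating forms it is multiplication by `k!`,
so it carries smoothness of families of multilinear maps over to families of forms. -/
def alternatizationCLM (k : ℕ) : ContinuousMultilinearMap ℝ (fun _ : Fin k => E) G →L[ℝ]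
    E [⋀^Fin k]→L[ℝ] G :=
  LinearMap.mkContinuous
    { toFun := ContinuousMultilinearMap.alternatization
      map_add' := map_add _
      map_smul' := fun c f => by
        ext v
        simp [ContinuousMultilinearMap.alternatization_apply_apply, Finset.smul_sum,
          smul_comm c] }
    (Fintype.card (Equiv.Perm (Fin k)) : ℝ) fun f => by
      refine ContinuousAlternatingMap.opNorm_le_bound _ (mul_nonneg (Nat.cast_nonneg _) (norm_nonneg f)) fun v => ?_
      simp only [LinearMap.coe_mk, AddHom.coe_mk,
        ContinuousMultilinearMap.alternatization_apply_apply]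
      refine (norm_sum_le _ _).trans ?_
      refine (Finset.sum_le_card_nsmul Finset.univ _ (‖f‖ * ∏ i, ‖v i‖) fun σ _ => ?_).trans
        (by rw [Finset.card_univ, nsmul_eq_mul, mul_assoc])
      have h : ‖Equiv.Perm.sign σ • f (v ∘ σ)‖ = ‖f (v ∘ σ)‖ := by
        rcases Int.units_eq_one_or (Equiv.Perm.sign σ) with h | h <;> simp [h]
      rw [h]
      refine (f.le_opNorm _).trans_eq ?_
      simp [Equiv.prod_comp σ fun i => ‖v i‖]

theorem alternatizationCLM_toContinuousMultilinearMap (k : ℕ) (f : E [⋀^Fin k]→L[ℝ] G) :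
    alternatizationCLM E G k f.toContinuousMultilinearMap = (k.factorial : ℝ) • f := by
  ext v
  have h : ∀ σ : Equiv.Perm (Fin k), Equiv.Perm.sign σ • f (v ∘ σ) = f v := fun σ => by
    have := f.toAlternatingMap.map_perm v σ
    simp only [ContinuousAlternatingMap.coe_toAlternatingMap] at this
    rw [this, smul_smul]
    simp
  simp [alternatizationCLM, ContinuousMultilinearMap.alternatization_apply_apply, h,
    Fintype.card_perm, Nat.cast_smul_eq_nsmul]

theorem two_le_infty : minSmoothness ℝ 2 ≤ (∞ : WithTop ℕ∞) := by
  rw [minSmoothness_of_isRCLikeNormedField]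
  exact WithTop.coe_le_coe.2 le_top

theorem contDiffAt_compContinuousLinearMap {k : ℕ} {n : WithTop ℕ∞}
    {f : E → F [⋀^Fin k]→L[ℝ] G} {L : E → E →L[ℝ] F} {y : E}
    (hf : ContDiffAt ℝ n f y) (hL : ContDiffAt ℝ n L y) :
    ContDiffAt ℝ n (fun y => (f y).compContinuousLinearMap (L y)) y := by
  have h1 : ContDiffAt ℝ n (fun y => ContinuousMultilinearMap.compContinuousLinearMapL (𝕜 := ℝ)
      (F := G) (fun _ : Fin k => L y) (f y).toContinuousMultilinearMap) y := by
    refine ContDiffAt.clm_apply ?_ ?_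
    · exact (ContinuousMultilinearMap.compContinuousLinearMapContinuousMultilinear ℝ
        (fun _ : Fin k => E) (fun _ : Fin k => F) G).contDiff.contDiffAt.comp y
        (contDiffAt_pi.2 fun _ => hL)
    · exact (ContinuousAlternatingMap.toContinuousMultilinearMapCLM
        ℝ).contDiff.contDiffAt.comp y hf
  have h2 := ((alternatizationCLM E G k).contDiff.contDiffAt.comp y h1).const_smul
    ((k.factorial : ℝ)⁻¹)
  refine h2.congr_of_eventuallyEq (Filter.Eventually.of_forall fun z => ?_)
  have h3 := alternatizationCLM_toContinuousMultilinearMap k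
    ((f z).compContinuousLinearMap (L z))
  have h4 : ((f z).compContinuousLinearMap (L z)).toContinuousMultilinearMap =
    ContinuousMultilinearMap.compContinuousLinearMapL (𝕜 := ℝ)
      (F := G) (fun _ : Fin k => L z) (f z).toContinuousMultilinearMap := by
    ext v; rfl
  rw [h4] at h3
  simp only [Function.comp_apply, h3]
  rw [smul_smul, inv_mul_cancel₀ (by positivity), one_smul]

end AlternatingMaps

section Pullback

open Set Filter

variable {E : Type*} [NormedAddCommGroup E] [NormedSpace ℝ E]
  {H : Type*} [TopologicalSpace H] {I : ModelWithCorners ℝ E H}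
  {N : Type*} [TopologicalSpace N] [ChartedSpace H N]
  {E' : Type*} [NormedAddCommGroup E'] [NormedSpace ℝ E']
  {H' : Type*} [TopologicalSpace H'] {I' : ModelWithCorners ℝ E' H'}
  {N' : Type*} [TopologicalSpace N'] [ChartedSpace H' N']
  {E'' : Type*} [NormedAddCommGroup E''] [NormedSpace ℝ E'']
  {H'' : Type*} [TopologicalSpace H''] {I'' : ModelWithCorners ℝ E'' H''}
  {N'' : Type*} [TopologicalSpace N''] [ChartedSpace H'' N'']
  {k : ℕ}

theorem DiffForm.pullback_eq (α : DiffForm E N k) (f : N' → N) (x : N') :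
    DiffForm.pullback I' I f α x = (α (f x)).compContinuousLinearMap (realDeriv I' I f x) := rfl

theorem DiffForm.pullback_apply (α : DiffForm E N k) (f : N' → N) (x : N') (v : Fin k → E') :
    DiffForm.pullback I' I f α x v = α (f x) fun i => realDeriv I' I f x (v i) := rfl

theorem formInChart_eq_pullback (α : DiffForm E N k) (x : N) :
    formInChart I α x = DiffForm.pullback 𝓘(ℝ, E) I (extChartAt I x).symm α := rfl

theorem DiffForm.pullback_comp (α : DiffForm E N k) {g : N' → N} {f : N'' → N'} {x : N''}
    (hg : MDifferentiableAt I' I g (f x)) (hf : MDifferentiableAt I'' I' f x) :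
    DiffForm.pullback I'' I (g ∘ f) α x =
      DiffForm.pullback I'' I' f (DiffForm.pullback I' I g α) x := by
  ext v
  simp only [DiffForm.pullback_apply, realDeriv_comp hg hf]
  rfl

theorem contMDiffAt_extChartAt_symm [I.Boundaryless] [IsManifold I ∞ N] (x : N) {y : E}
    (hy : y ∈ (extChartAt I x).target) : ContMDiffAt 𝓘(ℝ, E) I ∞ (extChartAt I x).symm y :=
  (contMDiffOn_extChartAt_symm x).contMDiffAt ((isOpen_extChartAt_target x).mem_nhds hy)

theorem contDiffAt_extChartAt_comp [IsManifold I ∞ N] {f : E' → N} {y₀ : E'}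
    (hf : ContMDiffAt 𝓘(ℝ, E') I ∞ f y₀) :
    ContDiffAt ℝ ∞ (extChartAt I (f y₀) ∘ f) y₀ := by
  rw [← contMDiffAt_iff_contDiffAt]
  exact (contMDiffAt_extChartAt' (I := I) (by simp)).comp y₀ hf

theorem IsSmoothForm.contDiffAt_formInChart [I.Boundaryless] {α : DiffForm E N k}
    (hα : IsSmoothForm I α) (x : N)
    {y : E} (hy : y ∈ (extChartAt I x).target) : ContDiffAt ℝ ∞ (formInChart I α x) y :=
  (hα x).contDiffAt ((isOpen_extChartAt_target x).mem_nhds hy)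

variable [I.Boundaryless] [IsManifold I ∞ N]

/-- Near a point, the pullback of a form under a smooth map is the pullback of its expression in
the preferred chart at the image point. -/
theorem DiffForm.pullback_eventuallyEq (α : DiffForm E N k) {f : E' → N} {y₀ : E'}
    (hf : ContMDiffAt 𝓘(ℝ, E') I ∞ f y₀) :
    DiffForm.pullback 𝓘(ℝ, E') I f α =ᶠ[𝓝 y₀] fun y =>
      (formInChart I α (f y₀) (extChartAt I (f y₀) (f y))).compContinuousLinearMap
        (fderiv ℝ (extChartAt I (f y₀) ∘ f) y) := by
  have : IsManifold I 1 N := IsManifold.of_le (n := ∞) (by simp)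
  have h1 : ∀ᶠ y in 𝓝 y₀, ContMDiffAt 𝓘(ℝ, E') I 1 f y :=
    (contMDiffAt_iff_contMDiffAt_nhds (by simp)).1 (hf.of_le (by simp))
  have h2 : ∀ᶠ y in 𝓝 y₀, f y ∈ (extChartAt I (f y₀)).source :=
    hf.continuousAt.eventually (extChartAt_source_mem_nhds (f y₀))
  filter_upwards [h1, h2] with y hy1 hy2
  have hd : MDifferentiableAt 𝓘(ℝ, E') I f y := hy1.mdifferentiableAt one_ne_zero
  ext v
  rw [formInChart_eq_pullback, ← realDeriv_eq_fderiv, DiffForm.pullback_apply,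
    realDeriv_eq_comp_chart (f y₀) hd hy2, ContinuousAlternatingMap.compContinuousLinearMap_apply,
    DiffForm.pullback_apply, (extChartAt I (f y₀)).left_inv hy2]
  rfl

theorem IsSmoothForm.contDiffAt_pullback {α : DiffForm E N k} (hα : IsSmoothForm I α)
    {f : E' → N} {y₀ : E'} (hf : ContMDiffAt 𝓘(ℝ, E') I ∞ f y₀) :
    ContDiffAt ℝ ∞ (DiffForm.pullback 𝓘(ℝ, E') I f α) y₀ := by
  have h1 := contDiffAt_extChartAt_comp hf
  refine ContDiffAt.congr_of_eventuallyEq ?_ (α.pullback_eventuallyEq hf)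
  refine contDiffAt_compContinuousLinearMap ?_ (h1.fderiv_right (m := ∞) (by simp))
  exact ContDiffAt.comp y₀ (hα.contDiffAt_formInChart (f y₀) (mem_extChartAt_target (f y₀))) h1

/-- The exterior derivative commutes with pullbacks. -/
theorem IsSmoothForm.extDeriv_pullback {α : DiffForm E N k} (hα : IsSmoothForm I α)
    {f : E' → N} {y₀ : E'} (hf : ContMDiffAt 𝓘(ℝ, E') I ∞ f y₀) :
    extDeriv (DiffForm.pullback 𝓘(ℝ, E') I f α) y₀ =
      DiffForm.pullback 𝓘(ℝ, E') I f (extD I α) y₀ := by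
  have : IsManifold I 1 N := IsManifold.of_le (n := ∞) (by simp)
  have h1 := contDiffAt_extChartAt_comp hf
  rw [(α.pullback_eventuallyEq hf).extDeriv_eq]
  have h := _root_.extDeriv_pullback (r := ∞) (f := extChartAt I (f y₀) ∘ f) (x := y₀)
    (hα.differentiableAt (f y₀)) h1 two_le_infty
  refine h.trans ?_
  ext v
  rw [DiffForm.pullback_apply, realDeriv_eq_comp_chart (f y₀) (hf.mdifferentiableAt (by simp))
    (mem_extChartAt_source _), realDeriv_extChartAt_symm_self, realDeriv_eq_fderiv]
  rfl

theorem IsSmoothForm.formInChart_extD {α : DiffForm E N k} (hα : IsSmoothForm I α) (x : N)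
    {y : E} (hy : y ∈ (extChartAt I x).target) :
    formInChart I (extD I α) x y = extDeriv (formInChart I α x) y :=
  (hα.extDeriv_pullback (contMDiffAt_extChartAt_symm x hy)).symm

theorem contDiffAt_extDeriv {F : Type*} [NormedAddCommGroup F] [NormedSpace ℝ F]
    {α : E → E [⋀^Fin k]→L[ℝ] F} {y : E} (hα : ContDiffAt ℝ ∞ α y) :
    ContDiffAt ℝ ∞ (extDeriv α) y :=
  ContDiffAt.comp (g := ContinuousAlternatingMap.alternatizeUncurryFinCLM ℝ E F) (f := fderiv ℝ α)
    y (ContinuousLinearMap.contDiff _).contDiffAt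
    (hα.fderiv_right (m := ∞) (by simp))

theorem IsSmoothForm.extD {α : DiffForm E N k} (hα : IsSmoothForm I α) :
    IsSmoothForm I (extD I α) := fun x => by
  refine ContDiffOn.congr (f := extDeriv (formInChart I α x)) (fun y hy => ?_)
    fun y hy => hα.formInChart_extD x hy
  exact (contDiffAt_extDeriv (hα.contDiffAt_formInChart x hy)).contDiffWithinAt

theorem IsSmoothForm.extD_extD {α : DiffForm E N k} (hα : IsSmoothForm I α) :
    ACylKahler.extD I (ACylKahler.extD I α) = 0 := by
  funext x
  have h : formInChart I (ACylKahler.extD I α) x =ᶠ[𝓝 (extChartAt I x x)]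
      extDeriv (formInChart I α x) := by
    filter_upwards [extChartAt_target_mem_nhds x] with y hy using hα.formInChart_extD x hy
  rw [ACylKahler.extD, h.extDeriv_eq]
  exact extDeriv_extDeriv_apply (hα.contDiffAt_formInChart x (mem_extChartAt_target x)) two_le_infty

end Pullback


/-! ### Integrals depending smoothly on parameters -/

section ParametricIntegral

open Set Filter MeasureTheory

universe u

/-- The partial derivative in the second variable. -/
def fderivSnd {E F : Type*} [NormedAddCommGroup E] [NormedSpace ℝ E]
    [NormedAddCommGroup F] [NormedSpace ℝ F] (G : ℝ × E → F) (p : ℝ × E) : E →L[ℝ] F :=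
  fderiv ℝ G p ∘L ContinuousLinearMap.inr ℝ ℝ E

section

variable {E F : Type*} [NormedAddCommGroup E] [NormedSpace ℝ E]
  [NormedAddCommGroup F] [NormedSpace ℝ F] {G : ℝ × E → F} {T : Set E}

theorem contDiffAt_of_contDiffOn_prod (hT : IsOpen T) (hG : ContDiffOn ℝ ∞ G (univ ×ˢ T)) {s : ℝ}
    {y : E} (hy : y ∈ T) : ContDiffAt ℝ ∞ G (s, y) :=
  hG.contDiffAt ((isOpen_univ.prod hT).mem_nhds ⟨mem_univ _, hy⟩)

theorem contDiffOn_fderivSnd (hT : IsOpen T) (hG : ContDiffOn ℝ ∞ G (univ ×ˢ T)) :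
    ContDiffOn ℝ ∞ (fderivSnd G) (univ ×ˢ T) :=
  (hG.fderiv_of_isOpen (m := ∞) (isOpen_univ.prod hT) (by simp)).clm_comp contDiffOn_const

theorem hasFDerivAt_comp_prodMk (hT : IsOpen T) (hG : ContDiffOn ℝ ∞ G (univ ×ˢ T)) {s : ℝ}
    {y : E} (hy : y ∈ T) : HasFDerivAt (fun z => G (s, z)) (fderivSnd G (s, y)) y :=
  ((contDiffAt_of_contDiffOn_prod hT hG hy).differentiableAt (by simp)).hasFDerivAt.comp y
    (hasFDerivAt_prodMk_right s y)

theorem continuous_of_contDiffOn_prod (hT : IsOpen T) (hG : ContDiffOn ℝ ∞ G (univ ×ˢ T)) {y : E}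
    (hy : y ∈ T) : Continuous fun s => G (s, y) := by
  rw [continuous_iff_continuousAt]
  exact fun s => ContinuousAt.comp (f := fun s => (s, y))
    (contDiffAt_of_contDiffOn_prod hT hG hy).continuousAt (by fun_prop)

/-- Differentiation under the integral sign. -/
theorem hasFDerivAt_intervalIntegral [FiniteDimensional ℝ E] (hT : IsOpen T)
    (hG : ContDiffOn ℝ ∞ G (univ ×ˢ T)) (a b : ℝ) {y : E} (hy : y ∈ T) :
    HasFDerivAt (fun z => ∫ s in a..b, G (s, z)) (∫ s in a..b, fderivSnd G (s, y)) y := by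
  have : ProperSpace E := FiniteDimensional.proper ℝ E
  obtain ⟨r, hr, hrT⟩ := Metric.nhds_basis_closedBall.mem_iff.1 (hT.mem_nhds hy)
  obtain ⟨C, hC⟩ := (isCompact_uIcc.prod (isCompact_closedBall y r)).exists_bound_of_continuousOn
    (f := fderivSnd G) (s := uIcc a b ×ˢ Metric.closedBall y r)
    ((contDiffOn_fderivSnd hT hG).continuousOn.mono (prod_mono (subset_univ _) hrT))
  refine intervalIntegral.hasFDerivAt_integral_of_dominated_of_fderiv_le (bound := fun _ => C)
    (F' := fun z s => fderivSnd G (s, z)) (s := Metric.closedBall y r)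
    (Metric.closedBall_mem_nhds y hr) ?_ ?_ ?_ ?_ ?_ ?_
  · filter_upwards [hT.mem_nhds hy] with z hz
    exact (continuous_of_contDiffOn_prod hT hG hz).aestronglyMeasurable
  · exact (continuous_of_contDiffOn_prod hT hG hy).intervalIntegrable _ _
  · exact (continuous_of_contDiffOn_prod hT (contDiffOn_fderivSnd hT hG) hy).aestronglyMeasurable
  · exact Eventually.of_forall fun s hs z hz => hC (s, z) ⟨uIoc_subset_uIcc hs, hz⟩
  · exact intervalIntegrable_const
  · exact Eventually.of_forall fun s _ z hz => hasFDerivAt_comp_prodMk hT hG (hrT hz)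

end

/-- Integrals depending on parameters are `n` times differentiable.  Parameters and values share
a universe, since the induction on `n` replaces the values by linear maps on the parameters. -/
theorem contDiffOn_intervalIntegral_nat {E : Type u} [NormedAddCommGroup E] [NormedSpace ℝ E]
    [FiniteDimensional ℝ E] {T : Set E} (hT : IsOpen T) (a b : ℝ) (n : ℕ) :
    ∀ {F : Type u} [NormedAddCommGroup F] [NormedSpace ℝ F] {G : ℝ × E → F},
      ContDiffOn ℝ ∞ G (univ ×ˢ T) → ContDiffOn ℝ n (fun y => ∫ s in a..b, G (s, y)) T := by
  induction n with
  | zero =>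
    intro F _ _ G hG
    exact contDiffOn_zero.2 fun y hy =>
      (hasFDerivAt_intervalIntegral hT hG a b hy).continuousAt.continuousWithinAt
  | succ n ih =>
    intro F _ _ G hG
    have h := fun y hy => hasFDerivAt_intervalIntegral hT hG a b (y := y) hy
    rw [Nat.cast_add, Nat.cast_one, contDiffOn_succ_iff_fderiv_of_isOpen hT]
    refine ⟨fun y hy => (h y hy).differentiableAt.differentiableWithinAt, by simp, ?_⟩
    exact (ih (contDiffOn_fderivSnd hT hG)).congr fun y hy => (h y hy).fderiv

theorem contDiffOn_intervalIntegral {E F : Type u} [NormedAddCommGroup E] [NormedSpace ℝ E]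
    [FiniteDimensional ℝ E] [NormedAddCommGroup F] [NormedSpace ℝ F] {T : Set E} (hT : IsOpen T)
    (a b : ℝ) {G : ℝ × E → F} (hG : ContDiffOn ℝ ∞ G (univ ×ˢ T)) :
    ContDiffOn ℝ ∞ (fun y => ∫ s in a..b, G (s, y)) T :=
  contDiffOn_infty.2 fun n => contDiffOn_intervalIntegral_nat hT a b n hG

/-- The real valued version, with the values moved to the universe of the parameters. -/
theorem contDiffOn_intervalIntegral_real {E : Type u} [NormedAddCommGroup E] [NormedSpace ℝ E]
    [FiniteDimensional ℝ E] {T : Set E} (hT : IsOpen T)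
    (a b : ℝ) {G : ℝ × E → ℝ} (hG : ContDiffOn ℝ ∞ G (univ ×ˢ T)) :
    ContDiffOn ℝ ∞ (fun y => ∫ s in a..b, G (s, y)) T := by
  let e : ULift.{u} ℝ ≃L[ℝ] ℝ := ContinuousLinearEquiv.ulift
  have h := contDiffOn_intervalIntegral hT a b (e.symm.contDiff.comp_contDiffOn hG)
  refine (e.contDiff.comp_contDiffOn h).congr fun y hy => ?_
  simp only [Function.comp_apply]
  rw [← ContinuousLinearEquiv.coe_coe, ← ContinuousLinearMap.intervalIntegral_comp_comm]
  · simp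
  · exact (e.symm.continuous.comp (continuous_of_contDiffOn_prod hT hG hy)).intervalIntegrable _ _

end ParametricIntegral

/-! ### Second primitives -/

section SecondPrimitive

open Set Filter MeasureTheory

/-- The second primitive `∫₀ᵗ (t - s) a(s) ds`, written as an integral over `[0, 1]`, so
that `t` is a parameter of the integrand. -/
def secondPrimitive (a : ℝ → ℝ) (t : ℝ) : ℝ := ∫ r in (0:ℝ)..1, t ^ 2 * ((1 - r) * a (r * t))

theorem secondPrimitive_eq {a : ℝ → ℝ} (t : ℝ) :
    secondPrimitive a t = ∫ s in (0:ℝ)..t, (t - s) * a s := by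
  rcases eq_or_ne t 0 with rfl | ht
  · simp [secondPrimitive]
  have h := intervalIntegral.integral_comp_mul_right (a := 0) (b := 1)
    (fun s => (t - s) * a s) ht
  rw [zero_mul, one_mul] at h
  rw [← inv_smul_eq_iff₀ (inv_ne_zero ht), inv_inv] at h
  rw [← h, secondPrimitive, smul_eq_mul, ← intervalIntegral.integral_const_mul]
  congr 1
  ext r
  ring

@[simp] theorem secondPrimitive_zero (a : ℝ → ℝ) : secondPrimitive a 0 = 0 := by
  simp [secondPrimitive]

theorem hasDerivAt_secondPrimitive {a : ℝ → ℝ} (ha : Continuous a) (t : ℝ) :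
    HasDerivAt (secondPrimitive a) (∫ s in (0:ℝ)..t, a s) t := by
  have h1 : secondPrimitive a =
      fun t => t * (∫ s in (0:ℝ)..t, a s) - ∫ s in (0:ℝ)..t, s * a s := by
    funext t
    rw [secondPrimitive_eq, ← intervalIntegral.integral_const_mul,
      ← intervalIntegral.integral_sub]
    · congr 1; ext s; ring
    · exact (by fun_prop : Continuous _).intervalIntegrable _ _
    · exact (by fun_prop : Continuous _).intervalIntegrable _ _
  have h2 : HasDerivAt (fun t => ∫ s in (0:ℝ)..t, a s) (a t) t := ha.integral_hasStrictDerivAt 0 t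
    |>.hasDerivAt
  have h3 : HasDerivAt (fun t => ∫ s in (0:ℝ)..t, s * a s) (t * a t) t :=
    (by fun_prop : Continuous fun s => s * a s).integral_hasStrictDerivAt 0 t |>.hasDerivAt
  rw [h1]
  exact (((hasDerivAt_id t).mul h2).sub h3).congr_deriv (by simp)

theorem hasDerivAt_primitive {a : ℝ → ℝ} (ha : Continuous a) (t : ℝ) :
    HasDerivAt (fun t => ∫ s in (0:ℝ)..t, a s) (a t) t :=
  (ha.integral_hasStrictDerivAt 0 t).hasDerivAt

theorem contDiffOn_secondPrimitive {E : Type*} [NormedAddCommGroup E] [NormedSpace ℝ E]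
    [FiniteDimensional ℝ E] {T : Set E} (hT : IsOpen T) {a : ℝ × E → ℝ}
    (ha : ContDiffOn ℝ ∞ a (univ ×ˢ T)) :
    ContDiffOn ℝ ∞ (fun p : ℝ × E => secondPrimitive (fun s => a (s, p.2)) p.1) (univ ×ˢ T) := by
  refine contDiffOn_intervalIntegral_real (isOpen_univ.prod hT) 0 1
    (G := fun q : ℝ × ℝ × E => q.2.1 ^ 2 * ((1 - q.1) * a (q.1 * q.2.1, q.2.2))) ?_
  have h : ContDiffOn ℝ ∞ (fun q : ℝ × ℝ × E => a (q.1 * q.2.1, q.2.2))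
      (univ ×ˢ (univ ×ˢ T)) :=
    ha.comp (f := fun q : ℝ × ℝ × E => (q.1 * q.2.1, q.2.2))
      (by fun_prop : ContDiff ℝ ∞ _).contDiffOn fun q hq => ⟨mem_univ _, hq.2.2⟩
  refine ContDiffOn.mul ?_ (ContDiffOn.mul ?_ h)
  · exact (by fun_prop : ContDiff ℝ ∞ _).contDiffOn
  · exact (by fun_prop : ContDiff ℝ ∞ _).contDiffOn

end SecondPrimitive


/-! ### Forms of low degree on normed spaces -/

section LowDegree

variable {E : Type*} [NormedAddCommGroup E] [NormedSpace ℝ E]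

theorem extDeriv_zeroForm_apply (α : E → E [⋀^Fin 0]→L[ℝ] ℝ) (x u : E) :
    extDeriv α x ![u] = fderiv ℝ α x u ![] := by
  rw [extDeriv, ContinuousAlternatingMap.alternatizeUncurryFin_apply, Fin.sum_univ_one]
  simp only [Fin.coe_ofNat_eq_mod, Nat.zero_mod, pow_zero, one_smul, Matrix.cons_val_zero]
  congr 1

theorem extDeriv_oneForm_apply (α : E → E [⋀^Fin 1]→L[ℝ] ℝ) (x u v : E) :
    extDeriv α x ![u, v] = fderiv ℝ α x u ![v] - fderiv ℝ α x v ![u] := by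
  rw [extDeriv, ContinuousAlternatingMap.alternatizeUncurryFin_apply, Fin.sum_univ_two]
  have h0 : (0 : Fin 2).removeNth ![u, v] = ![v] := by ext i; fin_cases i; rfl
  have h1 : (1 : Fin 2).removeNth ![u, v] = ![u] := by ext i; fin_cases i; rfl
  rw [h0, h1]
  simp [sub_eq_add_neg]

theorem extDeriv_twoForm_apply (α : E → E [⋀^Fin 2]→L[ℝ] ℝ) (x u v w : E) :
    extDeriv α x ![u, v, w] =
      fderiv ℝ α x u ![v, w] - fderiv ℝ α x v ![u, w] + fderiv ℝ α x w ![u, v] := by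
  rw [extDeriv, ContinuousAlternatingMap.alternatizeUncurryFin_apply, Fin.sum_univ_three]
  have h0 : (0 : Fin 3).removeNth ![u, v, w] = ![v, w] := by ext i; fin_cases i <;> rfl
  have h1 : (1 : Fin 3).removeNth ![u, v, w] = ![u, w] := by ext i; fin_cases i <;> rfl
  have h2 : (2 : Fin 3).removeNth ![u, v, w] = ![u, v] := by ext i; fin_cases i <;> rfl
  rw [h0, h1, h2]
  simp [sub_eq_add_neg]

theorem alternating_ext_one {α β : E [⋀^Fin 1]→L[ℝ] ℝ} (h : ∀ u, α ![u] = β ![u]) : α = β := by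
  ext v
  have : v = ![v 0] := by ext i; fin_cases i; rfl
  rw [this, h]

theorem alternating_ext_two {α β : E [⋀^Fin 2]→L[ℝ] ℝ} (h : ∀ u v, α ![u, v] = β ![u, v]) :
    α = β := by
  ext v
  have : v = ![v 0, v 1] := by ext i; fin_cases i <;> rfl
  rw [this, h]

theorem alternating_ext_three {α β : E [⋀^Fin 3]→L[ℝ] ℝ}
    (h : ∀ u v w, α ![u, v, w] = β ![u, v, w]) : α = β := by
  ext v
  have : v = ![v 0, v 1, v 2] := by ext i; fin_cases i <;> rfl
  rw [this, h]

theorem alternating_add_left (α : E [⋀^Fin 2]→L[ℝ] ℝ) (u u' v : E) :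
    α ![u + u', v] = α ![u, v] + α ![u', v] := by
  exact congrArg (fun L : E [⋀^Fin 1]→L[ℝ] ℝ => L ![v]) (α.curryLeft.map_add u u')

theorem alternating_smul_left (α : E [⋀^Fin 2]→L[ℝ] ℝ) (c : ℝ) (u v : E) :
    α ![c • u, v] = c * α ![u, v] := by
  exact congrArg (fun L : E [⋀^Fin 1]→L[ℝ] ℝ => L ![v]) (α.curryLeft.map_smul c u)

theorem alternating_swap (α : E [⋀^Fin 2]→L[ℝ] ℝ) (u v : E) : α ![u, v] = -α ![v, u] := by
  have h := α.toAlternatingMap.map_swap ![v, u] (show (0 : Fin 2) ≠ 1 by decide)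
  have h2 : (![v, u] ∘ Equiv.swap (0 : Fin 2) 1) = ![u, v] := by
    ext i; fin_cases i <;> simp
  rw [h2] at h
  exact h

theorem alternating_add_right (α : E [⋀^Fin 2]→L[ℝ] ℝ) (u v v' : E) :
    α ![u, v + v'] = α ![u, v] + α ![u, v'] := by
  rw [alternating_swap, alternating_add_left, neg_add, ← alternating_swap, ← alternating_swap]

theorem alternating_smul_right (α : E [⋀^Fin 2]→L[ℝ] ℝ) (c : ℝ) (u v : E) :
    α ![u, c • v] = c * α ![u, v] := by
  rw [alternating_swap, alternating_smul_left, alternating_swap α u v]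
  ring

theorem alternating_self (α : E [⋀^Fin 2]→L[ℝ] ℝ) (u : E) : α ![u, u] = 0 := by
  have := alternating_swap α u u
  linarith

theorem alternating_zero_left (α : E [⋀^Fin 2]→L[ℝ] ℝ) (v : E) : α ![0, v] = 0 := by
  rw [← zero_smul ℝ (0 : E), alternating_smul_left, zero_mul]

theorem compContinuousLinearMap_two {E' : Type*} [NormedAddCommGroup E'] [NormedSpace ℝ E']
    (α : E [⋀^Fin 2]→L[ℝ] ℝ) (L : E' →L[ℝ] E) (u v : E') :
    α.compContinuousLinearMap L ![u, v] = α ![L u, L v] := by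
  rw [ContinuousAlternatingMap.compContinuousLinearMap_apply]
  congr 1
  ext i; fin_cases i <;> rfl

theorem compContinuousLinearMap_one {E' : Type*} [NormedAddCommGroup E'] [NormedSpace ℝ E']
    (α : E [⋀^Fin 1]→L[ℝ] ℝ) (L : E' →L[ℝ] E) (u : E') :
    α.compContinuousLinearMap L ![u] = α ![L u] := by
  rw [ContinuousAlternatingMap.compContinuousLinearMap_apply]
  congr 1
  ext i; fin_cases i; rfl

/-- The derivative of a component of a form along a line. -/
theorem hasDerivAt_form_line {k : ℕ} {α : E → E [⋀^Fin k]→L[ℝ] ℝ} {x u : E} {s : ℝ}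
    (h : DifferentiableAt ℝ α (x + s • u)) (v : Fin k → E) :
    HasDerivAt (fun t : ℝ => α (x + t • u) v) (fderiv ℝ α (x + s • u) u v) s := by
  have h1 : HasDerivAt (fun t : ℝ => x + t • u) u s := by
    simpa using ((hasDerivAt_id s).smul_const u).const_add x
  have h2 := h.hasFDerivAt.comp_hasDerivAt s h1
  exact (ContinuousAlternatingMap.apply ℝ E ℝ v).hasFDerivAt.comp_hasDerivAt s h2

end LowDegree

/-! ### The homotopy formula averaged over a circle -/

section LocalHomotopy

open Set Filter MeasureTheory

variable {E : Type*} [NormedAddCommGroup E] [NormedSpace ℝ E]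

/-- The contraction of a `2`-form on `ℝ × E` with the coordinate vector field of `ℝ`, restricted to
the slices `{s} × E`. -/
def sliceContract : (ℝ × E) [⋀^Fin 2]→L[ℝ] ℝ →L[ℝ] E [⋀^Fin 1]→L[ℝ] ℝ :=
  (ContinuousAlternatingMap.compContinuousLinearMapCLM (ContinuousLinearMap.inr ℝ ℝ E)) ∘L
    (ContinuousLinearMap.apply ℝ _ ((1 : ℝ), (0 : E))) ∘L
      (ContinuousAlternatingMap.curryLeftLI (n := 1) (𝕜 := ℝ) (E := ℝ × E)
        (F := ℝ)).toContinuousLinearMap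

theorem sliceContract_apply (α : (ℝ × E) [⋀^Fin 2]→L[ℝ] ℝ) (v : E) :
    sliceContract α ![v] = α ![(1, 0), (0, v)] := by
  change (α.curryLeft (1, 0)).compContinuousLinearMap (ContinuousLinearMap.inr ℝ ℝ E) ![v] = _
  rw [compContinuousLinearMap_one, ContinuousAlternatingMap.curryLeft_apply_apply]
  rfl

variable [FiniteDimensional ℝ E] {T : Set E} {Z : ℝ × E → (ℝ × E) [⋀^Fin 2]→L[ℝ] ℝ}

theorem contDiffOn_integral_sliceContract (hT : IsOpen T)
    (hZ : ContDiffOn ℝ ∞ Z (univ ×ˢ T)) :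
    ContDiffOn ℝ ∞ (fun y => ∫ s in (0:ℝ)..1, (1 - s) • sliceContract (Z (s, y))) T := by
  refine contDiffOn_intervalIntegral (G := fun p : ℝ × E => (1 - p.1) • sliceContract (Z p))
    hT 0 1 ?_
  exact ContDiffOn.smul (contDiff_const.sub contDiff_fst).contDiffOn
    (ContDiff.comp_contDiffOn (g := ⇑(sliceContract (E := E))) (ContinuousLinearMap.contDiff _) hZ)

/-- For a closed `2`-form `Z` on `ℝ × E`, the form `∫₀¹ (1 - s) ι_{∂ₛ} Z ds` on `E` is a primitive
of the difference between the average of `Z` over the slices `{s} × E`, `0 ≤ s ≤ 1`, and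
its restriction to `{0} × E`. -/
theorem extDeriv_integral_sliceContract (hT : IsOpen T) (hZ : ContDiffOn ℝ ∞ Z (univ ×ˢ T))
    (hclosed : ∀ s : ℝ, ∀ y ∈ T, extDeriv Z (s, y) = 0) {y : E} (hy : y ∈ T) (u v : E) :
    extDeriv (fun y => ∫ s in (0:ℝ)..1, (1 - s) • sliceContract (Z (s, y))) y ![u, v] =
      (∫ s in (0:ℝ)..1, Z (s, y) ![(0, u), (0, v)]) - Z (0, y) ![(0, u), (0, v)] := by
  set G := fun p : ℝ × E => (1 - p.1) • sliceContract (Z p) with hGdef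
  have hG : ContDiffOn ℝ ∞ G (univ ×ˢ T) :=
    ContDiffOn.smul (contDiff_const.sub contDiff_fst).contDiffOn
      (ContDiff.comp_contDiffOn (g := ⇑(sliceContract (E := E))) (ContinuousLinearMap.contDiff _) hZ)
  have hdZ : ∀ s, DifferentiableAt ℝ Z (s, y) := fun s =>
    (contDiffAt_of_contDiffOn_prod hT hZ hy).differentiableAt (by simp)
  have hfd : ∀ s w, fderivSnd G (s, y) w = (1 - s) • sliceContract (fderiv ℝ Z (s, y) (0, w)) := by
    intro s w
    have h1 : HasFDerivAt (fun z => G (s, z)) ((1 - s) • (sliceContract ∘L fderivSnd Z (s, y))) y :=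
      (sliceContract.hasFDerivAt.comp y (hasFDerivAt_comp_prodMk hT hZ hy)).const_smul (1 - s)
    rw [(hasFDerivAt_comp_prodMk hT hG hy).unique h1]
    rfl
  have hcont : Continuous fun s => fderivSnd G (s, y) :=
    continuous_of_contDiffOn_prod hT (contDiffOn_fderivSnd hT hG) hy
  have hint : ∀ w w' : E, (∫ s in (0:ℝ)..1, fderivSnd G (s, y)) w ![w'] =
      ∫ s in (0:ℝ)..1, (1 - s) * fderiv ℝ Z (s, y) (0, w) ![(1, 0), (0, w')] := by
    intro w w'
    have h1 := ((ContinuousAlternatingMap.apply ℝ E ℝ ![w']) ∘L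
      (ContinuousLinearMap.apply ℝ (E [⋀^Fin 1]→L[ℝ] ℝ) w)).intervalIntegral_comp_comm
      (hcont.intervalIntegrable (μ := volume) 0 1)
    refine h1.symm.trans ?_
    congr 1
    ext s
    change fderivSnd G (s, y) w ![w'] = _
    rw [hfd, ContinuousAlternatingMap.smul_apply, sliceContract_apply, smul_eq_mul]
  have hcontZ : ∀ w w', Continuous fun s => fderiv ℝ Z (s, y) (0, w) ![(1, 0), (0, w')] := by
    intro w w'
    have h1 := continuous_of_contDiffOn_prod hT
      (hZ.fderiv_of_isOpen (m := ∞) (isOpen_univ.prod hT) (by simp)) hy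
    exact ((ContinuousAlternatingMap.apply ℝ (ℝ × E) ℝ ![((1:ℝ), (0:E)), (0, w')]) ∘L
      (ContinuousLinearMap.apply ℝ ((ℝ × E) [⋀^Fin 2]→L[ℝ] ℝ) ((0 : ℝ), w))).continuous.comp h1
  rw [extDeriv_oneForm_apply, (hasFDerivAt_intervalIntegral hT hG 0 1 hy).fderiv, hint, hint,
    ← intervalIntegral.integral_sub]
  rotate_left
  · exact ((by fun_prop : Continuous fun s : ℝ => 1 - s).mul (hcontZ u v)).intervalIntegrable _ _
  · exact ((by fun_prop : Continuous fun s : ℝ => 1 - s).mul (hcontZ v u)).intervalIntegrable _ _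
  set g : ℝ → ℝ := fun s => Z (s, y) ![(0, u), (0, v)] with hg
  have hg' : ∀ s, HasDerivAt g (fderiv ℝ Z (s, y) (1, 0) ![(0, u), (0, v)]) s := by
    intro s
    have h1 := hasDerivAt_form_line (α := Z) (x := (0, y)) (u := ((1:ℝ), (0:E))) (s := s)
      (by simpa using hdZ s) ![(0, u), (0, v)]
    simpa using h1
  have hgc : Continuous g := continuous_iff_continuousAt.2 fun s => (hg' s).continuousAt
  have hrew : ∀ s, (1 - s) * fderiv ℝ Z (s, y) (0, u) ![(1, 0), (0, v)] -
      (1 - s) * fderiv ℝ Z (s, y) (0, v) ![(1, 0), (0, u)] =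
      (1 - s) * fderiv ℝ Z (s, y) (1, 0) ![(0, u), (0, v)] := by
    intro s
    have h1 := extDeriv_twoForm_apply Z (s, y) (1, 0) (0, u) (0, v)
    rw [hclosed s y hy] at h1
    have h2 : fderiv ℝ Z (s, y) (1, 0) ![(0, u), (0, v)] =
      fderiv ℝ Z (s, y) (0, u) ![(1, 0), (0, v)] -
        fderiv ℝ Z (s, y) (0, v) ![(1, 0), (0, u)] := by
      have h3 : (0 : (ℝ × E) [⋀^Fin 3]→L[ℝ] ℝ) ![(1, 0), (0, u), (0, v)] = 0 := rfl
      linarith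
    rw [h2]; ring
  simp only [hrew]
  have hprim : ∀ s, HasDerivAt (fun s => (1 - s) * g s)
      ((1 - s) * fderiv ℝ Z (s, y) (1, 0) ![(0, u), (0, v)] - g s) s := by
    intro s
    exact (((hasDerivAt_id s).const_sub 1).mul (hg' s)).congr_deriv (by simp; ring)
  have hcd : Continuous fun s => (1 - s) * fderiv ℝ Z (s, y) (1, 0) ![(0, u), (0, v)] := by
    refine Continuous.congr (f := fun s => (1 - s) * fderiv ℝ Z (s, y) (0, u) ![(1, 0), (0, v)] -
      (1 - s) * fderiv ℝ Z (s, y) (0, v) ![(1, 0), (0, u)]) ?_ hrew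
    have := hcontZ u v
    have := hcontZ v u
    fun_prop
  have hFTC := intervalIntegral.integral_eq_sub_of_hasDerivAt (a := 0) (b := 1)
    (fun s _ => hprim s) ((hcd.sub hgc).intervalIntegrable _ _)
  rw [intervalIntegral.integral_sub (hcd.intervalIntegrable _ _) (hgc.intervalIntegrable _ _)]
    at hFTC
  have h0 : g 0 = Z (0, y) ![(0, u), (0, v)] := rfl
  rw [← h0]
  linarith

end LocalHomotopy


/-! ### The operator `dᶜ` on complex vector spaces -/

section LocalDc

open Set Filter

variable {E : Type*} [NormedAddCommGroup E] [NormedSpace ℂ E]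

variable (E) in
/-- The complex structure as a real continuous linear map. -/
def cplxJL : E →L[ℝ] E := (Complex.I • ContinuousLinearMap.id ℂ E).restrictScalars ℝ

theorem cplxJ_smul (c : ℝ) (u : E) : cplxJ (c • u) = c • cplxJ u := (cplxJL E).map_smul c u

variable (E) in
/-- The linear map which sends a linear form `L` to the `1`-form `v ↦ -L (J v)`. -/
def dcCLM : (E →L[ℝ] ℝ) →L[ℝ] E [⋀^Fin 1]→L[ℝ] ℝ :=
  (ContinuousAlternatingMap.ofSubsingletonLIE (𝕜 := ℝ) (E := E) (F := ℝ)
    (0 : Fin 1)).toContinuousLinearEquiv.toContinuousLinearMap ∘L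
      (-((ContinuousLinearMap.compL ℝ E E ℝ).flip (cplxJL E)))

theorem dcCLM_apply (L : E →L[ℝ] ℝ) (v : E) : dcCLM E L ![v] = -L (cplxJ v) := rfl

/-- The `1`-form `dᶜg = -dg ∘ J` of a function on a complex vector space. -/
def dcLocal (g : E → ℝ) (y : E) : E [⋀^Fin 1]→L[ℝ] ℝ := dcCLM E (fderiv ℝ g y)

theorem dcLocal_apply (g : E → ℝ) (y v : E) : dcLocal g y ![v] = -fderiv ℝ g y (cplxJ v) := rfl

theorem contDiffAt_dcLocal {g : E → ℝ} {y : E} (hg : ContDiffAt ℝ ∞ g y) :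
    ContDiffAt ℝ ∞ (dcLocal g) y :=
  ContDiffAt.comp (g := dcCLM E) (f := fderiv ℝ g) y (ContinuousLinearMap.contDiff _).contDiffAt
    (hg.fderiv_right (m := ∞) (by simp))

theorem differentiableAt_fderiv {E : Type*} [NormedAddCommGroup E] [NormedSpace ℝ E]
    {g : E → ℝ} {y : E} (hg : ContDiffAt ℝ ∞ g y) : DifferentiableAt ℝ (fderiv ℝ g) y :=
  (hg.fderiv_right (m := ∞) (by simp)).differentiableAt (by simp)

theorem fderiv_fderiv_comm {E : Type*} [NormedAddCommGroup E] [NormedSpace ℝ E]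
    {g : E → ℝ} {y : E} (hg : ContDiffAt ℝ ∞ g y) (u v : E) :
    fderiv ℝ (fderiv ℝ g) y u v = fderiv ℝ (fderiv ℝ g) y v u :=
  (hg.isSymmSndFDerivAt two_le_infty).eq u v

theorem ddc_apply {g : E → ℝ} {y : E} (hg : ContDiffAt ℝ ∞ g y) (u v : E) :
    extDeriv (dcLocal g) y ![u, v] =
      fderiv ℝ (fderiv ℝ g) y v (cplxJ u) - fderiv ℝ (fderiv ℝ g) y u (cplxJ v) := by
  have h : fderiv ℝ (dcLocal g) y = dcCLM E ∘L fderiv ℝ (fderiv ℝ g) y :=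
    ((dcCLM E).hasFDerivAt.comp y (differentiableAt_fderiv hg).hasFDerivAt).fderiv
  rw [extDeriv_oneForm_apply, h]
  simp only [ContinuousLinearMap.comp_apply, dcCLM_apply]
  ring

/-- The form `ddᶜg` is of type `(1,1)`. -/
theorem ddc_cplxJ {g : E → ℝ} {y : E} (hg : ContDiffAt ℝ ∞ g y) (u v : E) :
    extDeriv (dcLocal g) y ![cplxJ u, cplxJ v] = extDeriv (dcLocal g) y ![u, v] := by
  rw [ddc_apply hg, ddc_apply hg, cplxJ_cplxJ, cplxJ_cplxJ, map_neg, map_neg,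
    fderiv_fderiv_comm hg (cplxJ v) u, fderiv_fderiv_comm hg (cplxJ u) v]
  ring

theorem ddc_add {g h : E → ℝ} {y : E} (hg : ContDiffAt ℝ ∞ g y) (hh : ContDiffAt ℝ ∞ h y) :
    extDeriv (dcLocal (g + h)) y = extDeriv (dcLocal g) y + extDeriv (dcLocal h) y := by
  have h1 : dcLocal (g + h) =ᶠ[𝓝 y] dcLocal g + dcLocal h := by
    filter_upwards [(contMDiffAt_iff_contMDiffAt_nhds (n := 1) (by simp)).1
      (contMDiffAt_iff_contDiffAt.2 (hg.of_le (by simp))),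
      (contMDiffAt_iff_contMDiffAt_nhds (n := 1) (by simp)).1
      (contMDiffAt_iff_contDiffAt.2 (hh.of_le (by simp)))] with z hz hz'
    rw [contMDiffAt_iff_contDiffAt] at hz hz'
    simp only [dcLocal, Pi.add_apply]
    rw [fderiv_add (hz.differentiableAt (by simp)) (hz'.differentiableAt (by simp)), map_add]
  rw [h1.extDeriv_eq, extDeriv_add ((contDiffAt_dcLocal hg).differentiableAt (by simp))
    ((contDiffAt_dcLocal hh).differentiableAt (by simp))]

theorem ddc_congr {g h : E → ℝ} {y : E} (hgh : g =ᶠ[𝓝 y] h) :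
    extDeriv (dcLocal g) y = extDeriv (dcLocal h) y := by
  refine Filter.EventuallyEq.extDeriv_eq ?_
  filter_upwards [hgh.fderiv (𝕜 := ℝ)] with z hz
  rw [dcLocal, dcLocal, hz]

theorem ddc_const (c : ℝ) (y : E) : extDeriv (dcLocal fun _ : E => c) y = 0 := by
  refine alternating_ext_two fun u v => ?_
  rw [ddc_apply contDiffAt_const]
  have : fderiv ℝ (fun _ : E => c) = fun _ => 0 := by ext; simp
  rw [this]
  simp

end LocalDc

/-! ### Kähler forms on a cylinder have global potentials -/

section Cylinder

open Set Filter

variable {V : Type*} [NormedAddCommGroup V] [NormedSpace ℂ V]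

theorem prod_decomp (u : ℂ × V) :
    u = u.1.re • ((1 : ℂ), (0 : V)) + (u.1.im • (Complex.I, (0 : V)) + ((0 : ℂ), u.2)) := by
  ext1
  · simp [Complex.re_add_im]
  · simp

theorem twoForm_decomp (α : (ℂ × V) [⋀^Fin 2]→L[ℝ] ℝ) (u v : ℂ × V) :
    α ![u, v] = (u.1.re * v.1.im - u.1.im * v.1.re) * α ![(1, 0), (Complex.I, 0)] +
      u.1.re * α ![(1, 0), (0, v.2)] - v.1.re * α ![(1, 0), (0, u.2)] +
      u.1.im * α ![(Complex.I, 0), (0, v.2)] - v.1.im * α ![(Complex.I, 0), (0, u.2)] +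
      α ![(0, u.2), (0, v.2)] := by
  conv_lhs => rw [prod_decomp u, prod_decomp v]
  simp only [alternating_add_left, alternating_add_right, alternating_smul_left,
    alternating_smul_right, alternating_self]
  rw [alternating_swap α (Complex.I, 0) (1, 0), alternating_swap α (0, u.2) (1, 0),
    alternating_swap α (0, u.2) (Complex.I, 0)]
  ring

theorem hasDerivAt_line_re {k : ℕ} {K : ℂ × V → (ℂ × V) [⋀^Fin k]→L[ℝ] ℝ} {y : V} {s : ℝ}
    (h : DifferentiableAt ℝ K ((s : ℂ), y)) (v : Fin k → ℂ × V) :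
    HasDerivAt (fun t : ℝ => K ((t : ℂ), y) v) (fderiv ℝ K ((s : ℂ), y) (1, 0) v) s := by
  have he : ∀ t : ℝ, ((0 : ℂ), y) + t • ((1 : ℂ), (0 : V)) = ((t : ℂ), y) := fun t => by
    ext1 <;> simp
  have h1 := hasDerivAt_form_line (α := K) (x := ((0 : ℂ), y)) (u := ((1:ℂ), (0:V))) (s := s)
      (by rwa [he]) v
  simpa only [he] using h1

theorem fderiv_imaginary_eq_zero {F : Type*} [NormedAddCommGroup F] [NormedSpace ℝ F]
    {T : Set V} {K : ℂ × V → F} {ζ : ℂ} {y : V}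
    (hy : y ∈ T) (hd : DifferentiableAt ℝ K (ζ, y))
    (hinv : ∀ (ζ : ℂ) (θ : ℝ), ∀ y ∈ T, K (ζ + θ * Complex.I, y) = K (ζ, y)) :
    fderiv ℝ K (ζ, y) (Complex.I, 0) = 0 := by
  have h1 : HasDerivAt (fun t : ℝ => (ζ, y) + t • (Complex.I, (0 : V))) (Complex.I, 0) 0 := by
    simpa using ((hasDerivAt_id (0 : ℝ)).smul_const (Complex.I, (0 : V))).const_add (ζ, y)
  have h2 := HasFDerivAt.comp_hasDerivAt (0 : ℝ) (f := fun t : ℝ => (ζ, y) + t • (Complex.I, (0:V)))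
    (l := K) (l' := fderiv ℝ K (ζ, y)) (by simpa using hd.hasFDerivAt) h1
  have h3 : (K ∘ fun t : ℝ => (ζ, y) + t • (Complex.I, (0:V))) = fun _ => K (ζ, y) := by
    funext t
    simp only [Function.comp_apply]
    rw [← hinv ζ t y hy]
    congr 1
    ext1 <;> simp
  rw [h3] at h2
  exact h2.unique (hasDerivAt_const _ _)

variable {T : Set V}

/-- A closed `2`-form on `ℂ × T` of type `(1,1)`, invariant under imaginary translations, vanishes
if its coefficient along `ℂ` and its restriction to `{0} × T` vanish, where the restriction is
also contracted with the imaginary direction. -/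
theorem eq_zero_of_closed_of_invariant (hT : IsOpen T) {K : ℂ × V → (ℂ × V) [⋀^Fin 2]→L[ℝ] ℝ}
    (hd : ∀ ζ : ℂ, ∀ y ∈ T, DifferentiableAt ℝ K (ζ, y))
    (hclosed : ∀ ζ : ℂ, ∀ y ∈ T, extDeriv K (ζ, y) = 0)
    (hJ : ∀ ζ : ℂ, ∀ y ∈ T, ∀ u v, K (ζ, y) ![cplxJ u, cplxJ v] = K (ζ, y) ![u, v])
    (hinv : ∀ (ζ : ℂ) (θ : ℝ), ∀ y ∈ T, K (ζ + θ * Complex.I, y) = K (ζ, y))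
    (h1 : ∀ ζ : ℂ, ∀ y ∈ T, K (ζ, y) ![(1, 0), (Complex.I, 0)] = 0)
    (h2 : ∀ y ∈ T, ∀ v, K (0, y) ![(Complex.I, 0), (0, v)] = 0)
    (h3 : ∀ y ∈ T, ∀ u v, K (0, y) ![(0, u), (0, v)] = 0) (ζ : ℂ) {y : V} (hy : y ∈ T) :
    K (ζ, y) = 0 := by
  -- The components which vanish identically have vanishing derivatives.
  have hzero : ∀ w w' : ℂ × V, (∀ ζ : ℂ, ∀ y ∈ T, K (ζ, y) ![w, w'] = 0) →
      ∀ ζ : ℂ, ∀ y ∈ T, ∀ e, fderiv ℝ K (ζ, y) e ![w, w'] = 0 := by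
    intro w w' h ζ y hy e
    have h4 := (ContinuousAlternatingMap.apply ℝ (ℂ × V) ℝ ![w, w']).hasFDerivAt.comp (ζ, y)
      (hd ζ y hy).hasFDerivAt
    have h5 : ((ContinuousAlternatingMap.apply ℝ (ℂ × V) ℝ ![w, w']) ∘ K) =ᶠ[𝓝 (ζ, y)]
        fun _ => 0 := by
      filter_upwards [(isOpen_univ.prod hT).mem_nhds (⟨mem_univ ζ, hy⟩ : (ζ, y) ∈ univ ×ˢ T)]
        with p hp using h p.1 p.2 hp.2
    have h6 := (h4.congr_of_eventuallyEq h5.symm).unique (hasFDerivAt_const (0 : ℝ) (ζ, y))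
    exact congrArg (fun L : ℂ × V →L[ℝ] ℝ => L e) h6
  have hdI : ∀ ζ : ℂ, ∀ y ∈ T, fderiv ℝ K (ζ, y) (Complex.I, 0) = 0 := fun ζ y hy =>
    fderiv_imaginary_eq_zero hy (hd ζ y hy) hinv
  -- A component with vanishing derivative along the real direction is determined at `0`.
  have hconst : ∀ w w' : ℂ × V, (∀ ζ : ℂ, ∀ y ∈ T, fderiv ℝ K (ζ, y) (1, 0) ![w, w'] = 0) →
      ∀ ζ : ℂ, ∀ y ∈ T, K (ζ, y) ![w, w'] = K (0, y) ![w, w'] := by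
    intro w w' h ζ y hy
    have hder : ∀ t : ℝ, HasDerivAt (fun t : ℝ => K ((t : ℂ), y) ![w, w']) 0 t := fun t => by
      have := hasDerivAt_line_re (hd (t : ℂ) y hy) ![w, w']
      rwa [h (t : ℂ) y hy] at this
    have hc := is_const_of_deriv_eq_zero (fun t => (hder t).differentiableAt)
      (fun t => (hder t).deriv) ζ.re 0
    have h4 := hinv ζ.re ζ.im y hy
    rw [Complex.re_add_im] at h4
    rw [h4]
    simpa using hc
  have hcl : ∀ ζ : ℂ, ∀ y ∈ T, ∀ a b c, fderiv ℝ K (ζ, y) a ![b, c] -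
      fderiv ℝ K (ζ, y) b ![a, c] + fderiv ℝ K (ζ, y) c ![a, b] = 0 := by
    intro ζ y hy a b c
    rw [← extDeriv_twoForm_apply, hclosed ζ y hy]
    rfl
  have k2 : ∀ v, ∀ ζ : ℂ, ∀ y ∈ T, K (ζ, y) ![(Complex.I, 0), (0, v)] = 0 := by
    intro v ζ y hy
    rw [hconst _ _ _ ζ y hy, h2 y hy]
    intro ζ y hy
    have h4 := hcl ζ y hy (1, 0) (Complex.I, 0) (0, v)
    rw [hdI ζ y hy, hzero _ _ h1 ζ y hy] at h4
    have h5 : (0 : (ℂ × V) [⋀^Fin 2]→L[ℝ] ℝ) ![(1, 0), (0, v)] = 0 := rfl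
    linarith
  have k3 : ∀ v, ∀ ζ : ℂ, ∀ y ∈ T, K (ζ, y) ![(1, 0), (0, v)] = 0 := by
    intro v ζ y hy
    rw [← hJ ζ y hy]
    have e1 : cplxJ ((1 : ℂ), (0 : V)) = (Complex.I, 0) := by simp [cplxJ]
    have e2 : cplxJ ((0 : ℂ), v) = (0, cplxJ v) := by simp [cplxJ]
    rw [e1, e2, k2 _ ζ y hy]
  have k4 : ∀ u v, ∀ ζ : ℂ, ∀ y ∈ T, K (ζ, y) ![(0, u), (0, v)] = 0 := by
    intro u v ζ y hy
    rw [hconst _ _ _ ζ y hy, h3 y hy]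
    intro ζ y hy
    have h4 := hcl ζ y hy (1, 0) (0, u) (0, v)
    rw [hzero _ _ (k3 v) ζ y hy, hzero _ _ (k3 u) ζ y hy] at h4
    linarith
  refine alternating_ext_two fun u v => ?_
  rw [twoForm_decomp, h1 ζ y hy, k2 _ ζ y hy, k2 _ ζ y hy, k3 _ ζ y hy, k3 _ ζ y hy,
    k4 _ _ ζ y hy]
  have h5 : (0 : (ℂ × V) [⋀^Fin 2]→L[ℝ] ℝ) ![u, v] = 0 := rfl
  rw [h5]; ring

/-- The projection of `ℂ × V` to `{0} × V`. -/
def sndProj (V : Type*) [NormedAddCommGroup V] [NormedSpace ℂ V] : ℂ × V →L[ℝ] ℂ × V :=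
  ContinuousLinearMap.inr ℝ ℂ V ∘L ContinuousLinearMap.snd ℝ ℂ V

theorem sndProj_apply (p : ℂ × V) : sndProj V p = (0, p.2) := rfl

theorem ddc_fst_apply {g : ℂ × V → ℝ} {p : ℂ × V} (hg : ContDiffAt ℝ ∞ g p)
    (hI : ∀ e, fderiv ℝ (fderiv ℝ g) p (Complex.I, 0) e = 0) :
    extDeriv (dcLocal g) p ![(1, 0), (Complex.I, 0)] = fderiv ℝ (fderiv ℝ g) p (1, 0) (1, 0) ∧
    ∀ v, extDeriv (dcLocal g) p ![(Complex.I, 0), (0, v)] =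
      -fderiv ℝ (fderiv ℝ g) p (0, v) (1, 0) := by
  have e1 : cplxJ ((1 : ℂ), (0 : V)) = (Complex.I, 0) := by simp [cplxJ]
  have e2 : cplxJ (Complex.I, (0 : V)) = -((1 : ℂ), (0 : V)) := by rw [← e1, cplxJ_cplxJ]
  constructor
  · rw [ddc_apply hg, e1, e2, hI, map_neg]; ring
  · intro v
    rw [ddc_apply hg, e2, hI, map_neg]; ring

/-- On `ℂ × T`, a closed `(1,1)`-form `Z` invariant under imaginary translations is the sum of the
pullback of its restriction to `{0} × T` and of `ddᶜg`, for every invariant function `g` vanishing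
on `{0} × T` which solves the equations `∂ₜ²g = Z(∂ₜ, ∂_θ)` and `d(∂ₜg) = -ι_{∂_θ} Z` on
`{0} × T`. -/
theorem eq_restriction_add_ddc (hT : IsOpen T) {Z : ℂ × V → (ℂ × V) [⋀^Fin 2]→L[ℝ] ℝ}
    (hZ : ∀ ζ : ℂ, ∀ y ∈ T, ContDiffAt ℝ ∞ Z (ζ, y))
    (hclosed : ∀ ζ : ℂ, ∀ y ∈ T, extDeriv Z (ζ, y) = 0)
    (hJ : ∀ ζ : ℂ, ∀ y ∈ T, ∀ u v, Z (ζ, y) ![cplxJ u, cplxJ v] = Z (ζ, y) ![u, v])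
    (hinv : ∀ (ζ : ℂ) (θ : ℝ), ∀ y ∈ T, Z (ζ + θ * Complex.I, y) = Z (ζ, y))
    {g : ℂ × V → ℝ} (hg : ∀ ζ : ℂ, ∀ y ∈ T, ContDiffAt ℝ ∞ g (ζ, y))
    (hginv : ∀ (ζ : ℂ) (θ : ℝ), ∀ y ∈ T, g (ζ + θ * Complex.I, y) = g (ζ, y))
    (hg1 : ∀ ζ : ℂ, ∀ y ∈ T, fderiv ℝ (fderiv ℝ g) (ζ, y) (1, 0) (1, 0) =
      Z (ζ, y) ![(1, 0), (Complex.I, 0)])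
    (hg2 : ∀ y ∈ T, ∀ v, fderiv ℝ (fderiv ℝ g) (0, y) (0, v) (1, 0) =
      -Z (0, y) ![(Complex.I, 0), (0, v)])
    (hg3 : ∀ y ∈ T, g (0, y) = 0) (ζ : ℂ) {y : V} (hy : y ∈ T) :
    Z (ζ, y) = (Z (0, y)).compContinuousLinearMap (sndProj V) + extDeriv (dcLocal g) (ζ, y) := by
  have hfinv : ∀ (ζ : ℂ) (θ : ℝ), ∀ y ∈ T,
      fderiv ℝ g (ζ + θ * Complex.I, y) = fderiv ℝ g (ζ, y) := by
    intro ζ θ y hy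
    have h1 : (fun p => g (p + (θ * Complex.I, 0))) =ᶠ[𝓝 (ζ, y)] g := by
      filter_upwards [(isOpen_univ.prod hT).mem_nhds (⟨mem_univ ζ, hy⟩ : (ζ, y) ∈ univ ×ˢ T)]
        with p hp
      rw [← hginv p.1 θ p.2 hp.2]
      congr 1
      ext1 <;> simp
    rw [← h1.fderiv_eq, fderiv_comp_add_right]
    simp
  have hfI : ∀ ζ : ℂ, ∀ y ∈ T, ∀ e, fderiv ℝ (fderiv ℝ g) (ζ, y) (Complex.I, 0) e = 0 := by
    intro ζ y hy e
    rw [fderiv_imaginary_eq_zero hy (differentiableAt_fderiv (hg ζ y hy)) hfinv]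
    rfl
  have hdcinv : ∀ (ζ : ℂ) (θ : ℝ), ∀ y ∈ T, extDeriv (dcLocal g) (ζ + θ * Complex.I, y) =
      extDeriv (dcLocal g) (ζ, y) := by
    intro ζ θ y hy
    have h1 : (fun p => dcLocal g (p + (θ * Complex.I, 0))) =ᶠ[𝓝 (ζ, y)] dcLocal g := by
      filter_upwards [(isOpen_univ.prod hT).mem_nhds (⟨mem_univ ζ, hy⟩ : (ζ, y) ∈ univ ×ˢ T)]
        with p hp
      rw [dcLocal, dcLocal, ← hfinv p.1 θ p.2 hp.2]
      congr 2
      ext1 <;> simp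
    rw [← h1.extDeriv_eq, extDeriv, extDeriv, fderiv_comp_add_right]
    simp
  -- The restriction to `{0} × T`, pulled back to `ℂ × T`.
  set Z0 : ℂ × V → (ℂ × V) [⋀^Fin 2]→L[ℝ] ℝ := fun p =>
    (Z (sndProj V p)).compContinuousLinearMap (fderiv ℝ (sndProj V) p) with hZ0
  have hZ0e : ∀ p, Z0 p = (Z (0, p.2)).compContinuousLinearMap (sndProj V) := fun p => by
    rw [hZ0]; simp only [ContinuousLinearMap.fderiv, sndProj_apply]
  have hZ0d : ∀ ζ : ℂ, ∀ y ∈ T, extDeriv Z0 (ζ, y) = 0 := by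
    intro ζ y hy
    have h := _root_.extDeriv_pullback (r := ∞) (f := sndProj V) (x := (ζ, y))
      (show DifferentiableAt ℝ Z (sndProj V (ζ, y)) from (hZ 0 y hy).differentiableAt (by simp)) (sndProj V).contDiff.contDiffAt two_le_infty
    refine h.trans ?_
    have h0 : extDeriv Z (sndProj V (ζ, y)) = 0 := hclosed 0 y hy
    rw [h0]
    ext v; rfl
  have hZ0s : ∀ ζ : ℂ, ∀ y ∈ T, DifferentiableAt ℝ Z0 (ζ, y) := by
    intro ζ y hy
    refine (contDiffAt_compContinuousLinearMap (n := ∞) (ContDiffAt.comp (ζ, y) (g := Z)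
      (hZ 0 y hy) (sndProj V).contDiff.contDiffAt) ?_).differentiableAt (by simp)
    have h : fderiv ℝ (sndProj V) = fun _ => sndProj V := funext fun p => (sndProj V).fderiv
    rw [h]
    exact contDiffAt_const
  have hdd : ∀ ζ : ℂ, ∀ y ∈ T, DifferentiableAt ℝ (extDeriv (dcLocal g)) (ζ, y) := fun ζ y hy =>
    (contDiffAt_extDeriv (contDiffAt_dcLocal (hg ζ y hy))).differentiableAt (by simp)
  set K := Z - Z0 - extDeriv (dcLocal g) with hK
  have hKa : ∀ p u v, K p ![u, v] = Z p ![u, v] - Z (0, p.2) ![(0, u.2), (0, v.2)] -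
      extDeriv (dcLocal g) p ![u, v] := by
    intro p u v
    have h1 : Z0 p ![u, v] = Z (0, p.2) ![(0, u.2), (0, v.2)] := by
      rw [hZ0e, compContinuousLinearMap_two]; rfl
    rw [← h1]
    rfl
  have hmain := eq_zero_of_closed_of_invariant hT (K := K)
    (fun ζ y hy => (((hZ ζ y hy).differentiableAt (by simp)).sub (hZ0s ζ y hy)).sub (hdd ζ y hy))
    ?_ ?_ ?_ ?_ ?_ ?_ ζ hy
  · have h1 : Z (ζ, y) - Z0 (ζ, y) - extDeriv (dcLocal g) (ζ, y) = 0 := hmain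
    rw [← hZ0e (ζ, y), ← sub_eq_zero, ← sub_sub, h1]
  · intro ζ y hy
    have h1 : fderiv ℝ K (ζ, y) = fderiv ℝ Z (ζ, y) - fderiv ℝ Z0 (ζ, y) -
        fderiv ℝ (extDeriv (dcLocal g)) (ζ, y) := by
      rw [hK, fderiv_sub (((hZ ζ y hy).differentiableAt (by simp)).sub (hZ0s ζ y hy))
        (hdd ζ y hy), fderiv_sub ((hZ ζ y hy).differentiableAt (by simp)) (hZ0s ζ y hy)]
    refine alternating_ext_three fun u v w => ?_
    have a1 := extDeriv_twoForm_apply Z (ζ, y) u v w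
    have a2 := extDeriv_twoForm_apply Z0 (ζ, y) u v w
    have a3 := extDeriv_twoForm_apply (extDeriv (dcLocal g)) (ζ, y) u v w
    rw [hclosed ζ y hy] at a1
    rw [hZ0d ζ y hy] at a2
    rw [extDeriv_extDeriv_apply (contDiffAt_dcLocal (hg ζ y hy)) two_le_infty] at a3
    rw [extDeriv_twoForm_apply, h1]
    have a0 : (0 : (ℂ × V) [⋀^Fin 3]→L[ℝ] ℝ) ![u, v, w] = 0 := rfl
    simp only [_root_.sub_apply, ContinuousAlternatingMap.sub_apply]
    linarith
  · intro ζ y hy u v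
    have e2 : ∀ v : ℂ × V, ((0 : ℂ), (cplxJ v).2) = cplxJ (0, v.2) := fun v => by simp [cplxJ]
    rw [hKa, hKa, hJ ζ y hy, ddc_cplxJ (hg ζ y hy), e2, e2]
    rw [hJ 0 y hy]
  · intro ζ θ y hy
    refine alternating_ext_two fun u v => ?_
    rw [hKa, hKa, hinv ζ θ y hy, hdcinv ζ θ y hy]
  · intro ζ y hy
    rw [hKa, (ddc_fst_apply (hg ζ y hy) (hfI ζ y hy)).1, hg1 ζ y hy, alternating_self]
    ring
  · intro y hy v
    rw [hKa, (ddc_fst_apply (hg 0 y hy) (hfI 0 y hy)).2, hg2 y hy]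
    have h1 : Z (0, y) ![(0, (0 : V)), (0, v)] = 0 := alternating_zero_left _ _
    simp only at h1 ⊢
    rw [h1]; ring
  · intro y hy u v
    rw [hKa, ddc_apply (hg 0 y hy)]
    -- The function vanishes on `{0} × T`, so its second derivatives along it vanish.
    have hf0 : ∀ y ∈ T, ∀ v, fderiv ℝ g (0, y) (0, v) = 0 := by
      intro y hy v
      have h1 := ((hg 0 y hy).differentiableAt (by simp)).hasFDerivAt.comp y
        (hasFDerivAt_prodMk_right (𝕜 := ℝ) (0 : ℂ) y)
      have h2 : (g ∘ fun y => ((0 : ℂ), y)) =ᶠ[𝓝 y] fun _ => 0 := by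
        filter_upwards [hT.mem_nhds hy] with z hz using hg3 z hz
      have h3 := (h1.congr_of_eventuallyEq h2.symm).unique (hasFDerivAt_const (0:ℝ) y)
      exact congrArg (fun L : V →L[ℝ] ℝ => L v) h3
    have hff0 : ∀ u v, fderiv ℝ (fderiv ℝ g) (0, y) (0, u) (0, v) = 0 := by
      intro u v
      have h0 := (differentiableAt_fderiv (hg 0 y hy)).hasFDerivAt.comp y
        (hasFDerivAt_prodMk_right (𝕜 := ℝ) (0 : ℂ) y)
      have h1 := (ContinuousLinearMap.apply ℝ ℝ ((0 : ℂ), v)).hasFDerivAt.comp y h0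
      have h2 : (fun y => fderiv ℝ g ((0 : ℂ), y) (0, v)) =ᶠ[𝓝 y] fun _ => 0 := by
        filter_upwards [hT.mem_nhds hy] with z hz using hf0 z hz v
      have h3 := (h1.congr_of_eventuallyEq h2.symm).unique (hasFDerivAt_const (0:ℝ) y)
      exact congrArg (fun L : V →L[ℝ] ℝ => L u) h3
    have e2 : ∀ v : V, cplxJ ((0 : ℂ), v) = (0, cplxJ v) := fun v => by simp [cplxJ]
    rw [e2, e2, hff0, hff0]
    simp

/-- The contraction of an invariant closed `2`-form with the imaginary direction is closed on
`{0} × T`. -/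
theorem fderiv_contract_symm {Z : ℂ × V → (ℂ × V) [⋀^Fin 2]→L[ℝ] ℝ} {y : V} (hy : y ∈ T)
    (hd : DifferentiableAt ℝ Z (0, y)) (hclosed : extDeriv Z (0, y) = 0)
    (hinv : ∀ (ζ : ℂ) (θ : ℝ), ∀ y ∈ T, Z (ζ + θ * Complex.I, y) = Z (ζ, y)) (u v : V) :
    fderiv ℝ Z (0, y) (0, u) ![(Complex.I, 0), (0, v)] =
      fderiv ℝ Z (0, y) (0, v) ![(Complex.I, 0), (0, u)] := by
  have h1 := extDeriv_twoForm_apply Z (0, y) (Complex.I, 0) (0, u) (0, v)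
  rw [hclosed, fderiv_imaginary_eq_zero hy hd hinv] at h1
  have a0 : (0 : (ℂ × V) [⋀^Fin 3]→L[ℝ] ℝ) ![(Complex.I, 0), (0, u), (0, v)] = 0 := rfl
  have a1 : (0 : (ℂ × V) [⋀^Fin 2]→L[ℝ] ℝ) ![(0, u), (0, v)] = 0 := rfl
  linarith

end Cylinder


/-! ### The operator `dᶜ` on complex manifolds -/

section ManifoldDc

open Set Filter

variable {W : Type*} [NormedAddCommGroup W] [NormedSpace ℂ W]
  {M : Type*} [TopologicalSpace M] [ChartedSpace W M]

instance realManifold [IsManifold 𝓘(ℂ, W) ω M] (n : WithTop ℕ∞) : IsManifold 𝓘(ℝ, W) n M :=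
  have := (sameModel_self W).isManifold (N := M) (n := ω)
  IsManifold.of_le (n := ω) le_top

theorem contMDiffAt_real_self {V : Type*} [NormedAddCommGroup V] [NormedSpace ℂ V]
    {D : Type*} [TopologicalSpace D] [ChartedSpace V D] {f : D → M} {x : D}
    (hf : ContMDiffAt 𝓘(ℂ, V) 𝓘(ℂ, W) ω f x) : ContMDiffAt 𝓘(ℝ, V) 𝓘(ℝ, W) ∞ f x :=
  ((sameModel_self V).contMDiffAt (sameModel_self W) hf).of_le le_top

theorem isJLinear_realDeriv_self {V : Type*} [NormedAddCommGroup V] [NormedSpace ℂ V]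
    {D : Type*} [TopologicalSpace D] [ChartedSpace V D] {f : D → M} {x : D}
    (hf : ContMDiffAt 𝓘(ℂ, V) 𝓘(ℂ, W) ω f x) : IsJLinear (realDeriv 𝓘(ℝ, V) 𝓘(ℝ, W) f x) :=
  (sameModel_self V).isJLinear_mfderiv (sameModel_self W) (hf.mdifferentiableAt (by simp))

/-- The `1`-form `dᶜG = -dG ∘ J` of a function on a complex manifold. -/
def dcForm (G : M → ℝ) : DiffForm W M 1 := fun x => dcCLM W (realDeriv 𝓘(ℝ, W) 𝓘(ℝ, ℝ) G x)

theorem pullback_dcForm {E : Type*} [NormedAddCommGroup E] [NormedSpace ℂ E] {G : M → ℝ}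
    {f : E → M} {y : E} (hG : MDifferentiableAt 𝓘(ℝ, W) 𝓘(ℝ, ℝ) G (f y))
    (hf : MDifferentiableAt 𝓘(ℝ, E) 𝓘(ℝ, W) f y)
    (hJ : IsJLinear (realDeriv 𝓘(ℝ, E) 𝓘(ℝ, W) f y)) :
    DiffForm.pullback 𝓘(ℝ, E) 𝓘(ℝ, W) f (dcForm G) y = dcLocal (G ∘ f) y := by
  refine alternating_ext_one fun u => ?_
  rw [DiffForm.pullback_eq, compContinuousLinearMap_one, dcForm, dcCLM_apply, dcLocal_apply,
    ← realDeriv_eq_fderiv, realDeriv_comp hG hf, ContinuousLinearMap.comp_apply, hJ]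

variable [IsManifold 𝓘(ℂ, W) ω M]

theorem isJLinear_extChartAt_symm (x : M) {y : W} (hy : y ∈ (extChartAt 𝓘(ℝ, W) x).target) :
    IsJLinear (realDeriv 𝓘(ℝ, W) 𝓘(ℝ, W) (extChartAt 𝓘(ℝ, W) x).symm y) := by
  have h := (contMDiffOn_extChartAt_symm (I := 𝓘(ℂ, W)) (n := ω) x).contMDiffAt
    ((isOpen_extChartAt_target x).mem_nhds (x := y) hy)
  exact isJLinear_realDeriv_self h

theorem formInChart_dcForm {G : M → ℝ} (hG : ContMDiff 𝓘(ℝ, W) 𝓘(ℝ, ℝ) ∞ G) (x : M) {y : W}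
    (hy : y ∈ (extChartAt 𝓘(ℝ, W) x).target) :
    formInChart 𝓘(ℝ, W) (dcForm G) x y = dcLocal (G ∘ (extChartAt 𝓘(ℝ, W) x).symm) y :=
  pullback_dcForm (hG.mdifferentiableAt (by simp)) (mdifferentiableAt_extChartAt_symm x hy)
    (isJLinear_extChartAt_symm x hy)

theorem isSmoothForm_dcForm {G : M → ℝ} (hG : ContMDiff 𝓘(ℝ, W) 𝓘(ℝ, ℝ) ∞ G) :
    IsSmoothForm 𝓘(ℝ, W) (dcForm G) := fun x => by
  refine ContDiffOn.congr (f := dcLocal (G ∘ (extChartAt 𝓘(ℝ, W) x).symm)) (fun y hy => ?_)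
    fun y hy => formInChart_dcForm hG x hy
  refine (contDiffAt_dcLocal ?_).contDiffWithinAt
  exact contMDiffAt_iff_contDiffAt.1 (hG.contMDiffAt.comp y (contMDiffAt_extChartAt_symm x hy))

/-- The pullback of `ddᶜG` under a holomorphic map. -/
theorem pullback_extD_dcForm {E : Type*} [NormedAddCommGroup E] [NormedSpace ℂ E]
    {G : M → ℝ} (hG : ContMDiff 𝓘(ℝ, W) 𝓘(ℝ, ℝ) ∞ G)
    {f : E → M} {y : E} (hf : ContMDiffAt 𝓘(ℂ, E) 𝓘(ℂ, W) ω f y) :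
    DiffForm.pullback 𝓘(ℝ, E) 𝓘(ℝ, W) f (extD 𝓘(ℝ, W) (dcForm G)) y =
      extDeriv (dcLocal (G ∘ f)) y := by
  rw [← (isSmoothForm_dcForm hG).extDeriv_pullback (contMDiffAt_real_self hf)]
  refine Filter.EventuallyEq.extDeriv_eq ?_
  filter_upwards [(contMDiffAt_iff_contMDiffAt_nhds (by simp)).1 (hf.of_le (m := 1) le_top)]
    with z hz
  have hz' : MDifferentiableAt 𝓘(ℂ, E) 𝓘(ℂ, W) f z := hz.mdifferentiableAt one_ne_zero
  exact pullback_dcForm (hG.mdifferentiableAt (by simp))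
    (((sameModel_self E).contMDiffAt (sameModel_self W) hz).mdifferentiableAt one_ne_zero)
    ((sameModel_self E).isJLinear_mfderiv (sameModel_self W) hz')

theorem extD_dcForm_cplxJ {G : M → ℝ} (hG : ContMDiff 𝓘(ℝ, W) 𝓘(ℝ, ℝ) ∞ G) (x : M) (u v : W) :
    extD 𝓘(ℝ, W) (dcForm G) x ![cplxJ u, cplxJ v] = extD 𝓘(ℝ, W) (dcForm G) x ![u, v] := by
  have h : extD 𝓘(ℝ, W) (dcForm G) x =
      extDeriv (dcLocal (G ∘ (extChartAt 𝓘(ℝ, W) x).symm)) (extChartAt 𝓘(ℝ, W) x x) := by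
    refine Filter.EventuallyEq.extDeriv_eq ?_
    filter_upwards [extChartAt_target_mem_nhds x] with y hy using formInChart_dcForm hG x hy
  rw [h]
  refine ddc_cplxJ ?_ u v
  exact contMDiffAt_iff_contDiffAt.1 (hG.contMDiffAt.comp _
    (contMDiffAt_extChartAt_symm x (mem_extChartAt_target x)))

end ManifoldDc

/-! ### Averaging over a holomorphic circle action -/

section Averaging

open Set Filter MeasureTheory

variable {W : Type*} [NormedAddCommGroup W] [NormedSpace ℂ W]
  {M : Type*} [TopologicalSpace M] [ChartedSpace W M]

/-- A smooth action of the circle `ℝ / ℤ` on a complex manifold by holomorphic maps. -/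
structure IsCircleAction (A : ℝ → M → M) : Prop where
  smooth : ContMDiff (𝓘(ℝ, ℝ).prod 𝓘(ℝ, W)) 𝓘(ℝ, W) ∞ fun p : ℝ × M => A p.1 p.2
  holomorphic : ∀ s x, IsJLinear (realDeriv 𝓘(ℝ, W) 𝓘(ℝ, W) (A s) x)
  zero : A 0 = id
  one : A 1 = id
  add : ∀ s t, A (s + t) = A s ∘ A t

/-- The velocity of the orbit of `x` at time `s`. -/
def orbitVelocity (A : ℝ → M → M) (s : ℝ) (x : M) : W :=
  realDeriv 𝓘(ℝ, ℝ) 𝓘(ℝ, W) (fun s => A s x) s 1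

/-- The action read in the inverse of the preferred chart at `x₀`. -/
def actionInChart (A : ℝ → M → M) (x₀ : M) (p : ℝ × W) : M :=
  A p.1 ((extChartAt 𝓘(ℝ, W) x₀).symm p.2)

/-- The `1`-form `A_s^* (ι_X α)`, where `X` generates the action. -/
def contractedPullback (A : ℝ → M → M) (α : DiffForm W M 2) (s : ℝ) : DiffForm W M 1 := fun x =>
  ((α (A s x)).curryLeft (orbitVelocity (W := W) A s x)).compContinuousLinearMap
    (realDeriv 𝓘(ℝ, W) 𝓘(ℝ, W) (A s) x)

/-- The `1`-form `∫₀¹ (1 - s) A_s^* (ι_X α) ds`, whose differential is the difference between the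
average of `α` over the action and `α`: the derivative of `A_s^* α` in `s` is `d(A_s^* (ι_X α))`,
and the weight `1 - s` comes from an integration by parts. -/
def averagePrimitive (A : ℝ → M → M) (α : DiffForm W M 2) : DiffForm W M 1 := fun x =>
  ∫ s in (0:ℝ)..1, (1 - s) • (contractedPullback A α s x : W [⋀^Fin 1]→L[ℝ] ℝ)

/-- The average of a closed form over a circle action, written as the sum of the form and of an
exact form; `IsCircleAction.average_apply` identifies it with `∫₀¹ A_s^* α ds`. -/
def average (A : ℝ → M → M) (α : DiffForm W M 2) : DiffForm W M 2 :=
  α + extD 𝓘(ℝ, W) (averagePrimitive A α)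

namespace IsCircleAction

variable {A : ℝ → M → M} (hA : IsCircleAction (W := W) A)
include hA

theorem contMDiff_slice (s : ℝ) : ContMDiff 𝓘(ℝ, W) 𝓘(ℝ, W) ∞ (A s) :=
  hA.smooth.comp (contMDiff_const.prodMk contMDiff_id)

theorem mdifferentiableAt_slice (s : ℝ) (x : M) :
    MDifferentiableAt 𝓘(ℝ, W) 𝓘(ℝ, W) (A s) x :=
  (hA.contMDiff_slice s).mdifferentiableAt (by simp)

variable [IsManifold 𝓘(ℂ, W) ω M]

theorem contMDiffAt_actionInChart (x₀ : M) (s : ℝ) {y : W}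
    (hy : y ∈ (extChartAt 𝓘(ℝ, W) x₀).target) :
    ContMDiffAt 𝓘(ℝ, ℝ × W) 𝓘(ℝ, W) ∞ (actionInChart A x₀) (s, y) := by
  have h1 : ContMDiffAt 𝓘(ℝ, ℝ × W) 𝓘(ℝ, ℝ) ∞ (Prod.fst : ℝ × W → ℝ) (s, y) :=
    contMDiffAt_iff_contDiffAt.2 contDiffAt_fst
  have h2 : ContMDiffAt 𝓘(ℝ, ℝ × W) 𝓘(ℝ, W) ∞ (Prod.snd : ℝ × W → W) (s, y) :=
    contMDiffAt_iff_contDiffAt.2 contDiffAt_snd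
  have h3 : ContMDiffAt 𝓘(ℝ, ℝ × W) 𝓘(ℝ, W) ∞
      (fun p : ℝ × W => (extChartAt 𝓘(ℝ, W) x₀).symm p.2) (s, y) :=
    ContMDiffAt.comp (s, y) (contMDiffAt_extChartAt_symm x₀ hy) h2
  exact hA.smooth.contMDiffAt.comp (s, y) (h1.prodMk h3)

theorem realDeriv_actionInChart_fst (x₀ : M) (s : ℝ) {y : W}
    (hy : y ∈ (extChartAt 𝓘(ℝ, W) x₀).target) :
    realDeriv 𝓘(ℝ, ℝ × W) 𝓘(ℝ, W) (actionInChart A x₀) (s, y) (1, 0) =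
      orbitVelocity A s ((extChartAt 𝓘(ℝ, W) x₀).symm y) := by
  have h := realDeriv_comp (I := 𝓘(ℝ, ℝ)) (I' := 𝓘(ℝ, ℝ × W)) (I'' := 𝓘(ℝ, W))
    (g := actionInChart A x₀) (f := fun s => (s, y)) (x := s)
    ((hA.contMDiffAt_actionInChart x₀ s hy).mdifferentiableAt (by simp))
    (mdifferentiableAt_iff_differentiableAt.2 (by fun_prop))
  rw [realDeriv_eq_fderiv, (hasFDerivAt_prodMk_left s y).fderiv] at h
  exact (congrArg (fun L : ℝ →L[ℝ] W => L 1) h).symm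

theorem realDeriv_actionInChart_snd (x₀ : M) (s : ℝ) {y : W}
    (hy : y ∈ (extChartAt 𝓘(ℝ, W) x₀).target) (v : W) :
    realDeriv 𝓘(ℝ, ℝ × W) 𝓘(ℝ, W) (actionInChart A x₀) (s, y) (0, v) =
      realDeriv 𝓘(ℝ, W) 𝓘(ℝ, W) (A s) ((extChartAt 𝓘(ℝ, W) x₀).symm y)
        (realDeriv 𝓘(ℝ, W) 𝓘(ℝ, W) (extChartAt 𝓘(ℝ, W) x₀).symm y v) := by
  have h := realDeriv_comp (I := 𝓘(ℝ, W)) (I' := 𝓘(ℝ, ℝ × W)) (I'' := 𝓘(ℝ, W))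
    (g := actionInChart A x₀) (f := fun y => (s, y)) (x := y)
    ((hA.contMDiffAt_actionInChart x₀ s hy).mdifferentiableAt (by simp))
    (mdifferentiableAt_iff_differentiableAt.2 (by fun_prop))
  rw [realDeriv_eq_fderiv, (hasFDerivAt_prodMk_right s y).fderiv] at h
  have h' := realDeriv_comp (I := 𝓘(ℝ, W)) (I' := 𝓘(ℝ, W)) (I'' := 𝓘(ℝ, W)) (g := A s)
    (f := (extChartAt 𝓘(ℝ, W) x₀).symm) (x := y) (hA.mdifferentiableAt_slice s _)
    (mdifferentiableAt_extChartAt_symm x₀ hy)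
  exact congrArg (fun L : W →L[ℝ] W => L v) (h.symm.trans h')

theorem sliceContract_pullback (α : DiffForm W M 2) (x₀ : M) (s : ℝ) {y : W}
    (hy : y ∈ (extChartAt 𝓘(ℝ, W) x₀).target) :
    sliceContract (DiffForm.pullback 𝓘(ℝ, ℝ × W) 𝓘(ℝ, W) (actionInChart A x₀) α (s, y)) =
      ((contractedPullback A α s ((extChartAt 𝓘(ℝ, W) x₀).symm y) :
        W [⋀^Fin 1]→L[ℝ] ℝ)).compContinuousLinearMap
        (realDeriv 𝓘(ℝ, W) 𝓘(ℝ, W) (extChartAt 𝓘(ℝ, W) x₀).symm y) := by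
  refine alternating_ext_one fun v => ?_
  rw [sliceContract_apply, DiffForm.pullback_eq, compContinuousLinearMap_two,
    hA.realDeriv_actionInChart_fst x₀ s hy, hA.realDeriv_actionInChart_snd x₀ s hy,
    compContinuousLinearMap_one, contractedPullback, compContinuousLinearMap_one]
  rfl

theorem pullback_actionInChart_apply (α : DiffForm W M 2) (x₀ : M) (s : ℝ) {y : W}
    (hy : y ∈ (extChartAt 𝓘(ℝ, W) x₀).target) (u v : W) :
    DiffForm.pullback 𝓘(ℝ, ℝ × W) 𝓘(ℝ, W) (actionInChart A x₀) α (s, y) ![(0, u), (0, v)] =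
      DiffForm.pullback 𝓘(ℝ, W) 𝓘(ℝ, W) (A s) α ((extChartAt 𝓘(ℝ, W) x₀).symm y)
        ![realDeriv 𝓘(ℝ, W) 𝓘(ℝ, W) (extChartAt 𝓘(ℝ, W) x₀).symm y u,
          realDeriv 𝓘(ℝ, W) 𝓘(ℝ, W) (extChartAt 𝓘(ℝ, W) x₀).symm y v] := by
  rw [DiffForm.pullback_eq, compContinuousLinearMap_two, hA.realDeriv_actionInChart_snd x₀ s hy,
    hA.realDeriv_actionInChart_snd x₀ s hy, DiffForm.pullback_eq, compContinuousLinearMap_two]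
  rfl

variable {α : DiffForm W M 2} (hα : IsSmoothForm 𝓘(ℝ, W) α)
include hα

theorem contDiffOn_pullback_actionInChart (x₀ : M) :
    ContDiffOn ℝ ∞ (DiffForm.pullback 𝓘(ℝ, ℝ × W) 𝓘(ℝ, W) (actionInChart A x₀) α)
      (univ ×ˢ (extChartAt 𝓘(ℝ, W) x₀).target) := fun p hp =>
  (hα.contDiffAt_pullback (hA.contMDiffAt_actionInChart x₀ p.1 hp.2)).contDiffWithinAt

theorem continuous_contractedPullback (x : M) :
    Continuous fun s => (contractedPullback A α s x : W [⋀^Fin 1]→L[ℝ] ℝ) := by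
  have h := (sliceContract (E := W)).continuous.comp
    (continuous_of_contDiffOn_prod (isOpen_extChartAt_target x)
    (hA.contDiffOn_pullback_actionInChart hα x) (mem_extChartAt_target (I := 𝓘(ℝ, W)) x))
  refine h.congr fun s => ?_
  simp only [Function.comp_apply]
  rw [hA.sliceContract_pullback α x s (mem_extChartAt_target x), realDeriv_extChartAt_symm_self,
    extChartAt_to_inv]
  rfl

theorem continuous_pullback_apply (x : M) (u v : W) :
    Continuous fun s => DiffForm.pullback 𝓘(ℝ, W) 𝓘(ℝ, W) (A s) α x ![u, v] := by
  have h := (ContinuousAlternatingMap.apply ℝ (ℝ × W) ℝ ![(0, u), (0, v)]).continuous.comp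
    (continuous_of_contDiffOn_prod (isOpen_extChartAt_target x)
    (hA.contDiffOn_pullback_actionInChart hα x) (mem_extChartAt_target (I := 𝓘(ℝ, W)) x))
  refine h.congr fun s => ?_
  have h1 := hA.pullback_actionInChart_apply α x s (mem_extChartAt_target (I := 𝓘(ℝ, W)) x) u v
  rw [realDeriv_extChartAt_symm_self, extChartAt_to_inv] at h1
  exact h1

theorem formInChart_averagePrimitive (x₀ : M) {y : W}
    (hy : y ∈ (extChartAt 𝓘(ℝ, W) x₀).target) :
    formInChart 𝓘(ℝ, W) (averagePrimitive A α) x₀ y = ∫ s in (0:ℝ)..1, (1 - s) • sliceContract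
      (DiffForm.pullback 𝓘(ℝ, ℝ × W) 𝓘(ℝ, W) (actionInChart A x₀) α (s, y)) := by
  have h1 := (ContinuousAlternatingMap.compContinuousLinearMapCLM (ι := Fin 1) (F := ℝ)
    (realDeriv 𝓘(ℝ, W) 𝓘(ℝ, W) (extChartAt 𝓘(ℝ, W) x₀).symm y)).intervalIntegral_comp_comm
    (((by fun_prop : Continuous fun s : ℝ => 1 - s).smul (hA.continuous_contractedPullback hα
      ((extChartAt 𝓘(ℝ, W) x₀).symm y))).intervalIntegrable (μ := volume) 0 1)
  refine h1.symm.trans ?_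
  congr 1
  ext1 s
  rw [hA.sliceContract_pullback α x₀ s hy]
  exact (ContinuousAlternatingMap.compContinuousLinearMapCLM (ι := Fin 1) (F := ℝ)
    (realDeriv 𝓘(ℝ, W) 𝓘(ℝ, W) (extChartAt 𝓘(ℝ, W) x₀).symm y)).map_smul (1 - s) _

variable [FiniteDimensional ℂ W]

theorem isSmoothForm_averagePrimitive : IsSmoothForm 𝓘(ℝ, W) (averagePrimitive A α) := fun x₀ => by
  have : FiniteDimensional ℝ W := FiniteDimensional.complexToReal W
  exact (contDiffOn_integral_sliceContract (isOpen_extChartAt_target x₀)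
    (hA.contDiffOn_pullback_actionInChart hα x₀)).congr
    fun y hy => hA.formInChart_averagePrimitive hα x₀ hy

theorem isSmoothForm_average : IsSmoothForm 𝓘(ℝ, W) (average A α) :=
  hα.add (hA.isSmoothForm_averagePrimitive hα).extD

theorem average_apply (hd : extD 𝓘(ℝ, W) α = 0) (x : M) (u v : W) :
    average A α x ![u, v] =
      ∫ s in (0:ℝ)..1, DiffForm.pullback 𝓘(ℝ, W) 𝓘(ℝ, W) (A s) α x ![u, v] := by
  have : FiniteDimensional ℝ W := FiniteDimensional.complexToReal W
  have hx := mem_extChartAt_target (I := 𝓘(ℝ, W)) x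
  have h1 : extD 𝓘(ℝ, W) (averagePrimitive A α) x =
      extDeriv (fun y => ∫ s in (0:ℝ)..1, (1 - s) • sliceContract
        (DiffForm.pullback 𝓘(ℝ, ℝ × W) 𝓘(ℝ, W) (actionInChart A x) α (s, y)))
        (extChartAt 𝓘(ℝ, W) x x) := by
    refine Filter.EventuallyEq.extDeriv_eq ?_
    filter_upwards [extChartAt_target_mem_nhds x] with y hy
      using hA.formInChart_averagePrimitive hα x hy
  have h2 := extDeriv_integral_sliceContract (isOpen_extChartAt_target x)
    (hA.contDiffOn_pullback_actionInChart hα x) (fun s y hy => by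
      rw [hα.extDeriv_pullback (hA.contMDiffAt_actionInChart x s hy), hd]
      rfl) hx u v
  have h3 : ∀ s : ℝ, DiffForm.pullback 𝓘(ℝ, ℝ × W) 𝓘(ℝ, W) (actionInChart A x) α
      (s, extChartAt 𝓘(ℝ, W) x x) ![(0, u), (0, v)] =
      DiffForm.pullback 𝓘(ℝ, W) 𝓘(ℝ, W) (A s) α x ![u, v] := by
    intro s
    have h1 := hA.pullback_actionInChart_apply α x s hx u v
    rw [realDeriv_extChartAt_symm_self, extChartAt_to_inv] at h1
    exact h1
  have h4 : DiffForm.pullback 𝓘(ℝ, W) 𝓘(ℝ, W) (A 0) α x ![u, v] = α x ![u, v] := by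
    rw [DiffForm.pullback_eq, compContinuousLinearMap_two, hA.zero, realDeriv_id]
    rfl
  simp only [h3, h4] at h2
  have h5 : average A α x ![u, v] =
    α x ![u, v] + extD 𝓘(ℝ, W) (averagePrimitive A α) x ![u, v] := rfl
  rw [h5, h1, h2]
  ring

/-- The average is invariant under the action. -/
theorem pullback_average (hd : extD 𝓘(ℝ, W) α = 0) (t : ℝ) :
    DiffForm.pullback 𝓘(ℝ, W) 𝓘(ℝ, W) (A t) (average A α) = average A α := by
  funext x
  refine alternating_ext_two fun u v => ?_
  set f : ℝ → ℝ := fun s => DiffForm.pullback 𝓘(ℝ, W) 𝓘(ℝ, W) (A s) α x ![u, v] with hf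
  have hper : Function.Periodic f 1 := fun s => by
    simp only [hf]
    rw [hA.add, hA.one, Function.comp_id]
  rw [DiffForm.pullback_eq, compContinuousLinearMap_two, hA.average_apply hα hd,
    hA.average_apply hα hd]
  have h1 : ∀ s, DiffForm.pullback 𝓘(ℝ, W) 𝓘(ℝ, W) (A s) α (A t x)
      ![realDeriv 𝓘(ℝ, W) 𝓘(ℝ, W) (A t) x u, realDeriv 𝓘(ℝ, W) 𝓘(ℝ, W) (A t) x v] = f (s + t) := by
    intro s
    simp only [hf]
    rw [hA.add, DiffForm.pullback_comp α (hA.mdifferentiableAt_slice s _)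
      (hA.mdifferentiableAt_slice t x), DiffForm.pullback_eq _ (A t) x,
      compContinuousLinearMap_two]
  simp only [h1]
  rw [intervalIntegral.integral_comp_add_right, zero_add, add_comm 1 t]
  have := hper.intervalIntegral_add_eq t 0
  rw [zero_add] at this
  exact this

end IsCircleAction

theorem IsCircleAction.isKahlerForm_average [IsManifold 𝓘(ℂ, W) ω M] [FiniteDimensional ℂ W]
    {A : ℝ → M → M} (hA : IsCircleAction (W := W) A) {σ : DiffForm W M 2} (hσ : IsKahlerForm σ) :
    IsKahlerForm (average A σ) := by
  have hs : IsSmoothForm 𝓘(ℝ, W) σ := hσ.closed.1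
  have hd : extD 𝓘(ℝ, W) σ = 0 := hσ.closed.2
  refine ⟨⟨hA.isSmoothForm_average hs, ?_⟩, fun x u v => ?_, fun x u hu => ?_⟩
  · rw [average, extD_add hs (hA.isSmoothForm_averagePrimitive hs).extD, hd,
      (hA.isSmoothForm_averagePrimitive hs).extD_extD, add_zero]
  · rw [hA.average_apply hs hd, hA.average_apply hs hd]
    congr 1
    ext s
    rw [DiffForm.pullback_eq, compContinuousLinearMap_two, compContinuousLinearMap_two,
      hA.holomorphic, hA.holomorphic, hσ.invariant]
  · rw [hA.average_apply hs hd]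
    refine intervalIntegral.intervalIntegral_pos_of_pos
      ((hA.continuous_pullback_apply hs x _ _).intervalIntegrable _ _) (fun s => ?_) one_pos
    rw [DiffForm.pullback_eq, compContinuousLinearMap_two, hA.holomorphic]
    refine hσ.pos _ _ fun h0 => hu ?_
    -- The derivative of `A s` is injective, with inverse the derivative of `A (-s)`.
    have h1 := realDeriv_comp (I := 𝓘(ℝ, W)) (I' := 𝓘(ℝ, W)) (I'' := 𝓘(ℝ, W)) (g := A (-s))
      (f := A s) (x := x) (hA.mdifferentiableAt_slice _ _) (hA.mdifferentiableAt_slice _ _)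
    rw [← hA.add, neg_add_cancel, hA.zero, realDeriv_id] at h1
    have h2 := congrArg (fun L : W →L[ℝ] W => L u) h1
    simp only [ContinuousLinearMap.comp_apply, h0, map_zero] at h2
    exact h2

end Averaging


/-! ### The distance of a Kähler metric -/

section Distance

open Set Filter MeasureTheory Manifold

variable {W : Type*} [NormedAddCommGroup W] [NormedSpace ℂ W]
  {M : Type*} [TopologicalSpace M] [ChartedSpace W M]

omit [TopologicalSpace M] [ChartedSpace W M] in
theorem kahlerMetric_apply (σ : DiffForm W M 2) (x : M) (u v : W) :
    kahlerMetric σ x ![u, v] = σ x ![u, cplxJ v] := rfl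

theorem IsKahlerForm.nonneg {σ : DiffForm W M 2} (hσ : IsKahlerForm σ) (x : M) (u : W) :
    0 ≤ kahlerMetric σ x ![u, u] := by
  rw [kahlerMetric_apply]
  rcases eq_or_ne u 0 with rfl | hu
  · rw [alternating_zero_left]
  · exact (hσ.pos x u hu).le

/-- The length of tangent vectors for the metric of a `2`-form. -/
abbrev metricENorm (σ : DiffForm W M 2) (p : M) : ENorm (TangentSpace 𝓘(ℝ, W) p) :=
  ⟨fun v => ENNReal.ofReal (Real.sqrt (kahlerMetric σ p ![v, v]))⟩

theorem riemDist_eq (σ : DiffForm W M 2) (x y : M) :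
    riemDist 𝓘(ℝ, W) (kahlerMetric σ) x y =
      letI := metricENorm σ
      riemannianEDist 𝓘(ℝ, W) x y := rfl

omit [TopologicalSpace M] [ChartedSpace W M] in
theorem kahlerMetric_smul_self (σ : DiffForm W M 2) (p : M) (c : ℝ) (v : W) :
    kahlerMetric σ p ![c • v, c • v] = c ^ 2 * kahlerMetric σ p ![v, v] := by
  rw [kahlerMetric_apply, kahlerMetric_apply, cplxJ_smul, alternating_smul_left,
    alternating_smul_right]
  ring

theorem metricENorm_smulClass (σ : DiffForm W M 2) (p : M) :
    letI := metricENorm σ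
    ENormSMulClass ℝ (TangentSpace 𝓘(ℝ, W) p) := by
  let _ := metricENorm σ
  refine ⟨fun c v => ?_⟩
  have h : ENNReal.ofReal (Real.sqrt (kahlerMetric σ p ![(c • v : W), (c • v : W)])) =
      ‖c‖ₑ * ENNReal.ofReal (Real.sqrt (kahlerMetric σ p ![v, v])) := by
    refine (congrArg (fun r => ENNReal.ofReal (Real.sqrt r))
      (kahlerMetric_smul_self σ p c v)).trans ?_
    rw [Real.sqrt_mul (sq_nonneg c), Real.sqrt_sq_eq_abs, ENNReal.ofReal_mul (abs_nonneg c),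
      Real.enorm_eq_ofReal_abs]
  exact h

theorem riemDist_comm (σ : DiffForm W M 2) (x y : M) :
    riemDist 𝓘(ℝ, W) (kahlerMetric σ) x y = riemDist 𝓘(ℝ, W) (kahlerMetric σ) y x := by
  let _ := metricENorm σ
  have _ := metricENorm_smulClass σ
  exact riemannianEDist_comm

theorem riemDist_triangle (σ : DiffForm W M 2) (x y z : M) :
    riemDist 𝓘(ℝ, W) (kahlerMetric σ) x z ≤
      riemDist 𝓘(ℝ, W) (kahlerMetric σ) x y + riemDist 𝓘(ℝ, W) (kahlerMetric σ) y z := by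
  let _ := metricENorm σ
  have _ := metricENorm_smulClass σ
  exact riemannianEDist_triangle

theorem riemDist_self (σ : DiffForm W M 2) (x : M) :
    riemDist 𝓘(ℝ, W) (kahlerMetric σ) x x = 0 := by
  let _ := metricENorm σ
  have _ := metricENorm_smulClass σ
  exact riemannianEDist_self

/-- A function whose differential is bounded by the metric is `1`-Lipschitz for its distance. -/
theorem ofReal_abs_sub_le_riemDist (σ : DiffForm W M 2) {ρ : M → ℝ}
    (hρ : ContMDiff 𝓘(ℝ, W) 𝓘(ℝ, ℝ) 1 ρ)
    (hbound : ∀ x u, |realDeriv 𝓘(ℝ, W) 𝓘(ℝ, ℝ) ρ x u| ≤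
      Real.sqrt (kahlerMetric σ x ![u, u])) (x y : M) :
    ENNReal.ofReal |ρ y - ρ x| ≤ riemDist 𝓘(ℝ, W) (kahlerMetric σ) x y := by
  let _ := metricENorm σ
  have _ := metricENorm_smulClass σ
  rw [riemDist_eq]
  refine le_of_forall_gt fun r hr => ?_
  obtain ⟨c, hc0, hc1, hc, hcr, -, -⟩ :=
    exists_lt_locally_constant_of_riemannianEDist_lt hr zero_lt_one
  refine lt_of_le_of_lt ?_ hcr
  have hρc : ContDiff ℝ 1 (ρ ∘ c) := contMDiff_iff_contDiff.1 (hρ.comp hc)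
  have h1 := enorm_sub_le_lintegral_deriv_of_contDiffOn_Icc (f := ρ ∘ c) (a := 0) (b := 1)
    hρc.contDiffOn zero_le_one
  simp only [Function.comp_apply, hc0, hc1] at h1
  rw [Real.enorm_eq_ofReal_abs] at h1
  refine h1.trans ?_
  rw [pathELength_eq_lintegral_mfderiv_Icc]
  refine lintegral_mono fun t => ?_
  have h2 : deriv (ρ ∘ c) t = realDeriv 𝓘(ℝ, W) 𝓘(ℝ, ℝ) ρ (c t)
      (realDeriv 𝓘(ℝ, ℝ) 𝓘(ℝ, W) c t 1) := by
    rw [← fderiv_apply_one_eq_deriv, ← realDeriv_eq_fderiv, realDeriv_comp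
      (hρ.mdifferentiableAt one_ne_zero) (hc.mdifferentiableAt one_ne_zero)]
    rfl
  rw [Real.enorm_eq_ofReal_abs]
  refine ENNReal.ofReal_le_ofReal ?_
  have h3 : deriv (fun t => ρ (c t)) t = deriv (ρ ∘ c) t := rfl
  rw [h2]
  exact hbound _ _

variable [IsManifold 𝓘(ℂ, W) ω M]

/-- The distance of a Kähler metric is controlled by the distance in a chart. -/
theorem exists_riemDist_le {σ : DiffForm W M 2} (hσ : IsKahlerForm σ) (x : M) :
    ∃ C : ℝ, 0 ≤ C ∧ ∀ᶠ y in 𝓝 x, riemDist 𝓘(ℝ, W) (kahlerMetric σ) x y ≤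
      ENNReal.ofReal (C * ‖extChartAt 𝓘(ℝ, W) x y - extChartAt 𝓘(ℝ, W) x x‖) := by
  let _ := metricENorm σ
  have _ := metricENorm_smulClass σ
  set φ := extChartAt 𝓘(ℝ, W) x with hφ
  have hcont : ContinuousAt (formInChart 𝓘(ℝ, W) σ x) (φ x) :=
    (hσ.closed.1.contDiffAt_formInChart x (mem_extChartAt_target x)).continuousAt
  obtain ⟨C, hC⟩ : ∃ C, ∀ᶠ y in 𝓝 (φ x), ‖formInChart 𝓘(ℝ, W) σ x y‖ ≤ C :=
    ⟨‖formInChart 𝓘(ℝ, W) σ x (φ x)‖ + 1,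
      (hcont.norm.eventually (gt_mem_nhds (lt_add_one _))).mono fun y hy => hy.le⟩
  obtain ⟨r, hr, hball⟩ := Metric.mem_nhds_iff.1 (hC.and (extChartAt_target_mem_nhds x))
  have hC0 : 0 ≤ C := (norm_nonneg _).trans (hball (Metric.mem_ball_self hr)).1
  refine ⟨Real.sqrt C, Real.sqrt_nonneg C, ?_⟩
  filter_upwards [extChartAt_source_mem_nhds (I := 𝓘(ℝ, W)) x,
    (continuousAt_extChartAt (I := 𝓘(ℝ, W)) x).preimage_mem_nhds (Metric.ball_mem_nhds _ hr)]
    with y hy hyb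
  set w := φ y - φ x with hw
  have hseg : ∀ t ∈ Icc (0:ℝ) 1, φ x + t • w ∈ Metric.ball (φ x) r := by
    intro t ht
    rw [mem_ball_iff_norm, add_sub_cancel_left, norm_smul, Real.norm_of_nonneg ht.1]
    have h1 : ‖w‖ < r := by rw [← mem_ball_iff_norm]; exact hyb
    exact (mul_le_of_le_one_left (norm_nonneg w) ht.2).trans_lt h1
  have hline : ContMDiff 𝓘(ℝ, ℝ) 𝓘(ℝ, W) ∞ fun t : ℝ => φ x + t • w :=
    contMDiff_iff_contDiff.2 (by fun_prop)
  have hc : ∀ t ∈ Icc (0:ℝ) 1, ContMDiffAt 𝓘(ℝ, ℝ) 𝓘(ℝ, W) ∞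
      (φ.symm ∘ fun t : ℝ => φ x + t • w) t := fun t ht =>
    (contMDiffAt_extChartAt_symm x (hball (hseg t ht)).2).comp t hline.contMDiffAt
  refine (riemannianEDist_le_pathELength (γ := φ.symm ∘ fun t : ℝ => φ x + t • w) (a := 0) (b := 1)
    (fun t ht => ((hc t ht).of_le (by simp)).contMDiffWithinAt) ?_ ?_ zero_le_one).trans ?_
  · simp [hφ]
  · simp only [Function.comp_apply, one_smul, hw, add_sub_cancel]
    exact φ.left_inv hy
  rw [pathELength_eq_lintegral_mfderiv_Icc]
  have hle : ∀ t ∈ Icc (0:ℝ) 1, ENNReal.ofReal (Real.sqrt (kahlerMetric σ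
      ((φ.symm ∘ fun t : ℝ => φ x + t • w) t)
      ![realDeriv 𝓘(ℝ, ℝ) 𝓘(ℝ, W) (φ.symm ∘ fun t : ℝ => φ x + t • w) t 1,
        realDeriv 𝓘(ℝ, ℝ) 𝓘(ℝ, W) (φ.symm ∘ fun t : ℝ => φ x + t • w) t 1])) ≤
      ENNReal.ofReal (Real.sqrt C * ‖w‖) := by
    intro t ht
    have hyt := hball (hseg t ht)
    have h1 : realDeriv 𝓘(ℝ, ℝ) 𝓘(ℝ, W) (φ.symm ∘ fun t : ℝ => φ x + t • w) t 1 =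
        realDeriv 𝓘(ℝ, W) 𝓘(ℝ, W) φ.symm (φ x + t • w) w := by
      have h2 := realDeriv_comp (I := 𝓘(ℝ, ℝ)) (I' := 𝓘(ℝ, W)) (I'' := 𝓘(ℝ, W)) (g := φ.symm)
        (f := fun t : ℝ => φ x + t • w) (x := t) (mdifferentiableAt_extChartAt_symm x hyt.2)
        (hline.mdifferentiableAt (by simp))
      have h3 : HasDerivAt (fun t : ℝ => φ x + t • w) w t := by
        simpa using ((hasDerivAt_id t).smul_const w).const_add (φ x)
      rw [h2, realDeriv_eq_fderiv, ContinuousLinearMap.comp_apply, fderiv_apply_one_eq_deriv,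
        h3.deriv]
    rw [h1, kahlerMetric_apply, ← isJLinear_extChartAt_symm x hyt.2 w]
    have h4 : σ ((φ.symm ∘ fun t : ℝ => φ x + t • w) t)
        ![realDeriv 𝓘(ℝ, W) 𝓘(ℝ, W) φ.symm (φ x + t • w) w,
          realDeriv 𝓘(ℝ, W) 𝓘(ℝ, W) φ.symm (φ x + t • w) (cplxJ w)] =
        formInChart 𝓘(ℝ, W) σ x (φ x + t • w) ![w, cplxJ w] := by
      rw [formInChart_eq_pullback, DiffForm.pullback_eq, compContinuousLinearMap_two]
      rfl
    rw [h4]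
    refine ENNReal.ofReal_le_ofReal ?_
    rw [← Real.sqrt_sq (norm_nonneg w), ← Real.sqrt_mul hC0]
    refine Real.sqrt_le_sqrt ?_
    refine (Real.le_norm_self _).trans ((ContinuousAlternatingMap.le_opNorm _ _).trans ?_)
    have h5 : ‖cplxJ w‖ = ‖w‖ := by simp [cplxJ, norm_smul]
    simp only [Fin.prod_univ_two, Matrix.cons_val_zero, Matrix.cons_val_one, h5]
    rw [sq]
    exact mul_le_mul_of_nonneg_right hyt.1 (by positivity)
  calc _ ≤ ∫⁻ _ in Icc (0:ℝ) 1, ENNReal.ofReal (Real.sqrt C * ‖w‖) :=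
        setLIntegral_mono' measurableSet_Icc fun t ht => hle t ht
    _ = _ := by simp

theorem eventually_riemDist_lt {σ : DiffForm W M 2} (hσ : IsKahlerForm σ) (x : M) {ε : ENNReal}
    (hε : 0 < ε) : ∀ᶠ y in 𝓝 x, riemDist 𝓘(ℝ, W) (kahlerMetric σ) x y < ε := by
  obtain ⟨C, -, h⟩ := exists_riemDist_le hσ x
  have h1 : Tendsto (fun y => ENNReal.ofReal
      (C * ‖extChartAt 𝓘(ℝ, W) x y - extChartAt 𝓘(ℝ, W) x x‖)) (𝓝 x) (𝓝 0) := by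
    have h2 : ContinuousAt (fun y => ENNReal.ofReal
      (C * ‖extChartAt 𝓘(ℝ, W) x y - extChartAt 𝓘(ℝ, W) x x‖)) x :=
      ENNReal.continuous_ofReal.continuousAt.comp (continuousAt_const.mul
        ((continuousAt_extChartAt x).sub continuousAt_const).norm)
    simpa [ContinuousAt] using h2
  filter_upwards [h, h1.eventually (gt_mem_nhds hε)] with y hy hy' using hy.trans_lt hy'

/-- A Kähler metric is complete as soon as it admits a proper function with bounded
differential. -/
theorem isCompleteMetric_of_proper [FirstCountableTopology M] {σ : DiffForm W M 2}
    (hσ : IsKahlerForm σ) {ρ : M → ℝ} (hρ : ContMDiff 𝓘(ℝ, W) 𝓘(ℝ, ℝ) 1 ρ)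
    (hbound : ∀ x u, |realDeriv 𝓘(ℝ, W) 𝓘(ℝ, ℝ) ρ x u| ≤ Real.sqrt (kahlerMetric σ x ![u, u]))
    (hproper : ∀ c : ℝ, ∃ K : Set M, IsCompact K ∧ ∀ x, ρ x ≤ c → x ∈ K) :
    IsCompleteMetric 𝓘(ℝ, W) (kahlerMetric σ) := by
  intro u hu
  obtain ⟨n₀, hn₀⟩ := hu 1 one_pos
  obtain ⟨K, hK, hKc⟩ := hproper (ρ (u n₀) + 1)
  have hmem : ∀ j, u (n₀ + j) ∈ K := by
    intro j
    refine hKc _ ?_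
    have h1 := (ofReal_abs_sub_le_riemDist σ hρ hbound (u n₀) (u (n₀ + j))).trans_lt
      (hn₀ n₀ le_rfl (n₀ + j) (Nat.le_add_right _ _))
    rw [← ENNReal.ofReal_one, ENNReal.ofReal_lt_ofReal_iff one_pos] at h1
    have := (abs_lt.1 h1).2
    linarith
  obtain ⟨x, -, φ, hφ, hx⟩ := hK.tendsto_subseq hmem
  refine ⟨x, ?_⟩
  rw [ENNReal.tendsto_nhds_zero]
  intro ε hε
  have hε2 : 0 < ε / 2 := ENNReal.half_pos hε.ne'
  obtain ⟨N, hN⟩ := hu (ε / 2) hε2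
  have h1 := hx.eventually (eventually_riemDist_lt hσ x hε2)
  obtain ⟨k, hk1, hk2⟩ := (h1.and (eventually_ge_atTop N)).exists
  filter_upwards [eventually_ge_atTop N] with i hi
  have h3 : N ≤ n₀ + φ k := hk2.trans ((hφ.id_le k).trans (Nat.le_add_left _ _))
  calc _ ≤ riemDist 𝓘(ℝ, W) (kahlerMetric σ) (u i) (u (n₀ + φ k)) +
        riemDist 𝓘(ℝ, W) (kahlerMetric σ) (u (n₀ + φ k)) x := riemDist_triangle σ _ _ _
    _ ≤ ε / 2 + ε / 2 := by
        refine add_le_add (hN i hi _ h3).le ?_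
        rw [riemDist_comm]
        exact hk1.le
    _ = ε := ENNReal.add_halves ε

theorem riemDist_lt_top [PreconnectedSpace M] {σ : DiffForm W M 2} (hσ : IsKahlerForm σ)
    (x y : M) : riemDist 𝓘(ℝ, W) (kahlerMetric σ) x y < ⊤ := by
  have hclopen : IsClopen {y | riemDist 𝓘(ℝ, W) (kahlerMetric σ) x y < ⊤} := by
    refine ⟨⟨isOpen_iff_mem_nhds.2 fun y hy => ?_⟩, isOpen_iff_mem_nhds.2 fun y hy => ?_⟩
    · filter_upwards [eventually_riemDist_lt hσ y one_pos] with z hz hz'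
      refine hy ((riemDist_triangle σ x z y).trans_lt (ENNReal.add_lt_top.2 ⟨hz', ?_⟩))
      rw [riemDist_comm]
      exact hz.trans ENNReal.one_lt_top
    · filter_upwards [eventually_riemDist_lt hσ y one_pos] with z hz
      exact (riemDist_triangle σ x y z).trans_lt
        (ENNReal.add_lt_top.2 ⟨hy, hz.trans ENNReal.one_lt_top⟩)
  have h := hclopen.eq_univ ⟨x, by simp [riemDist_self]⟩
  have hy : y ∈ {y | riemDist 𝓘(ℝ, W) (kahlerMetric σ) x y < ⊤} := by
    rw [h]
    exact mem_univ y
  exact hy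

theorem isBoundedFor_of_isCompact [PreconnectedSpace M] {σ : DiffForm W M 2} (hσ : IsKahlerForm σ)
    {K s : Set M} (hK : IsCompact K) (hs : s ⊆ K) :
    IsBoundedFor 𝓘(ℝ, W) (kahlerMetric σ) s := by
  rcases s.eq_empty_or_nonempty with rfl | ⟨x₀, -⟩
  · exact ⟨0, by simp⟩
  obtain ⟨C, hC⟩ : ∃ C : NNReal, ∀ x ∈ K, riemDist 𝓘(ℝ, W) (kahlerMetric σ) x₀ x ≤ C := by
    refine hK.induction_on (p := fun K => ∃ C : NNReal, ∀ x ∈ K,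
      riemDist 𝓘(ℝ, W) (kahlerMetric σ) x₀ x ≤ C) ⟨0, by simp⟩ ?_ ?_ ?_
    · rintro s t hst ⟨C, hC⟩
      exact ⟨C, fun x hx => hC x (hst hx)⟩
    · rintro s t ⟨C, hC⟩ ⟨C', hC'⟩
      refine ⟨max C C', fun x hx => ?_⟩
      rcases hx with hx | hx
      · exact (hC x hx).trans (by simp)
      · exact (hC' x hx).trans (by simp)
    · intro x _
      refine ⟨_, mem_nhdsWithin_of_mem_nhds (eventually_riemDist_lt hσ x one_pos),
        (riemDist 𝓘(ℝ, W) (kahlerMetric σ) x₀ x).toNNReal + 1, fun y hy => ?_⟩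
      refine (riemDist_triangle σ x₀ x y).trans ?_
      rw [ENNReal.coe_add, ENNReal.coe_toNNReal (riemDist_lt_top hσ x₀ x).ne]
      exact add_le_add le_rfl (le_of_lt hy)
  refine ⟨C + C, fun x hx y hy => (riemDist_triangle σ x x₀ y).trans ?_⟩
  rw [ENNReal.coe_add]
  refine add_le_add ?_ (hC y (hs hy))
  rw [riemDist_comm]
  exact hC x (hs hx)

end Distance


/-! ### The regular part of the orbifold -/

section OrbifoldTopology

open Set Filter

variable {D : Type*} {m : ℕ} {γ : Equiv.Perm D}

theorem deck_zpow_apply (k : ℤ) (p : ℂ × D) :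
    (deck m γ ^ k) p = (Complex.exp (2 * Real.pi * Complex.I / m) ^ k * p.1, (γ ^ k) p.2) := by
  induction k with
  | zero => simp
  | succ k ih =>
    rw [add_comm, zpow_add, zpow_add, Equiv.Perm.mul_apply, ih, zpow_one, zpow_one,
      zpow_add₀ (Complex.exp_ne_zero _)]
    simp [deck, mul_assoc]
  | pred k ih =>
    rw [sub_eq_neg_add, zpow_add, zpow_add, Equiv.Perm.mul_apply, ih, zpow_neg_one, zpow_neg_one,
      zpow_add₀ (Complex.exp_ne_zero _), Equiv.Perm.inv_def]
    simp [deck, mul_assoc]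

theorem Orbifold.mk_eq_mk_iff {p q : ℂ × D} :
    Orbifold.mk m γ p = Orbifold.mk m γ q ↔ ∃ k : ℤ, (deck m γ ^ k) q = p := by
  rw [Orbifold.mk, Orbifold.mk, Quotient.eq, MulAction.orbitRel_apply, MulAction.mem_orbit_iff]
  constructor
  · rintro ⟨⟨g, k, hk⟩, h⟩
    exact ⟨k, (congrArg (fun g : Equiv.Perm (ℂ × D) => g q) hk).trans h⟩
  · rintro ⟨k, h⟩
    exact ⟨⟨deck m γ ^ k, k, rfl⟩, h⟩

theorem Orbifold.mk_deck (p : ℂ × D) : Orbifold.mk m γ (deck m γ p) = Orbifold.mk m γ p :=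
  Orbifold.mk_eq_mk_iff.2 ⟨1, by rw [zpow_one]⟩

theorem norm_exp_root (m : ℕ) : ‖Complex.exp (2 * Real.pi * Complex.I / m)‖ = 1 := by
  rw [Complex.norm_exp]
  have : (2 * Real.pi * Complex.I / m : ℂ) = ((2 * Real.pi / m : ℝ) : ℂ) * Complex.I := by
    push_cast; ring
  rw [this, Complex.re_ofReal_mul, Complex.I_re, mul_zero, Real.exp_zero]

/-- The function `|z|` on the orbifold. -/
def Orbifold.radius (m : ℕ) (γ : Equiv.Perm D) : Orbifold m γ → ℝ :=
  Quotient.lift (fun p : ℂ × D => ‖p.1‖) fun p q h => by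
    have h1 : Orbifold.mk m γ p = Orbifold.mk m γ q := Quotient.sound h
    obtain ⟨k, rfl⟩ := Orbifold.mk_eq_mk_iff.1 h1
    simp [deck_zpow_apply, norm_exp_root]

theorem Orbifold.radius_mk (p : ℂ × D) : Orbifold.radius m γ (Orbifold.mk m γ p) = ‖p.1‖ := rfl

theorem Orbifold.exists_mk (q : Orbifold m γ) : ∃ p, Orbifold.mk m γ p = q :=
  Quotient.exists_rep q

/-- The points with `z ≠ 0` are regular. -/
theorem mk_notMem_singularPart (hm : 0 < m) (hγ : orderOf γ = m) {p : ℂ × D} (hp : p.1 ≠ 0) :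
    Orbifold.mk m γ p ∉ singularPart m γ := by
  rintro ⟨q, hq, hqp⟩
  refine hq ((Subgroup.eq_bot_iff_forall _).2 ?_)
  have hq1 : q.1 ≠ 0 := by
    have h := congrArg (Orbifold.radius m γ) hqp
    rw [Orbifold.radius_mk, Orbifold.radius_mk] at h
    rw [← norm_ne_zero_iff, h, norm_ne_zero_iff]
    exact hp
  rintro ⟨g, k, hk⟩ hg
  change deck m γ ^ k = g at hk
  subst hk
  have h1 : (deck m γ ^ k) q = q := hg
  have hm0 : (m : ℂ) ≠ 0 := by exact_mod_cast hm.ne'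
  have h2 : Complex.exp (2 * Real.pi * Complex.I / m) ^ k = 1 := by
    have h := congrArg Prod.fst h1
    rw [deck_zpow_apply] at h
    exact mul_right_cancel₀ hq1 (h.trans (one_mul _).symm)
  rw [← Complex.exp_int_mul, Complex.exp_eq_one_iff] at h2
  obtain ⟨n, hn⟩ := h2
  have h3 : k = n * m := by
    have h4 : (k : ℂ) = n * m := by
      have h5 : (2 * Real.pi * Complex.I : ℂ) ≠ 0 := Complex.two_pi_I_ne_zero
      have h6 : (2 * Real.pi * Complex.I : ℂ) * k = (2 * Real.pi * Complex.I : ℂ) * (n * m) := by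
        field_simp at hn
        rw [hn]
        ring
      exact mul_left_cancel₀ h5 h6
    exact_mod_cast h4
  refine Subtype.ext (Equiv.ext fun x => ?_)
  have h7 : γ ^ k = 1 := by
    rw [h3, mul_comm, zpow_mul, zpow_natCast, ← hγ, pow_orderOf_eq_one, one_zpow]
  have h8 : Complex.exp (2 * Real.pi * Complex.I / m) ^ k = 1 := by
    rw [← Complex.exp_int_mul, Complex.exp_eq_one_iff]
    exact ⟨n, hn⟩
  change (deck m γ ^ k) x = x
  rw [deck_zpow_apply, h7, h8, one_mul]
  rfl

variable [TopologicalSpace D]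

theorem Orbifold.continuous_mk : Continuous (Orbifold.mk m γ) := continuous_quotient_mk'

theorem Orbifold.continuous_radius : Continuous (Orbifold.radius m γ) :=
  Continuous.quotient_lift (by fun_prop) _

theorem Orbifold.isCompact_radius_le [CompactSpace D] (c : ℝ) :
    IsCompact {q : Orbifold m γ | Orbifold.radius m γ q ≤ c} := by
  have h : {q : Orbifold m γ | Orbifold.radius m γ q ≤ c} =
      Orbifold.mk m γ '' (Metric.closedBall (0 : ℂ) c ×ˢ univ) := by
    ext q
    obtain ⟨p, rfl⟩ := Orbifold.exists_mk q
    constructor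
    · intro hp
      exact ⟨p, ⟨mem_closedBall_zero_iff.2 hp, mem_univ _⟩, rfl⟩
    · rintro ⟨p', hp', h⟩
      rw [← h]
      exact mem_closedBall_zero_iff.1 hp'.1
  rw [h]
  exact ((isCompact_closedBall _ _).prod isCompact_univ).image Orbifold.continuous_mk

end OrbifoldTopology

/-! ### The cylindrical end of a resolution with a `ℂ*`-action -/

section CylindricalEnd

open Set Filter

variable {D : Type*} [TopologicalSpace D]
  {V : Type*} [NormedAddCommGroup V] [NormedSpace ℂ V] [ChartedSpace V D]
  {W : Type*} [NormedAddCommGroup W] [NormedSpace ℂ W]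
  {M : Type*} [TopologicalSpace M] [ChartedSpace W M]

/-- A map from `ℂ × D`, read in the preferred chart of `D` at `w₀`. -/
def inChartOfD (V : Type*) [NormedAddCommGroup V] [NormedSpace ℂ V] [ChartedSpace V D]
    (e : ℂ × D → M) (w₀ : D) (p : ℂ × V) : M :=
  e (p.1, (extChartAt 𝓘(ℝ, V) w₀).symm p.2)

/-- A complex manifold `M` with a holomorphic circle action `A` and a proper function `τ`, whose
part `{τ > 0}` is covered by a locally biholomorphic map `e` from `ℂ × D` which is invariant under
`(ζ, w) ↦ (ζ + 2πi/m, γ(w))` and satisfies `τ (e (ζ, w)) = exp (re ζ)`, the circle acting by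
imaginary translations of `ζ`.  Two points of a fibre of `e` have `D`-components in the same orbit
of `γ`.  Local inverses of `e` are taken in the charts of `D`, where `e` is `inChartOfD V e w₀`. -/
structure IsCylindricalEnd (V W : Type*) [NormedAddCommGroup V] [NormedSpace ℂ V]
    [ChartedSpace V D] [NormedAddCommGroup W] [NormedSpace ℂ W] [ChartedSpace W M]
    (m : ℕ) (γ : Equiv.Perm D) (A : ℝ → M → M) (τ : M → ℝ) (e : ℂ × D → M) : Prop where
  circleAction : IsCircleAction (W := W) A
  continuous : Continuous τ
  isCompact_le : ∀ c : ℝ, IsCompact {x | τ x ≤ c}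
  apply_eq : ∀ p, τ (e p) = Real.exp p.1.re
  exists_eq : ∀ x, 0 < τ x → ∃ p, e p = x
  snd_eq : ∀ p q, e p = e q → ∃ k : ℤ, p.2 = (γ ^ k) q.2
  rotate : ∀ (θ : ℝ) (p : ℂ × D), A θ (e p) = e (p.1 + 2 * Real.pi * θ * Complex.I, p.2)
  deck : ∀ (ζ : ℂ) (w : D), A (1 / m) (e (ζ, γ w)) = e (ζ, w)
  holomorphic : ContMDiff (𝓘(ℂ, ℂ).prod 𝓘(ℂ, V)) 𝓘(ℂ, W) ω e
  exists_localInverse : ∀ (w₀ : D) (ζ : ℂ), ∀ y ∈ (extChartAt 𝓘(ℝ, V) w₀).target,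
    ∃ Q : M → ℂ × V, ContMDiffAt 𝓘(ℝ, W) 𝓘(ℝ, ℂ × V) ∞ Q (inChartOfD V e w₀ (ζ, y)) ∧
      (∀ᶠ p in 𝓝 (ζ, y), Q (inChartOfD V e w₀ p) = p) ∧
      ∀ᶠ x in 𝓝 (inChartOfD V e w₀ (ζ, y)), inChartOfD V e w₀ (Q x) = x

namespace Resolution

variable {m : ℕ} {γ : Equiv.Perm D} (R : Resolution V W m γ M)

/-- The function `|z|` on a resolution. -/
def radius (x : M) : ℝ := Orbifold.radius m γ (R.proj x)

/-- The covering `(ζ, w) ↦ [exp ζ, w]` of the cylindrical end of a resolution. -/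
def expLift (p : ℂ × D) : M := R.lift (Complex.exp p.1, p.2)

theorem continuous_radius : Continuous R.radius :=
  Orbifold.continuous_radius.comp R.proper.continuous

theorem isCompact_radius_le [CompactSpace D] (c : ℝ) : IsCompact {x | R.radius x ≤ c} :=
  R.proper.isCompact_preimage (Orbifold.isCompact_radius_le c)

theorem eq_lift_of_proj_eq {x : M} {p : ℂ × D} (hp : Orbifold.mk m γ p ∉ singularPart m γ)
    (hx : R.proj x = Orbifold.mk m γ p) : x = R.lift p := by
  refine R.injOn ?_ ?_ (hx.trans (R.proj_lift p hp).symm)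
  · rw [mem_preimage, hx]; exact hp
  · rw [mem_preimage, R.proj_lift p hp]; exact hp

variable (hm : 0 < m) (hγ : orderOf γ = m)
include hm hγ

theorem radius_lift {p : ℂ × D} (hp : p.1 ≠ 0) : R.radius (R.lift p) = ‖p.1‖ := by
  rw [radius, R.proj_lift p (mk_notMem_singularPart hm hγ hp), Orbifold.radius_mk]

theorem radius_expLift (p : ℂ × D) : R.radius (R.expLift p) = Real.exp p.1.re := by
  rw [expLift, R.radius_lift hm hγ (Complex.exp_ne_zero _), Complex.norm_exp]

theorem exists_lift_eq {x : M} (hx : 0 < R.radius x) :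
    ∃ p : ℂ × D, p.1 ≠ 0 ∧ R.lift p = x := by
  obtain ⟨p, hp⟩ := Orbifold.exists_mk (R.proj x)
  have hp1 : p.1 ≠ 0 := by
    rw [radius, ← hp, Orbifold.radius_mk] at hx
    exact norm_pos_iff.1 hx
  exact ⟨p, hp1, (R.eq_lift_of_proj_eq (mk_notMem_singularPart hm hγ hp1) hp.symm).symm⟩

theorem exists_expLift_eq {x : M} (hx : 0 < R.radius x) : ∃ p : ℂ × D, R.expLift p = x := by
  obtain ⟨p, hp, h⟩ := R.exists_lift_eq hm hγ hx
  exact ⟨(Complex.log p.1, p.2), by rw [expLift, Complex.exp_log hp]; exact h⟩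

theorem core_eq : R.core = {x | R.radius x < 1} := by
  ext x
  rw [core, mem_compl_iff, mem_ofPred_eq, ← not_le, not_iff_not]
  constructor
  · rintro ⟨p, ⟨hp, hp1⟩, rfl⟩
    rw [R.radius_lift hm hγ hp]
    rwa [cylParam, Real.log_nonneg_iff (norm_pos_iff.2 hp)] at hp1
  · intro hx
    obtain ⟨p, hp, rfl⟩ := R.exists_lift_eq hm hγ (one_pos.trans_le hx)
    rw [R.radius_lift hm hγ hp] at hx
    exact ⟨p, ⟨hp, Real.log_nonneg hx⟩, rfl⟩

theorem continuous_expLift : Continuous R.expLift := by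
  rw [continuous_iff_continuousAt]
  intro p
  have h := (R.lift_biholomorphic ⟨(Complex.exp p.1, p.2),
    mk_notMem_singularPart hm hγ (Complex.exp_ne_zero _)⟩).contMDiffAt.continuousAt
  exact ContinuousAt.comp (f := fun p : ℂ × D => (Complex.exp p.1, p.2)) h (by fun_prop)

include R in
theorem preconnectedSpace [ConnectedSpace D] : PreconnectedSpace M := by
  have h1 : IsPreconnected (range R.expLift) := isPreconnected_range (R.continuous_expLift hm hγ)
  have h2 : R.proj ⁻¹' (singularPart m γ)ᶜ ⊆ closure (range R.expLift) := by
    intro x hx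
    obtain ⟨p, hp⟩ := Orbifold.exists_mk (R.proj x)
    have hreg : Orbifold.mk m γ p ∉ singularPart m γ := by rw [hp]; exact hx
    rw [R.eq_lift_of_proj_eq hreg hp.symm]
    have hc := (R.lift_biholomorphic ⟨p, hreg⟩).contMDiffAt.continuousAt
    have hcl : p ∈ closure {q : ℂ × D | q.1 ≠ 0} := by
      have : {q : ℂ × D | q.1 ≠ 0} = {(0:ℂ)}ᶜ ×ˢ univ := by ext; simp
      rw [this, closure_prod_eq, closure_univ]
      exact ⟨dense_compl_singleton (0:ℂ) p.1, mem_univ _⟩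
    refine closure_mono ?_ (mem_closure_image hc hcl)
    rintro _ ⟨q, hq, rfl⟩
    exact ⟨(Complex.log q.1, q.2), by rw [expLift, Complex.exp_log hq]⟩
  have h3 : closure (range R.expLift) = univ :=
    (dense_closure.1 (R.dense.mono h2)).closure_eq
  exact ⟨h3 ▸ h1.closure⟩

theorem lift_eq_lift {p q : ℂ × D} (hp : p.1 ≠ 0) (hq : q.1 ≠ 0) (h : R.lift p = R.lift q) :
    ∃ k : ℤ, (deck m γ ^ k) q = p := by
  have h1 := congrArg R.proj h
  rw [R.proj_lift p (mk_notMem_singularPart hm hγ hp),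
    R.proj_lift q (mk_notMem_singularPart hm hγ hq)] at h1
  exact Orbifold.mk_eq_mk_iff.1 h1

theorem lift_deck {p : ℂ × D} (hp : p.1 ≠ 0) : R.lift (deck m γ p) = R.lift p := by
  refine R.eq_lift_of_proj_eq (mk_notMem_singularPart hm hγ hp) ?_
  rw [R.proj_lift, Orbifold.mk_deck]
  rw [Orbifold.mk_deck]
  exact mk_notMem_singularPart hm hγ hp

/-- The circle in `ℂ*` acts on the resolution by holomorphic maps, and by rotations of `z`. -/
theorem exists_circleAction (hR : R.ActionExtends) : ∃ A : ℝ → M → M,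
    IsCircleAction (W := W) A ∧ ∀ (θ : ℝ) (p : ℂ × D), p.1 ≠ 0 →
      A θ (R.lift p) = R.lift (Complex.exp (2 * Real.pi * θ * Complex.I) * p.1, p.2) := by
  obtain ⟨act, hsm, heq⟩ := hR
  set c : ℝ → ℂˣ := fun θ =>
    Units.mk0 (Complex.exp (2 * Real.pi * θ * Complex.I)) (Complex.exp_ne_zero _) with hc
  have hcs : ContMDiff 𝓘(ℝ, ℝ) 𝓘(ℝ, ℂ) ∞ c := by
    refine ContMDiff.of_comp_isOpenEmbedding Units.isOpenEmbedding_val ?_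
    refine contMDiff_iff_contDiff.2 ?_
    change ContDiff ℝ ∞ fun θ : ℝ => Complex.exp (2 * Real.pi * θ * Complex.I)
    exact (((contDiff_const.mul Complex.ofRealCLM.contDiff).mul contDiff_const)).cexp
  have hact : ContMDiff (𝓘(ℝ, ℂ).prod 𝓘(ℝ, W)) 𝓘(ℝ, W) ∞ fun p : ℂˣ × M => p.1 • p.2 :=
    fun p => (((sameModel_self ℂ).prod (sameModel_self W)).contMDiffAt (sameModel_self W)
      (hsm p)).of_le le_top
  refine ⟨fun θ x => c θ • x, ⟨?_, fun s x => ?_, ?_, ?_, fun s t => ?_⟩, fun θ p hp => ?_⟩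
  · exact hact.comp ((hcs.comp contMDiff_fst).prodMk contMDiff_snd)
  · have h : ContMDiff 𝓘(ℂ, W) 𝓘(ℂ, W) ω fun x : M => c s • x :=
      hsm.comp (contMDiff_const.prodMk contMDiff_id)
    exact isJLinear_realDeriv_self (h x)
  · have h : c 0 = 1 := Units.ext (by simp [hc])
    funext x
    simp [h]
  · have h : c 1 = 1 := Units.ext (by simp [hc, Complex.exp_two_pi_mul_I])
    funext x
    simp [h]
  · have h : c (s + t) = c s * c t := Units.ext (by
      simp only [hc, Units.val_mk0, Units.val_mul, ← Complex.exp_add]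
      congr 1
      push_cast
      ring)
    funext x
    simp [h, mul_smul]
  · have hreg := mk_notMem_singularPart (γ := γ) hm hγ hp
    exact R.eq_lift_of_proj_eq
      (mk_notMem_singularPart hm hγ (mul_ne_zero (Complex.exp_ne_zero _) hp))
      (heq (c θ) (R.lift p) p.1 p.2 (R.proj_lift p hreg))

/-- Near a point of a cylinder, the inverse of `(ζ, y) ↦ (exp ζ, ψ⁻¹ y)`, with `ψ` a chart of `D`,
is given by a branch of the logarithm. -/
theorem exists_localInverse_expLift [IsManifold 𝓘(ℂ, V) ω D]
    (w₀ : D) (ζ : ℂ) {y : V} (hy : y ∈ (extChartAt 𝓘(ℝ, V) w₀).target) :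
    ∃ Q : M → ℂ × V, ContMDiffAt 𝓘(ℝ, W) 𝓘(ℝ, ℂ × V) ∞ Q (inChartOfD V R.expLift w₀ (ζ, y)) ∧
      (∀ᶠ p in 𝓝 (ζ, y), Q (inChartOfD V R.expLift w₀ p) = p) ∧
      ∀ᶠ x in 𝓝 (inChartOfD V R.expLift w₀ (ζ, y)), inChartOfD V R.expLift w₀ (Q x) = x := by
  set ψ := extChartAt 𝓘(ℝ, V) w₀ with hψ
  set p₀ : ℂ × D := (Complex.exp ζ, ψ.symm y) with hp₀
  have hlift := R.lift_biholomorphic ⟨p₀, mk_notMem_singularPart hm hγ (Complex.exp_ne_zero _)⟩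
  set E : ℂ × V → ℂ × D := fun p => (Complex.exp p.1, ψ.symm p.2) with hE
  have hEq : inChartOfD V R.expLift w₀ = R.lift ∘ E := rfl
  have hEc : ContinuousAt E (ζ, y) :=
    (Complex.continuous_exp.continuousAt.comp continuousAt_fst).prodMk
      (ContinuousAt.comp (g := ψ.symm) (f := Prod.snd) (continuousAt_extChartAt_symm'' hy)
        continuousAt_snd)
  set Φ := hlift.localInverse with hΦ
  have hΦ0 : Φ (R.lift p₀) = p₀ := hlift.localInverse_left_inv hlift.localInverse_mem_target
  set L : ℂ × D → ℂ × V := fun q => (ζ + Complex.log (q.1 / Complex.exp ζ), ψ q.2) with hL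
  have hyD : ψ.symm y ∈ ψ.source := ψ.map_target hy
  have hLs : ContMDiffAt (𝓘(ℝ, ℂ).prod 𝓘(ℝ, V)) 𝓘(ℝ, ℂ × V) ∞ L p₀ := by
    have h1 : ContMDiffAt (𝓘(ℝ, ℂ).prod 𝓘(ℝ, V)) 𝓘(ℝ, ℂ) ∞
        (fun q : ℂ × D => ζ + Complex.log (q.1 / Complex.exp ζ)) p₀ := by
      have h2 : ContDiffAt ℝ ∞ (fun z : ℂ => ζ + Complex.log (z / Complex.exp ζ)) p₀.1 := by
        have h3 : ContDiffAt ℂ ∞ (fun z : ℂ => ζ + Complex.log (z / Complex.exp ζ)) p₀.1 := by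
          refine contDiffAt_const.add (ContDiffAt.comp (g := Complex.log) _
            (Complex.contDiffAt_log ?_) (contDiffAt_id.div_const _))
          simp [hp₀]
        exact h3.restrict_scalars ℝ
      exact ContMDiffAt.comp (g := fun z : ℂ => ζ + Complex.log (z / Complex.exp ζ))
        (f := Prod.fst) p₀ (contMDiffAt_iff_contDiffAt.2 h2) contMDiffAt_fst
    have h2 : ContMDiffAt (𝓘(ℝ, ℂ).prod 𝓘(ℝ, V)) 𝓘(ℝ, V) ∞ (fun q : ℂ × D => ψ q.2) p₀ :=
      ContMDiffAt.comp (g := ψ) (f := Prod.snd) p₀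
        (contMDiffAt_extChartAt' (by rwa [← extChartAt_source 𝓘(ℝ, V)])) contMDiffAt_snd
    exact h1.prodMk_space h2
  have hexp : ∀ z : ℂ, z ≠ 0 → Complex.exp (ζ + Complex.log (z / Complex.exp ζ)) = z := by
    intro z hz
    rw [Complex.exp_add, Complex.exp_log (div_ne_zero hz (Complex.exp_ne_zero _))]
    field_simp
  have hΦs : ContMDiffAt 𝓘(ℝ, W) (𝓘(ℝ, ℂ).prod 𝓘(ℝ, V)) ∞ Φ (R.lift p₀) :=
    ((sameModel_self W).contMDiffAt ((sameModel_self ℂ).prod (sameModel_self V))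
      hlift.localInverse_contMDiffAt).of_le le_top
  refine ⟨L ∘ Φ, ?_, ?_, ?_⟩
  · exact ContMDiffAt.comp (g := L) (f := Φ) (R.lift p₀) (by rw [hΦ0]; exact hLs) hΦs
  · have h1 : ∀ᶠ p in 𝓝 (ζ, y), Φ (R.lift (E p)) = E p :=
      hEc.eventually (hlift.localInverse_eventuallyEq_left)
    have h2 : ∀ᶠ p : ℂ × V in 𝓝 (ζ, y), p.2 ∈ ψ.target :=
      continuousAt_snd.eventually ((isOpen_extChartAt_target w₀).mem_nhds hy)
    have h3 : ∀ᶠ p : ℂ × V in 𝓝 (ζ, y), |(p.1 - ζ).im| < 1 := by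
      have : ContinuousAt (fun p : ℂ × V => |(p.1 - ζ).im|) (ζ, y) := by fun_prop
      exact this.eventually (gt_mem_nhds (by simp))
    filter_upwards [h1, h2, h3] with p hp1 hp2 hp3
    rw [hEq, Function.comp_apply, Function.comp_apply, hp1]
    refine Prod.ext ?_ (ψ.right_inv hp2)
    change ζ + Complex.log (Complex.exp p.1 / Complex.exp ζ) = p.1
    rw [← Complex.exp_sub, Complex.log_exp, add_sub_cancel]
    · linarith [(abs_lt.1 hp3).1, Real.pi_gt_three]
    · linarith [(abs_lt.1 hp3).2, Real.pi_gt_three]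
  · have h1 : ∀ᶠ x in 𝓝 (R.lift p₀), R.lift (Φ x) = x := hlift.localInverse_eventuallyEq_right
    have h2 : ContinuousAt Φ (R.lift p₀) := hΦs.continuousAt
    have h3 : ∀ᶠ x in 𝓝 (R.lift p₀), (Φ x).1 ≠ 0 ∧ (Φ x).2 ∈ ψ.source := by
      have h4 : ∀ᶠ q : ℂ × D in 𝓝 p₀, q.1 ≠ 0 ∧ q.2 ∈ ψ.source :=
        (continuousAt_fst.eventually_ne (Complex.exp_ne_zero ζ)).and
          (continuousAt_snd.eventually ((isOpen_extChartAt_source w₀).mem_nhds hyD))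
      rw [← hΦ0] at h4
      exact h2.eventually h4
    filter_upwards [h1, h3] with x hx1 hx3
    have h4 : E (L (Φ x)) = Φ x := Prod.ext (hexp _ hx3.1) (ψ.left_inv hx3.2)
    rw [hEq, Function.comp_apply, Function.comp_apply, h4, hx1]

theorem isCylindricalEnd_expLift [CompactSpace D] [IsManifold 𝓘(ℂ, V) ω D]
    (hR : R.ActionExtends) : ∃ A : ℝ → M → M,
    IsCylindricalEnd V W m γ A R.radius R.expLift := by
  obtain ⟨A, hA, hAl⟩ := R.exists_circleAction hm hγ hR
  refine ⟨A, hA, R.continuous_radius, R.isCompact_radius_le, R.radius_expLift hm hγ,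
    fun x hx => R.exists_expLift_eq hm hγ hx, fun p q h => ?_, fun θ p => ?_, fun ζ w => ?_,
    fun p => ?_, fun w₀ ζ y hy => R.exists_localInverse_expLift hm hγ w₀ ζ hy⟩
  · obtain ⟨k, hk⟩ := R.lift_eq_lift hm hγ (Complex.exp_ne_zero _) (Complex.exp_ne_zero _) h
    rw [deck_zpow_apply] at hk
    exact ⟨k, (congrArg Prod.snd hk).symm⟩
  · rw [expLift, hAl θ _ (Complex.exp_ne_zero _), expLift, Complex.exp_add, mul_comm]
  · rw [expLift, hAl _ _ (Complex.exp_ne_zero _), expLift,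
      ← R.lift_deck hm hγ (p := (Complex.exp ζ, w)) (Complex.exp_ne_zero _)]
    congr 2
    change _ = Complex.exp (2 * Real.pi * Complex.I / m) * Complex.exp ζ
    congr 2
    push_cast
    ring
  · refine ContMDiffAt.comp (g := R.lift) (f := fun p : ℂ × D => (Complex.exp p.1, p.2)) p
      (R.lift_biholomorphic ⟨(Complex.exp p.1, p.2),
        mk_notMem_singularPart hm hγ (Complex.exp_ne_zero _)⟩).contMDiffAt ?_
    exact (ContMDiffAt.comp (g := Complex.exp) (f := Prod.fst) p
      (contMDiffAt_iff_contDiffAt.2 Complex.contDiff_exp.contDiffAt) contMDiffAt_fst).prodMk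
      contMDiffAt_snd

end Resolution

end CylindricalEnd


/-! ### Invariant forms on the cylindrical end -/

section EndForms

open Set Filter

variable {D : Type*} [TopologicalSpace D]
  {V : Type*} [NormedAddCommGroup V] [NormedSpace ℂ V] [ChartedSpace V D]
  {W : Type*} [NormedAddCommGroup W] [NormedSpace ℂ W]
  {M : Type*} [TopologicalSpace M] [ChartedSpace W M]

/-- The derivative of a map from `ℂ × D`. -/
abbrev endDeriv (V W : Type*) [NormedAddCommGroup V] [NormedSpace ℂ V]
    [ChartedSpace V D] [NormedAddCommGroup W] [NormedSpace ℂ W] [ChartedSpace W M]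
    (e : ℂ × D → M) (p : ℂ × D) : ℂ × V →L[ℝ] W :=
  realDeriv (𝓘(ℝ, ℂ).prod 𝓘(ℝ, V)) 𝓘(ℝ, W) e p

/-- The pullback of a `2`-form to `ℂ × D`. -/
def endForm (V : Type*) [NormedAddCommGroup V] [NormedSpace ℂ V] [ChartedSpace V D]
    (e : ℂ × D → M) (α : DiffForm W M 2) (p : ℂ × D) : (ℂ × V) [⋀^Fin 2]→L[ℝ] ℝ :=
  (α (e p)).compContinuousLinearMap (endDeriv V W e p)

/-- The pullback of a `2`-form to `ℂ × D`, read in the preferred chart of `D` at `w₀`. -/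
def endFormInChart (V : Type*) [NormedAddCommGroup V] [NormedSpace ℂ V] [ChartedSpace V D]
    (e : ℂ × D → M) (α : DiffForm W M 2) (w₀ : D) (p : ℂ × V) : (ℂ × V) [⋀^Fin 2]→L[ℝ] ℝ :=
  DiffForm.pullback 𝓘(ℝ, ℂ × V) 𝓘(ℝ, W) (inChartOfD V e w₀) α p

theorem endForm_apply (e : ℂ × D → M) (α : DiffForm W M 2) (p : ℂ × D) (u v : ℂ × V) :
    endForm V e α p ![u, v] = α (e p) ![endDeriv V W e p u, endDeriv V W e p v] :=
  compContinuousLinearMap_two _ _ _ _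

theorem endFormInChart_apply (e : ℂ × D → M) (α : DiffForm W M 2) (w₀ : D) (p u v : ℂ × V) :
    endFormInChart V e α w₀ p ![u, v] = α (inChartOfD V e w₀ p)
      ![realDeriv 𝓘(ℝ, ℂ × V) 𝓘(ℝ, W) (inChartOfD V e w₀) p u,
        realDeriv 𝓘(ℝ, ℂ × V) 𝓘(ℝ, W) (inChartOfD V e w₀) p v] :=
  compContinuousLinearMap_two _ _ _ _

namespace IsCylindricalEnd

variable {m : ℕ} {γ : Equiv.Perm D} {A : ℝ → M → M} {τ : M → ℝ} {e : ℂ × D → M}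
  (hE : IsCylindricalEnd V W m γ A τ e)
include hE

theorem mdifferentiableAt_real (p : ℂ × D) :
    MDifferentiableAt (𝓘(ℝ, ℂ).prod 𝓘(ℝ, V)) 𝓘(ℝ, W) e p :=
  (((sameModel_self ℂ).prod (sameModel_self V)).contMDiffAt (sameModel_self W)
    (hE.holomorphic p)).mdifferentiableAt (by simp)

theorem isJLinear_endDeriv (p : ℂ × D) : IsJLinear (endDeriv V W e p) :=
  ((sameModel_self ℂ).prod (sameModel_self V)).isJLinear_mfderiv (sameModel_self W)
    ((hE.holomorphic p).mdifferentiableAt (by simp))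

theorem apply_add_mul_I (ζ : ℂ) (θ : ℝ) (w : D) :
    A (θ / (2 * Real.pi)) (e (ζ, w)) = e (ζ + θ * Complex.I, w) := by
  rw [hE.rotate]
  congr 2
  have : (Real.pi : ℂ) ≠ 0 := by exact_mod_cast Real.pi_ne_zero
  push_cast
  field_simp

theorem exists_of_apply_eq {p q : ℂ × D} (h : e p = e q) :
    p.1.re = q.1.re ∧ ∃ k : ℤ, p.2 = (γ ^ k) q.2 := by
  refine ⟨?_, hE.snd_eq p q h⟩
  have h1 := congrArg τ h
  rwa [hE.apply_eq, hE.apply_eq, Real.exp_eq_exp] at h1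

section

variable [IsManifold 𝓘(ℂ, V) ω D]

theorem contMDiffAt_inChartOfD (w₀ : D) (ζ : ℂ) {y : V} (hy : y ∈ (extChartAt 𝓘(ℝ, V) w₀).target) :
    ContMDiffAt 𝓘(ℂ, ℂ × V) 𝓘(ℂ, W) ω (inChartOfD V e w₀) (ζ, y) := by
  have hsymm : ContMDiffAt 𝓘(ℂ, V) 𝓘(ℂ, V) ω (extChartAt 𝓘(ℝ, V) w₀).symm y :=
    (contMDiffOn_extChartAt_symm (I := 𝓘(ℂ, V)) (n := ω) w₀).contMDiffAt
      ((isOpen_extChartAt_target w₀).mem_nhds (x := y) hy)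
  refine ContMDiffAt.comp (g := e) (f := fun p : ℂ × V => (p.1, (extChartAt 𝓘(ℝ, V) w₀).symm p.2))
    (ζ, y) (hE.holomorphic _) (ContMDiffAt.prodMk ?_ ?_)
  · exact contMDiffAt_iff_contDiffAt.2 contDiffAt_fst
  · exact ContMDiffAt.comp (g := (extChartAt 𝓘(ℝ, V) w₀).symm) (f := Prod.snd) (ζ, y) hsymm
        (contMDiffAt_iff_contDiffAt.2 contDiffAt_snd)

theorem mdifferentiableAt_inChartOfD (w₀ : D) (ζ : ℂ) {y : V}
    (hy : y ∈ (extChartAt 𝓘(ℝ, V) w₀).target) :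
    MDifferentiableAt 𝓘(ℝ, ℂ × V) 𝓘(ℝ, W) (inChartOfD V e w₀) (ζ, y) :=
  (contMDiffAt_real_self (hE.contMDiffAt_inChartOfD w₀ ζ hy)).mdifferentiableAt (by simp)

theorem isJLinear_inChartOfD (w₀ : D) (ζ : ℂ) {y : V}
    (hy : y ∈ (extChartAt 𝓘(ℝ, V) w₀).target) :
    IsJLinear (realDeriv 𝓘(ℝ, ℂ × V) 𝓘(ℝ, W) (inChartOfD V e w₀) (ζ, y)) :=
  isJLinear_realDeriv_self (hE.contMDiffAt_inChartOfD w₀ ζ hy)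

theorem realDeriv_inChartOfD (w₀ : D) (ζ : ℂ) {y : V}
    (hy : y ∈ (extChartAt 𝓘(ℝ, V) w₀).target) (u : ℂ × V) :
    realDeriv 𝓘(ℝ, ℂ × V) 𝓘(ℝ, W) (inChartOfD V e w₀) (ζ, y) u =
      endDeriv V W e (ζ, (extChartAt 𝓘(ℝ, V) w₀).symm y)
        (u.1, realDeriv 𝓘(ℝ, V) 𝓘(ℝ, V) (extChartAt 𝓘(ℝ, V) w₀).symm y u.2) := by
  set ψ := extChartAt 𝓘(ℝ, V) w₀ with hψ
  have h1 : HasMFDerivAt 𝓘(ℝ, ℂ × V) 𝓘(ℝ, ℂ) (Prod.fst : ℂ × V → ℂ) (ζ, y)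
      (ContinuousLinearMap.fst ℝ ℂ V) := hasFDerivAt_fst.hasMFDerivAt
  have h2 : HasMFDerivAt 𝓘(ℝ, ℂ × V) 𝓘(ℝ, V) (Prod.snd : ℂ × V → V) (ζ, y)
      (ContinuousLinearMap.snd ℝ ℂ V) := hasFDerivAt_snd.hasMFDerivAt
  have h3 := HasMFDerivAt.comp (g := ψ.symm) (f := (Prod.snd : ℂ × V → V)) (ζ, y)
    (mdifferentiableAt_extChartAt_symm w₀ hy).hasMFDerivAt h2
  have h4 := HasMFDerivAt.comp (g := e) (f := fun p : ℂ × V => (p.1, ψ.symm p.2)) (ζ, y)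
    (hE.mdifferentiableAt_real (ζ, ψ.symm y)).hasMFDerivAt (h1.prodMk h3)
  exact congrArg (fun L : ℂ × V →L[ℝ] W => L u) h4.mfderiv

theorem realDeriv_inChartOfD_self (ζ : ℂ) (w : D) (u : ℂ × V) :
    realDeriv 𝓘(ℝ, ℂ × V) 𝓘(ℝ, W) (inChartOfD V e w) (ζ, extChartAt 𝓘(ℝ, V) w w) u =
      endDeriv V W e (ζ, w) u := by
  rw [hE.realDeriv_inChartOfD w ζ (mem_extChartAt_target w), realDeriv_extChartAt_symm_self,
    extChartAt_to_inv]
  rfl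

theorem endFormInChart_eq (α : DiffForm W M 2) (w₀ : D) (ζ : ℂ) {y : V}
    (hy : y ∈ (extChartAt 𝓘(ℝ, V) w₀).target) (u v : ℂ × V) :
    endFormInChart V e α w₀ (ζ, y) ![u, v] =
      endForm V e α (ζ, (extChartAt 𝓘(ℝ, V) w₀).symm y)
        ![(u.1, realDeriv 𝓘(ℝ, V) 𝓘(ℝ, V) (extChartAt 𝓘(ℝ, V) w₀).symm y u.2),
          (v.1, realDeriv 𝓘(ℝ, V) 𝓘(ℝ, V) (extChartAt 𝓘(ℝ, V) w₀).symm y v.2)] := by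
  rw [endFormInChart_apply, endForm_apply, hE.realDeriv_inChartOfD w₀ ζ hy,
    hE.realDeriv_inChartOfD w₀ ζ hy]
  rfl

theorem endDeriv_injective (p : ℂ × D) : Function.Injective (endDeriv V W e p) := by
  obtain ⟨ζ, w⟩ := p
  obtain ⟨Q, hQ, hQ1, -⟩ := hE.exists_localInverse w ζ _ (mem_extChartAt_target w)
  have h := realDeriv_comp (hQ.mdifferentiableAt (by simp))
    (hE.mdifferentiableAt_inChartOfD w ζ (mem_extChartAt_target w))
  rw [realDeriv_congr (f := Q ∘ inChartOfD V e w) (g := id) hQ1, realDeriv_id] at h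
  intro u v huv
  rw [← hE.realDeriv_inChartOfD_self, ← hE.realDeriv_inChartOfD_self] at huv
  have h1 := congrArg (fun L : ℂ × V →L[ℝ] ℂ × V => L u) h
  have h2 := congrArg (fun L : ℂ × V →L[ℝ] ℂ × V => L v) h
  simp only [ContinuousLinearMap.comp_apply] at h1 h2
  rw [huv, ← h2] at h1
  exact h1

theorem realDeriv_inChartOfD_surjective (w₀ : D) (ζ : ℂ) {y : V}
    (hy : y ∈ (extChartAt 𝓘(ℝ, V) w₀).target) : Function.Surjective
    (realDeriv 𝓘(ℝ, ℂ × V) 𝓘(ℝ, W) (inChartOfD V e w₀) (ζ, y)) := by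
  obtain ⟨Q, hQ, hQ1, hQ2⟩ := hE.exists_localInverse w₀ ζ _ hy
  have h0 := hQ1.self_of_nhds
  have h := realDeriv_comp (g := inChartOfD V e w₀) (f := Q) (x := inChartOfD V e w₀ (ζ, y))
    (I := 𝓘(ℝ, W)) (I' := 𝓘(ℝ, ℂ × V)) (I'' := 𝓘(ℝ, W))
    (by rw [h0]; exact hE.mdifferentiableAt_inChartOfD w₀ ζ hy) (hQ.mdifferentiableAt (by simp))
  rw [realDeriv_congr (f := inChartOfD V e w₀ ∘ Q) (g := id) hQ2, realDeriv_id, h0] at h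
  intro u
  exact ⟨_, (congrArg (fun L : W →L[ℝ] W => L u) h).symm⟩

theorem endDeriv_surjective (p : ℂ × D) : Function.Surjective (endDeriv V W e p) := fun u => by
  obtain ⟨v, hv⟩ := hE.realDeriv_inChartOfD_surjective p.2 p.1 (mem_extChartAt_target p.2) u
  exact ⟨v, by rw [← hv, hE.realDeriv_inChartOfD_self]⟩

end

/-- Invariance of the pullback of an invariant form under imaginary translations. -/
theorem endFormInChart_add_mul_I [IsManifold 𝓘(ℂ, V) ω D] {α : DiffForm W M 2}
    (hinv : ∀ s, DiffForm.pullback 𝓘(ℝ, W) 𝓘(ℝ, W) (A s) α = α) (w₀ : D) (ζ : ℂ) (θ : ℝ) {y : V}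
    (hy : y ∈ (extChartAt 𝓘(ℝ, V) w₀).target) :
    endFormInChart V e α w₀ (ζ + θ * Complex.I, y) = endFormInChart V e α w₀ (ζ, y) := by
  set s : ℝ := θ / (2 * Real.pi) with hs
  have h1 : A s ∘ inChartOfD V e w₀ =
      inChartOfD V e w₀ ∘ fun p : ℂ × V => p + (θ * Complex.I, 0) := by
    funext p
    simp only [Function.comp_apply, inChartOfD, Prod.fst_add, Prod.snd_add, add_zero]
    exact hE.apply_add_mul_I _ _ _
  have h2 : ((ζ, y) : ℂ × V) + (θ * Complex.I, 0) = (ζ + θ * Complex.I, y) := by simp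
  have h3 : realDeriv 𝓘(ℝ, ℂ × V) 𝓘(ℝ, ℂ × V) (fun p : ℂ × V => p + (θ * Complex.I, 0)) (ζ, y) =
      ContinuousLinearMap.id ℝ _ := by
    rw [realDeriv_eq_fderiv, fderiv_add_const]
    exact fderiv_id
  have h4 := DiffForm.pullback_comp α (g := A s) (f := inChartOfD V e w₀) (x := (ζ, y))
    (I'' := 𝓘(ℝ, ℂ × V)) (I' := 𝓘(ℝ, W)) (I := 𝓘(ℝ, W))
    (hE.circleAction.mdifferentiableAt_slice s _) (hE.mdifferentiableAt_inChartOfD w₀ ζ hy)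
  have h5 := DiffForm.pullback_comp α (g := inChartOfD V e w₀)
    (f := fun p : ℂ × V => p + (θ * Complex.I, 0)) (x := (ζ, y))
    (I'' := 𝓘(ℝ, ℂ × V)) (I' := 𝓘(ℝ, ℂ × V)) (I := 𝓘(ℝ, W))
    (by rw [h2]; exact hE.mdifferentiableAt_inChartOfD w₀ _ hy)
    (mdifferentiableAt_iff_differentiableAt.2 (by fun_prop))
  rw [hinv, h1, h5] at h4
  refine Eq.trans ?_ h4
  rw [DiffForm.pullback_eq (I' := 𝓘(ℝ, ℂ × V)) (I := 𝓘(ℝ, ℂ × V)), h3]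
  exact congrArg (endFormInChart V e α w₀) h2.symm

/-- Invariance of the pullback of an invariant form under the automorphism `γ` of `D`. -/
theorem endForm_deck [IsManifold 𝓘(ℂ, V) ω D] {α : DiffForm W M 2}
    (hinv : ∀ s, DiffForm.pullback 𝓘(ℝ, W) 𝓘(ℝ, W) (A s) α = α)
    (hγ : ContMDiff 𝓘(ℂ, V) 𝓘(ℂ, V) ω γ) (ζ : ℂ) (w : D) (u v : ℂ × V) :
    endForm V e α (ζ, γ w) ![(u.1, realDeriv 𝓘(ℝ, V) 𝓘(ℝ, V) γ w u.2),
      (v.1, realDeriv 𝓘(ℝ, V) 𝓘(ℝ, V) γ w v.2)] = endForm V e α (ζ, w) ![u, v] := by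
  set s : ℝ := 1 / m with hs
  have hγd : MDifferentiableAt 𝓘(ℝ, V) 𝓘(ℝ, V) γ w :=
    (contMDiffAt_real_self (hγ w)).mdifferentiableAt (by simp)
  have h1 : (A s ∘ e) ∘ Prod.map id γ = e := by
    funext p
    exact hE.deck p.1 p.2
  have h2 : ∀ u : ℂ × V, endDeriv V W e (ζ, w) u =
      realDeriv 𝓘(ℝ, W) 𝓘(ℝ, W) (A s) (e (ζ, γ w))
        (endDeriv V W e (ζ, γ w) (u.1, realDeriv 𝓘(ℝ, V) 𝓘(ℝ, V) γ w u.2)) := by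
    intro u
    have h3 := HasMFDerivAt.comp (g := e) (f := Prod.map id γ) (ζ, w)
      (hE.mdifferentiableAt_real (ζ, γ w)).hasMFDerivAt
      ((hasMFDerivAt_id (I := 𝓘(ℝ, ℂ)) ζ).prodMap (p := (ζ, w)) hγd.hasMFDerivAt)
    have h4 := HasMFDerivAt.comp (g := A s) (f := e ∘ Prod.map id γ) (ζ, w)
      (hE.circleAction.mdifferentiableAt_slice s (e (ζ, γ w))).hasMFDerivAt h3
    have h5 : A s ∘ e ∘ Prod.map id γ = e := h1
    rw [h5] at h4
    refine (congrArg (fun L : ℂ × V →L[ℝ] W => L u) h4.mfderiv).trans ?_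
    have h6 : (mfderiv 𝓘(ℝ, ℂ) 𝓘(ℝ, ℂ) (id : ℂ → ℂ) ζ : ℂ →L[ℝ] ℂ) u.1 = u.1 := by
      rw [mfderiv_id]; rfl
    change realDeriv 𝓘(ℝ, W) 𝓘(ℝ, W) (A s) (e (ζ, γ w)) (endDeriv V W e (ζ, γ w)
      ((mfderiv 𝓘(ℝ, ℂ) 𝓘(ℝ, ℂ) (id : ℂ → ℂ) ζ : ℂ →L[ℝ] ℂ) u.1,
        realDeriv 𝓘(ℝ, V) 𝓘(ℝ, V) γ w u.2)) = _
    rw [h6]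
  have h7 : α (e (ζ, γ w)) = _ := (congrFun (hinv s) (e (ζ, γ w))).symm
  rw [endForm_apply, endForm_apply, h7, DiffForm.pullback_eq, compContinuousLinearMap_two, ← h2,
    ← h2]
  have h8 : A s (e (ζ, γ w)) = e (ζ, w) := hE.deck ζ w
  rw [h8]

end IsCylindricalEnd

end EndForms


/-! ### Functions with vanishing differential -/

section LocallyConstant

open Set Filter

variable {D : Type*} [TopologicalSpace D]
  {V : Type*} [NormedAddCommGroup V] [NormedSpace ℂ V] [ChartedSpace V D]

theorem contMDiff_of_contDiffOn_chart [IsManifold 𝓘(ℂ, V) ω D] {f : D → ℝ}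
    (hf : ∀ w₀ : D, ContDiffOn ℝ ∞ (f ∘ (extChartAt 𝓘(ℝ, V) w₀).symm)
      (extChartAt 𝓘(ℝ, V) w₀).target) : ContMDiff 𝓘(ℝ, V) 𝓘(ℝ, ℝ) ∞ f := fun w => by
  have h := (hf w).contDiffAt (extChartAt_target_mem_nhds w)
  have h1 := ContMDiffAt.comp (g := f ∘ (extChartAt 𝓘(ℝ, V) w).symm)
    (f := extChartAt 𝓘(ℝ, V) w) w (contMDiffAt_iff_contDiffAt.2 h) contMDiffAt_extChartAt
  refine h1.congr_of_eventuallyEq ?_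
  filter_upwards [extChartAt_source_mem_nhds (I := 𝓘(ℝ, V)) w] with x hx
  exact (congrArg f ((extChartAt 𝓘(ℝ, V) w).left_inv hx)).symm

theorem isLocallyConstant_of_realDeriv_eq_zero [IsManifold 𝓘(ℂ, V) ω D] {f : D → ℝ}
    (hf : MDifferentiable 𝓘(ℝ, V) 𝓘(ℝ, ℝ) f)
    (h : ∀ w, realDeriv 𝓘(ℝ, V) 𝓘(ℝ, ℝ) f w = 0) : IsLocallyConstant f := by
  rw [IsLocallyConstant.iff_eventually_eq]
  intro w
  set ψ := extChartAt 𝓘(ℝ, V) w with hψ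
  obtain ⟨r, hr, hball⟩ := Metric.mem_nhds_iff.1 (extChartAt_target_mem_nhds (I := 𝓘(ℝ, V)) w)
  have hd : ∀ y ∈ Metric.ball (ψ w) r, HasFDerivAt (f ∘ ψ.symm) (0 : V →L[ℝ] ℝ) y := by
    intro y hy
    have hs := mdifferentiableAt_extChartAt_symm w (hball hy)
    have h1 := realDeriv_comp (I := 𝓘(ℝ, V)) (hf (ψ.symm y)) hs
    rw [h, ContinuousLinearMap.zero_comp, realDeriv_eq_fderiv] at h1
    have h2 := (mdifferentiableAt_iff_differentiableAt.1 ((hf (ψ.symm y)).comp y hs)).hasFDerivAt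
    rwa [h1] at h2
  filter_upwards [(continuousAt_extChartAt (I := 𝓘(ℝ, V)) w).preimage_mem_nhds
    (Metric.ball_mem_nhds _ hr), extChartAt_source_mem_nhds (I := 𝓘(ℝ, V)) w] with x hx hxs
  have h3 := Metric.isOpen_ball.is_const_of_fderiv_eq_zero (𝕜 := ℝ)
    (convex_ball (ψ w) r).isPreconnected
    (fun y hy => (hd y hy).differentiableAt.differentiableWithinAt) (fun y hy => (hd y hy).fderiv)
    (x := ψ x) (y := ψ w) hx (Metric.mem_ball_self hr)
  simp only [Function.comp_apply] at h3
  rwa [ψ.left_inv hxs, ψ.left_inv (mem_extChartAt_source w)] at h3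

end LocallyConstant

/-! ### The potential of an invariant Kähler form on the cylindrical end -/

section EndPotential

open Set Filter

variable {D : Type*} [TopologicalSpace D]
  {V : Type*} [NormedAddCommGroup V] [NormedSpace ℂ V] [ChartedSpace V D]
  {W : Type*} [NormedAddCommGroup W] [NormedSpace ℂ W]
  {M : Type*} [TopologicalSpace M] [ChartedSpace W M]

variable (V) in
/-- The linear map which sends a `2`-form `Z` on `ℂ × V` to the `1`-form `v ↦ Z(∂_θ, v)` on `V`,
where `∂_θ = (i, 0)`. -/
def contractIm : (ℂ × V) [⋀^Fin 2]→L[ℝ] ℝ →L[ℝ] V [⋀^Fin 1]→L[ℝ] ℝ :=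
  (ContinuousAlternatingMap.compContinuousLinearMapCLM (ContinuousLinearMap.inr ℝ ℂ V)) ∘L
    (ContinuousLinearMap.apply ℝ _ (Complex.I, (0 : V))) ∘L
      (ContinuousAlternatingMap.curryLeftLI (n := 1) (𝕜 := ℝ) (E := ℂ × V)
        (F := ℝ)).toContinuousLinearMap

theorem contractIm_apply (Z : (ℂ × V) [⋀^Fin 2]→L[ℝ] ℝ) (v : V) :
    contractIm V Z ![v] = Z ![(Complex.I, 0), (0, v)] := by
  change (Z.curryLeft (Complex.I, 0)).compContinuousLinearMap
    (ContinuousLinearMap.inr ℝ ℂ V) ![v] = _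
  rw [compContinuousLinearMap_one, ContinuousAlternatingMap.curryLeft_apply_apply]
  rfl

/-- The restriction of a `2`-form to the cross-section `{0} × D` of the end. -/
def sectionForm (V : Type*) [NormedAddCommGroup V] [NormedSpace ℂ V] [ChartedSpace V D]
    (e : ℂ × D → M) (α : DiffForm W M 2) : DiffForm V D 2 := fun w =>
  (endForm V e α (0, w)).compContinuousLinearMap (ContinuousLinearMap.inr ℝ ℂ V)

/-- The contraction of a `2`-form with `∂_θ`, restricted to the cross-section `{0} × D`. -/
def sectionContract (V : Type*) [NormedAddCommGroup V] [NormedSpace ℂ V] [ChartedSpace V D]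
    (e : ℂ × D → M) (α : DiffForm W M 2) : DiffForm V D 1 := fun w =>
  contractIm V (endForm V e α (0, w))

/-- The component `α(∂ₜ, ∂_θ)` of a `2`-form on the end. -/
def axialPart (V : Type*) [NormedAddCommGroup V] [NormedSpace ℂ V] [ChartedSpace V D]
    (e : ℂ × D → M) (α : DiffForm W M 2) (t : ℝ) (w : D) : ℝ :=
  endForm V e α ((t : ℂ), w) ![(1, 0), (Complex.I, 0)]

/-- A function `F` on the end with `α = pr^* α|_D + ddᶜF`, when `df = α(∂_θ, ·)` on the
cross-section: `F` vanishes at `t = 0`, where `∂ₜF = -f`, and `∂ₜ²F = α(∂ₜ, ∂_θ)`. -/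
def endPotential (V : Type*) [NormedAddCommGroup V] [NormedSpace ℂ V] [ChartedSpace V D]
    (e : ℂ × D → M) (α : DiffForm W M 2) (f : D → ℝ) (t : ℝ) (w : D) : ℝ :=
  secondPrimitive (fun s => axialPart V e α s w) t - t * f w

theorem sectionForm_apply (e : ℂ × D → M) (α : DiffForm W M 2) (w : D) (u v : V) :
    sectionForm V e α w ![u, v] = endForm V e α (0, w) ![(0, u), (0, v)] :=
  compContinuousLinearMap_two _ _ _ _

/-- A function on `ℝ × D`, as a function on `ℂ × V` in the preferred chart of `D` at `w₀`. -/
def cylinderFun (V : Type*) [NormedAddCommGroup V] [NormedSpace ℂ V] [ChartedSpace V D]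
    (F : ℝ → D → ℝ) (w₀ : D) (p : ℂ × V) : ℝ :=
  F p.1.re ((extChartAt 𝓘(ℝ, V) w₀).symm p.2)

/-- Smooth functions on `ℝ × D`, as families of functions on `D`. -/
def IsSmoothFamily (V : Type*) [NormedAddCommGroup V] [NormedSpace ℂ V] [ChartedSpace V D]
    (F : ℝ → D → ℝ) : Prop :=
  ∀ w₀ : D, ContDiffOn ℝ ∞ (fun p : ℝ × V => F p.1 ((extChartAt 𝓘(ℝ, V) w₀).symm p.2))
    (univ ×ˢ (extChartAt 𝓘(ℝ, V) w₀).target)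

theorem IsSmoothFamily.contDiffAt {F : ℝ → D → ℝ} (hF : IsSmoothFamily V F) (w₀ : D) (ζ : ℂ)
    {y : V} (hy : y ∈ (extChartAt 𝓘(ℝ, V) w₀).target) :
    ContDiffAt ℝ ∞ (cylinderFun V F w₀) (ζ, y) := by
  have h := contDiffAt_of_contDiffOn_prod (isOpen_extChartAt_target w₀) (hF w₀) (s := ζ.re) hy
  exact ContDiffAt.comp (g := fun p : ℝ × V => F p.1 ((extChartAt 𝓘(ℝ, V) w₀).symm p.2))
    (f := fun p : ℂ × V => (p.1.re, p.2)) (ζ, y) h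
    ((Complex.reCLM.contDiff.contDiffAt.comp _ contDiffAt_fst).prodMk contDiffAt_snd)

namespace IsCylindricalEnd

variable {m : ℕ} {γ : Equiv.Perm D} {A : ℝ → M → M} {τ : M → ℝ} {e : ℂ × D → M}
  (hE : IsCylindricalEnd V W m γ A τ e) [IsManifold 𝓘(ℂ, V) ω D] [IsManifold 𝓘(ℂ, W) ω M]
  {α : DiffForm W M 2} (hα : IsKahlerForm α)
include hE hα

theorem contDiffAt_endFormInChart (w₀ : D) (ζ : ℂ) {y : V}
    (hy : y ∈ (extChartAt 𝓘(ℝ, V) w₀).target) :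
    ContDiffAt ℝ ∞ (endFormInChart V e α w₀) (ζ, y) :=
  hα.closed.1.contDiffAt_pullback (contMDiffAt_real_self (hE.contMDiffAt_inChartOfD w₀ ζ hy))

theorem extDeriv_endFormInChart (w₀ : D) (ζ : ℂ) {y : V}
    (hy : y ∈ (extChartAt 𝓘(ℝ, V) w₀).target) : extDeriv (endFormInChart V e α w₀) (ζ, y) = 0 := by
  have h := hα.closed.1.extDeriv_pullback
    (contMDiffAt_real_self (hE.contMDiffAt_inChartOfD w₀ ζ hy))
  have h0 : extD 𝓘(ℝ, W) α = 0 := hα.closed.2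
  rw [h0] at h
  exact h

omit [IsManifold 𝓘(ℂ, W) ω M] in
theorem endFormInChart_cplxJ (w₀ : D) (ζ : ℂ) {y : V}
    (hy : y ∈ (extChartAt 𝓘(ℝ, V) w₀).target) (u v : ℂ × V) :
    endFormInChart V e α w₀ (ζ, y) ![cplxJ u, cplxJ v] =
      endFormInChart V e α w₀ (ζ, y) ![u, v] := by
  rw [endFormInChart_apply, endFormInChart_apply, hE.isJLinear_inChartOfD w₀ ζ hy,
    hE.isJLinear_inChartOfD w₀ ζ hy, hα.invariant]

omit [IsManifold 𝓘(ℂ, W) ω M] in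
theorem endForm_pos (p : ℂ × D) {u : ℂ × V} (hu : u ≠ 0) :
    0 < endForm V e α p ![u, cplxJ u] := by
  rw [endForm_apply, hE.isJLinear_endDeriv]
  refine hα.pos _ _ fun h => hu (hE.endDeriv_injective p ?_)
  rw [h, map_zero]

omit hα [IsManifold 𝓘(ℂ, W) ω M] in
theorem formInChart_sectionForm (w₀ : D) {y : V} (hy : y ∈ (extChartAt 𝓘(ℝ, V) w₀).target) :
    formInChart 𝓘(ℝ, V) (sectionForm V e α) w₀ y =
      (endFormInChart V e α w₀ (0, y)).compContinuousLinearMap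
        (ContinuousLinearMap.inr ℝ ℂ V) := by
  refine alternating_ext_two fun u v => ?_
  rw [formInChart_eq_pullback, DiffForm.pullback_eq, compContinuousLinearMap_two,
    sectionForm_apply, compContinuousLinearMap_two, hE.endFormInChart_eq α w₀ 0 hy]
  rfl

omit hα [IsManifold 𝓘(ℂ, W) ω M] in
theorem formInChart_sectionContract (w₀ : D) {y : V}
    (hy : y ∈ (extChartAt 𝓘(ℝ, V) w₀).target) :
    formInChart 𝓘(ℝ, V) (sectionContract V e α) w₀ y =
      contractIm V (endFormInChart V e α w₀ (0, y)) := by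
  refine alternating_ext_one fun v => ?_
  rw [formInChart_eq_pullback, DiffForm.pullback_eq, compContinuousLinearMap_one,
    sectionContract, contractIm_apply, contractIm_apply, hE.endFormInChart_eq α w₀ 0 hy, map_zero]

/-- The restriction of a Kähler form to the cross-section is a Kähler form. -/
theorem isKahlerForm_sectionForm : IsKahlerForm (sectionForm V e α) := by
  have hslice : ∀ w₀ : D, ∀ y ∈ (extChartAt 𝓘(ℝ, V) w₀).target,
      ContMDiffAt 𝓘(ℝ, V) 𝓘(ℝ, W) ∞ (fun y : V => inChartOfD V e w₀ (0, y)) y := by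
    intro w₀ y hy
    exact ContMDiffAt.comp (g := inChartOfD V e w₀) (f := fun y : V => ((0 : ℂ), y)) y
      (contMDiffAt_real_self (hE.contMDiffAt_inChartOfD w₀ 0 hy))
      (contMDiffAt_iff_contDiffAt.2 (contDiffAt_const.prodMk contDiffAt_id))
  have heq : ∀ w₀ : D, ∀ y ∈ (extChartAt 𝓘(ℝ, V) w₀).target,
      formInChart 𝓘(ℝ, V) (sectionForm V e α) w₀ y =
        DiffForm.pullback 𝓘(ℝ, V) 𝓘(ℝ, W) (fun y : V => inChartOfD V e w₀ (0, y)) α y := by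
    intro w₀ y hy
    have h1 := DiffForm.pullback_comp α (g := inChartOfD V e w₀) (f := fun y : V => ((0 : ℂ), y))
      (x := y) (I'' := 𝓘(ℝ, V)) (I' := 𝓘(ℝ, ℂ × V)) (I := 𝓘(ℝ, W))
      (hE.mdifferentiableAt_inChartOfD w₀ 0 hy)
      (mdifferentiableAt_iff_differentiableAt.2 (by fun_prop))
    refine (hE.formInChart_sectionForm w₀ hy).trans (Eq.trans ?_ h1.symm)
    rw [DiffForm.pullback_eq (I' := 𝓘(ℝ, V)) (I := 𝓘(ℝ, ℂ × V)), realDeriv_eq_fderiv,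
      (hasFDerivAt_prodMk_right (𝕜 := ℝ) (0 : ℂ) y).fderiv]
    rfl
  have hsm : IsSmoothForm 𝓘(ℝ, V) (sectionForm V e α) := fun w₀ y hy => by
    refine ContDiffWithinAt.congr ?_ (heq w₀) (heq w₀ y hy)
    exact (hα.closed.1.contDiffAt_pullback (hslice w₀ y hy)).contDiffWithinAt
  refine ⟨⟨hsm, ?_⟩, fun w u v => ?_, fun w u hu => ?_⟩
  · funext w
    have h0 : extD 𝓘(ℝ, W) α = 0 := hα.closed.2
    have h1 := hα.closed.1.extDeriv_pullback (hslice w _ (mem_extChartAt_target w))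
    rw [h0] at h1
    refine Eq.trans (Filter.EventuallyEq.extDeriv_eq ?_) h1
    filter_upwards [extChartAt_target_mem_nhds w] with y hy using heq w y hy
  · have h1 : ∀ u : V, ((0 : ℂ), cplxJ u) = cplxJ ((0 : ℂ), u) := fun u => by simp [cplxJ]
    rw [sectionForm_apply, sectionForm_apply, endForm_apply, endForm_apply, h1, h1,
      hE.isJLinear_endDeriv, hE.isJLinear_endDeriv, hα.invariant]
  · have h1 : ((0 : ℂ), cplxJ u) = cplxJ ((0 : ℂ), u) := by simp [cplxJ]
    rw [sectionForm_apply, h1]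
    exact hE.endForm_pos hα _ fun h => hu (congrArg Prod.snd h)

variable (hinv : ∀ s, DiffForm.pullback 𝓘(ℝ, W) 𝓘(ℝ, W) (A s) α = α)
include hinv

omit hα [IsManifold 𝓘(ℂ, W) ω M] in
theorem pullback_kahlerMetric_sectionForm (hγ : ContMDiff 𝓘(ℂ, V) 𝓘(ℂ, V) ω γ) :
    CovTensor.pullback 𝓘(ℝ, V) 𝓘(ℝ, V) γ (kahlerMetric (sectionForm V e α)) =
      kahlerMetric (sectionForm V e α) := by
  funext w v
  have h1 := hE.endForm_deck hinv hγ 0 w (0, v 0) (0, cplxJ (v 1))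
  have h2 : cplxJ (realDeriv 𝓘(ℝ, V) 𝓘(ℝ, V) γ w (v 1)) =
      realDeriv 𝓘(ℝ, V) 𝓘(ℝ, V) γ w (cplxJ (v 1)) := (isJLinear_realDeriv_self (hγ w) _).symm
  change sectionForm V e α (γ w) ![realDeriv 𝓘(ℝ, V) 𝓘(ℝ, V) γ w (v 0),
    cplxJ (realDeriv 𝓘(ℝ, V) 𝓘(ℝ, V) γ w (v 1))] = sectionForm V e α w ![v 0, cplxJ (v 1)]
  rw [h2, sectionForm_apply, sectionForm_apply]
  exact h1

theorem isClosed_sectionContract : sectionContract V e α ∈ closedForms 𝓘(ℝ, V) D 1 := by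
  have hZ : ∀ w₀ : D, ∀ y ∈ (extChartAt 𝓘(ℝ, V) w₀).target,
      ContDiffAt ℝ ∞ (fun y => contractIm V (endFormInChart V e α w₀ (0, y))) y := by
    intro w₀ y hy
    exact (contractIm V).contDiff.contDiffAt.comp y (ContDiffAt.comp
      (g := endFormInChart V e α w₀) (f := fun y : V => ((0 : ℂ), y)) y
      (hE.contDiffAt_endFormInChart hα w₀ 0 hy) (contDiffAt_const.prodMk contDiffAt_id))
  refine ⟨fun w₀ y hy => (hZ w₀ y hy).contDiffWithinAt.congr
    (fun z hz => hE.formInChart_sectionContract w₀ hz) (hE.formInChart_sectionContract w₀ hy), ?_⟩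
  funext w
  have hy := mem_extChartAt_target (I := 𝓘(ℝ, V)) w
  set y := extChartAt 𝓘(ℝ, V) w w with hydef
  have h1 : extD 𝓘(ℝ, V) (sectionContract V e α) w =
      extDeriv (fun y => contractIm V (endFormInChart V e α w (0, y))) y := by
    refine Filter.EventuallyEq.extDeriv_eq ?_
    filter_upwards [extChartAt_target_mem_nhds w] with y hy
      using hE.formInChart_sectionContract w hy
  have hd : DifferentiableAt ℝ (endFormInChart V e α w) (0, y) :=
    (hE.contDiffAt_endFormInChart hα w 0 hy).differentiableAt (by simp)
  have h2 : fderiv ℝ (fun y => contractIm V (endFormInChart V e α w (0, y))) y =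
      contractIm V ∘L fderiv ℝ (endFormInChart V e α w) (0, y) ∘L
        ContinuousLinearMap.inr ℝ ℂ V :=
    ((contractIm V).hasFDerivAt.comp y (hd.hasFDerivAt.comp y
      (hasFDerivAt_prodMk_right (0 : ℂ) y))).fderiv
  rw [h1]
  refine alternating_ext_two fun u v => ?_
  rw [extDeriv_oneForm_apply, h2]
  simp only [ContinuousLinearMap.comp_apply, contractIm_apply, ContinuousLinearMap.inr_apply]
  rw [fderiv_contract_symm hy hd (hE.extDeriv_endFormInChart hα w 0 hy)
    (fun ζ θ y hy => hE.endFormInChart_add_mul_I hinv w ζ θ hy) u v, sub_self]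
  rfl

omit hα [IsManifold 𝓘(ℂ, W) ω M] in
theorem pullback_sectionContract (hγ : ContMDiff 𝓘(ℂ, V) 𝓘(ℂ, V) ω γ) :
    DiffForm.pullback 𝓘(ℝ, V) 𝓘(ℝ, V) γ (sectionContract V e α) = sectionContract V e α := by
  funext w
  refine alternating_ext_one fun v => ?_
  have h1 := hE.endForm_deck hinv hγ 0 w (Complex.I, 0) (0, v)
  simp only [map_zero] at h1
  rw [DiffForm.pullback_eq, compContinuousLinearMap_one, sectionContract, contractIm_apply, h1,
    sectionContract, contractIm_apply]

omit [IsManifold 𝓘(ℂ, W) ω M] hα in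
/-- The `1`-form `α(∂_θ, ·)` on the cross-section has a `γ`-invariant primitive `f`. -/
theorem exists_invariant_primitive [ConnectedSpace D] (hm : 0 < m) (horder : orderOf γ = m)
    (hγ : ContMDiff 𝓘(ℂ, V) 𝓘(ℂ, V) ω γ)
    (hexact : sectionContract V e α ∈ exactForms 𝓘(ℝ, V) D 0) :
    ∃ f : D → ℝ, (∀ w₀ : D, ContDiffOn ℝ ∞ (f ∘ (extChartAt 𝓘(ℝ, V) w₀).symm)
        (extChartAt 𝓘(ℝ, V) w₀).target) ∧
      (∀ w₀ : D, ∀ y ∈ (extChartAt 𝓘(ℝ, V) w₀).target, ∀ v,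
        fderiv ℝ (f ∘ (extChartAt 𝓘(ℝ, V) w₀).symm) y v =
          endFormInChart V e α w₀ (0, y) ![(Complex.I, 0), (0, v)]) ∧
      ∀ w, f (γ w) = f w := by
  obtain ⟨η, hη, hηd⟩ := hexact
  set f : D → ℝ := fun w => η w ![] with hf
  set ev := ContinuousAlternatingMap.apply ℝ V ℝ (![] : Fin 0 → V) with hev
  have hfη : ∀ w₀ : D, f ∘ (extChartAt 𝓘(ℝ, V) w₀).symm =
      ev ∘ formInChart 𝓘(ℝ, V) η w₀ := by
    intro w₀
    funext y
    exact congrArg (η ((extChartAt 𝓘(ℝ, V) w₀).symm y)) (Subsingleton.elim _ _)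
  have hsm : ∀ w₀ : D, ContDiffOn ℝ ∞ (f ∘ (extChartAt 𝓘(ℝ, V) w₀).symm)
      (extChartAt 𝓘(ℝ, V) w₀).target := by
    intro w₀
    rw [hfη]
    exact ev.contDiff.comp_contDiffOn (hη w₀)
  have hder : ∀ w₀ : D, ∀ y ∈ (extChartAt 𝓘(ℝ, V) w₀).target, ∀ v,
      fderiv ℝ (f ∘ (extChartAt 𝓘(ℝ, V) w₀).symm) y v =
        endFormInChart V e α w₀ (0, y) ![(Complex.I, 0), (0, v)] := by
    intro w₀ y hy v
    have h1 := hη.formInChart_extD w₀ hy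
    rw [hηd, hE.formInChart_sectionContract w₀ hy] at h1
    have h2 := congrArg (fun L : V [⋀^Fin 1]→L[ℝ] ℝ => L ![v]) h1
    simp only [contractIm_apply] at h2
    rw [extDeriv_zeroForm_apply] at h2
    rw [h2, hfη, (ev.hasFDerivAt.comp y (((hη w₀).contDiffAt
      ((isOpen_extChartAt_target w₀).mem_nhds hy)).differentiableAt
        (by simp)).hasFDerivAt).fderiv]
    rfl
  refine ⟨f, hsm, hder, ?_⟩
  have hfs : ContMDiff 𝓘(ℝ, V) 𝓘(ℝ, ℝ) ∞ f := contMDiff_of_contDiffOn_chart hsm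
  have hfd : MDifferentiable 𝓘(ℝ, V) 𝓘(ℝ, ℝ) f := hfs.mdifferentiable (by simp)
  have hγd : MDifferentiable 𝓘(ℝ, V) 𝓘(ℝ, V) γ := fun w =>
    (contMDiffAt_real_self (hγ w)).mdifferentiableAt (by simp)
  have hdf : ∀ w v, realDeriv 𝓘(ℝ, V) 𝓘(ℝ, ℝ) f w v =
      endForm V e α (0, w) ![(Complex.I, 0), (0, v)] := by
    intro w v
    have hy := mem_extChartAt_target (I := 𝓘(ℝ, V)) w
    have h1 := realDeriv_comp (I := 𝓘(ℝ, V)) (hfd ((extChartAt 𝓘(ℝ, V) w).symm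
      (extChartAt 𝓘(ℝ, V) w w))) (mdifferentiableAt_extChartAt_symm w hy)
    rw [realDeriv_extChartAt_symm_self, ContinuousLinearMap.comp_id, extChartAt_to_inv,
      realDeriv_eq_fderiv] at h1
    rw [← h1, hder w _ hy, hE.endFormInChart_eq α w 0 hy, realDeriv_extChartAt_symm_self,
      extChartAt_to_inv]
    rfl
  -- The function `f ∘ γ - f` is locally constant, hence a constant `c`, and `m c = 0`.
  have hloc : IsLocallyConstant fun w => f (γ w) - f w := by
    refine isLocallyConstant_of_realDeriv_eq_zero (V := V) (fun w => ?_) fun w => ?_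
    · exact ((hfd (γ w)).comp w (hγd w)).sub (hfd w)
    · ext v
      have h1 : HasMFDerivAt 𝓘(ℝ, V) 𝓘(ℝ, ℝ) (f ∘ γ - f) w
          (realDeriv 𝓘(ℝ, V) 𝓘(ℝ, ℝ) (f ∘ γ) w - realDeriv 𝓘(ℝ, V) 𝓘(ℝ, ℝ) f w : V →L[ℝ] ℝ) :=
        ((hfd (γ w)).comp w (hγd w)).hasMFDerivAt.sub (hfd w).hasMFDerivAt
      have h2 := congrArg (fun L : V →L[ℝ] ℝ => L v) h1.mfderiv
      refine h2.trans ?_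
      change realDeriv 𝓘(ℝ, V) 𝓘(ℝ, ℝ) (f ∘ γ) w v - realDeriv 𝓘(ℝ, V) 𝓘(ℝ, ℝ) f w v = 0
      rw [realDeriv_comp (hfd (γ w)) (hγd w), ContinuousLinearMap.comp_apply, hdf, hdf]
      have h3 := hE.endForm_deck hinv hγ 0 w (Complex.I, 0) (0, v)
      simp only [map_zero] at h3
      rw [h3, sub_self]
  obtain ⟨c, hc⟩ := hloc.exists_eq_const
  have hc' : ∀ w, f (γ w) = f w + c := fun w => by
    have := congrFun hc w
    simp only [Function.const_apply] at this
    linarith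
  have hpow : ∀ (n : ℕ) w, f ((γ ^ n) w) = f w + n * c := by
    intro n
    induction n with
    | zero => simp
    | succ n ih =>
      intro w
      rw [pow_succ', Equiv.Perm.mul_apply, hc', ih]
      push_cast
      ring
  intro w
  have h4 := hpow m w
  rw [← horder, pow_orderOf_eq_one, horder] at h4
  simp only [Equiv.Perm.coe_one, id_eq] at h4
  have h5 : (m : ℝ) * c = 0 := by linarith
  have h6 : c = 0 := (mul_eq_zero.1 h5).resolve_left (by exact_mod_cast hm.ne')
  rw [hc', h6, add_zero]

omit hα [IsManifold 𝓘(ℂ, W) ω M] in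
theorem axialPart_deck (hγ : ContMDiff 𝓘(ℂ, V) 𝓘(ℂ, V) ω γ) (t : ℝ) (w : D) :
    axialPart V e α t (γ w) = axialPart V e α t w := by
  have h1 := hE.endForm_deck hinv hγ t w (1, 0) (Complex.I, 0)
  simp only [map_zero] at h1
  exact h1

omit hinv in
theorem isSmoothFamily_axialPart : IsSmoothFamily V (axialPart V e α) := fun w₀ p hp => by
  set ev := ContinuousAlternatingMap.apply ℝ (ℂ × V) ℝ ![((1 : ℂ), (0 : V)), (Complex.I, 0)]
    with hev
  have heq : ∀ p ∈ univ ×ˢ (extChartAt 𝓘(ℝ, V) w₀).target,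
      axialPart V e α p.1 ((extChartAt 𝓘(ℝ, V) w₀).symm p.2) =
        ev (endFormInChart V e α w₀ ((p.1 : ℂ), p.2)) := by
    intro p hp
    change _ = endFormInChart V e α w₀ ((p.1 : ℂ), p.2) ![((1 : ℂ), (0 : V)), (Complex.I, 0)]
    rw [hE.endFormInChart_eq α w₀ _ hp.2, map_zero]
    rfl
  refine ContDiffWithinAt.congr (ContDiffAt.contDiffWithinAt ?_) heq (heq p hp)
  exact ev.contDiff.contDiffAt.comp p (ContDiffAt.comp (g := endFormInChart V e α w₀)
    (f := fun p : ℝ × V => ((p.1 : ℂ), p.2)) p (hE.contDiffAt_endFormInChart hα w₀ p.1 hp.2)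
    ((Complex.ofRealCLM.contDiff.contDiffAt.comp p contDiffAt_fst).prodMk contDiffAt_snd))

omit hinv in
theorem isSmoothFamily_endPotential [FiniteDimensional ℂ V] {f : D → ℝ}
    (hf : ∀ w₀ : D, ContDiffOn ℝ ∞ (f ∘ (extChartAt 𝓘(ℝ, V) w₀).symm)
        (extChartAt 𝓘(ℝ, V) w₀).target) : IsSmoothFamily V (endPotential V e α f) := fun w₀ => by
  have : FiniteDimensional ℝ V := FiniteDimensional.complexToReal V
  have h1 := contDiffOn_secondPrimitive (isOpen_extChartAt_target w₀)
    (hE.isSmoothFamily_axialPart hα w₀)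
  exact h1.sub (contDiff_fst.contDiffOn.mul ((hf w₀).comp contDiffOn_snd fun p hp => hp.2))

end IsCylindricalEnd

end EndPotential


/-! ### Second derivatives of functions on `ℂ × V` -/

section CylinderDerivatives

open Set Filter

variable {E : Type*} [NormedAddCommGroup E] [NormedSpace ℝ E]

theorem fderiv_apply_eq_of_hasDerivAt_line {h : E → ℝ} {p u : E} {c : ℝ}
    (hd : DifferentiableAt ℝ h p) (hl : HasDerivAt (fun s : ℝ => h (p + s • u)) c 0) :
    fderiv ℝ h p u = c := by
  have h1 : HasDerivAt (fun s : ℝ => p + s • u) u 0 := by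
    simpa using ((hasDerivAt_id (0 : ℝ)).smul_const u).const_add p
  have h2 := HasFDerivAt.comp_hasDerivAt (0 : ℝ) (f := fun s : ℝ => p + s • u) (l := h)
    (l' := fderiv ℝ h p) (by simpa using hd.hasFDerivAt) h1
  exact h2.unique hl

theorem hasDerivAt_comp_const_add {φ : ℝ → ℝ} {c t : ℝ} (h : HasDerivAt φ c t) :
    HasDerivAt (fun s => φ (t + s)) c 0 :=
  HasDerivAt.comp_const_add t 0 (by rwa [add_zero])

theorem fderiv_fderiv_apply {g : E → ℝ} {p : E} (hg : ContDiffAt ℝ ∞ g p) (u v : E) :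
    fderiv ℝ (fderiv ℝ g) p u v = fderiv ℝ (fun q => fderiv ℝ g q v) p u := by
  have h := (differentiableAt_fderiv hg).hasFDerivAt.clm_apply (hasFDerivAt_const v p)
  rw [h.fderiv]
  simp

theorem differentiableAt_fderiv_apply {g : E → ℝ} {p : E} (hg : ContDiffAt ℝ ∞ g p) (v : E) :
    DifferentiableAt ℝ (fun q => fderiv ℝ g q v) p :=
  (differentiableAt_fderiv hg).clm_apply (differentiableAt_const v)

variable {V : Type*} [NormedAddCommGroup V] [NormedSpace ℂ V]

/-- The form `ddᶜ` of a function of the real part of `ζ`. -/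
theorem ddc_re_apply {k k' k'' : ℝ → ℝ} (hk : ContDiff ℝ ∞ k) (hk' : ∀ t, HasDerivAt k (k' t) t)
    (hk'' : ∀ t, HasDerivAt k' (k'' t) t) (p u v : ℂ × V) :
    extDeriv (dcLocal fun p : ℂ × V => k p.1.re) p ![u, v] =
      k'' p.1.re * (u.1.re * v.1.im - u.1.im * v.1.re) := by
  set R : ℂ × V →L[ℝ] ℝ := Complex.reCLM ∘L ContinuousLinearMap.fst ℝ ℂ V with hR
  have hg : ContDiff ℝ ∞ fun p : ℂ × V => k p.1.re := hk.comp R.contDiff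
  have h1 : fderiv ℝ (fun p : ℂ × V => k p.1.re) = fun q => k' q.1.re • R := by
    funext q
    exact ((hk' q.1.re).comp_hasFDerivAt q R.hasFDerivAt).fderiv
  have h2 : ∀ u v : ℂ × V, fderiv ℝ (fderiv ℝ fun p : ℂ × V => k p.1.re) p u v =
      k'' p.1.re * u.1.re * v.1.re := by
    intro u v
    have h3 : HasFDerivAt (fun q : ℂ × V => k' q.1.re) (k'' p.1.re • R) p :=
      (hk'' p.1.re).comp_hasFDerivAt p R.hasFDerivAt
    rw [h1, (h3.smul_const R).fderiv]
    simp [hR]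
  rw [ddc_apply hg.contDiffAt, h2, h2]
  simp [cplxJ]
  ring

/-- Multiplication by a function of `re ζ` commutes with `ddᶜ` in the directions of `V`. -/
theorem ddc_re_mul_apply {k : ℝ → ℝ} (hk : ContDiff ℝ ∞ k) {g : ℂ × V → ℝ} {p : ℂ × V}
    (hg : ∀ᶠ q in 𝓝 p, ContDiffAt ℝ ∞ g q) (u v : V) :
    extDeriv (dcLocal fun q : ℂ × V => k q.1.re * g q) p ![(0, u), (0, v)] =
      k p.1.re * extDeriv (dcLocal g) p ![(0, u), (0, v)] := by
  set R : ℂ × V →L[ℝ] ℝ := Complex.reCLM ∘L ContinuousLinearMap.fst ℝ ℂ V with hR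
  have hkR : ContDiff ℝ ∞ fun p : ℂ × V => k p.1.re := hk.comp R.contDiff
  have hkg : ∀ᶠ q in 𝓝 p, ContDiffAt ℝ ∞ (fun q : ℂ × V => k q.1.re * g q) q :=
    hg.mono fun q hq => hkR.contDiffAt.mul hq
  have h1 : ∀ v : V, ∀ᶠ q in 𝓝 p, fderiv ℝ (fun q : ℂ × V => k q.1.re * g q) q (0, v) =
      k q.1.re * fderiv ℝ g q (0, v) := by
    intro v
    filter_upwards [hg] with q hq
    have h2 : HasFDerivAt (fun q : ℂ × V => k q.1.re) (deriv k q.1.re • R) q :=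
      ((hk.differentiable (by simp)) q.1.re).hasDerivAt.comp_hasFDerivAt q R.hasFDerivAt
    have h3 : HasFDerivAt (fun q : ℂ × V => k q.1.re * g q) _ q :=
      h2.mul (hq.differentiableAt (by simp)).hasFDerivAt
    rw [h3.fderiv]
    simp [hR]
  have h2 : ∀ u v : V, fderiv ℝ (fderiv ℝ fun q : ℂ × V => k q.1.re * g q) p (0, u) (0, v) =
      k p.1.re * fderiv ℝ (fderiv ℝ g) p (0, u) (0, v) := by
    intro u v
    have hgp := hg.self_of_nhds
    rw [fderiv_fderiv_apply hkg.self_of_nhds, fderiv_fderiv_apply hgp,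
      Filter.EventuallyEq.fderiv_eq (h1 v)]
    have h2 : HasFDerivAt (fun q : ℂ × V => k q.1.re) (deriv k p.1.re • R) p :=
      ((hk.differentiable (by simp)) p.1.re).hasDerivAt.comp_hasFDerivAt p R.hasFDerivAt
    have h3 : HasFDerivAt (fun q : ℂ × V => k q.1.re * fderiv ℝ g q (0, v)) _ p :=
      h2.mul (differentiableAt_fderiv_apply hgp (0, v)).hasFDerivAt
    rw [h3.fderiv]
    simp [hR]
  have hJ : ∀ u : V, cplxJ ((0 : ℂ), u) = ((0 : ℂ), cplxJ u) := fun u => by simp [cplxJ]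
  rw [ddc_apply hkg.self_of_nhds, ddc_apply hg.self_of_nhds, hJ, hJ, h2, h2]
  ring

end CylinderDerivatives

/-! ### The formula `α = pr^* α|_D + ddᶜF` -/

section PotentialFormula

open Set Filter

variable {D : Type*} [TopologicalSpace D]
  {V : Type*} [NormedAddCommGroup V] [NormedSpace ℂ V] [ChartedSpace V D]
  {W : Type*} [NormedAddCommGroup W] [NormedSpace ℂ W]
  {M : Type*} [TopologicalSpace M] [ChartedSpace W M]

theorem IsSmoothFamily.eventually_contDiffAt [IsManifold 𝓘(ℂ, V) ω D] {F : ℝ → D → ℝ}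
    (hF : IsSmoothFamily V F) (w₀ : D) (ζ : ℂ)
    {y : V} (hy : y ∈ (extChartAt 𝓘(ℝ, V) w₀).target) :
    ∀ᶠ q in 𝓝 (ζ, y), ContDiffAt ℝ ∞ (cylinderFun V F w₀) q := by
  filter_upwards [continuousAt_snd.eventually ((isOpen_extChartAt_target (I := 𝓘(ℝ, V))
    w₀).mem_nhds hy)] with q hq using hF.contDiffAt w₀ q.1 hq

namespace IsCylindricalEnd

variable {m : ℕ} {γ : Equiv.Perm D} {A : ℝ → M → M} {τ : M → ℝ} {e : ℂ × D → M}
  (hE : IsCylindricalEnd V W m γ A τ e) [IsManifold 𝓘(ℂ, V) ω D] [IsManifold 𝓘(ℂ, W) ω M]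
  [FiniteDimensional ℂ V] {α : DiffForm W M 2} (hα : IsKahlerForm α)
  (hinv : ∀ s, DiffForm.pullback 𝓘(ℝ, W) 𝓘(ℝ, W) (A s) α = α)
  {f : D → ℝ} (hf : ∀ w₀ : D, ContDiffOn ℝ ∞ (f ∘ (extChartAt 𝓘(ℝ, V) w₀).symm)
        (extChartAt 𝓘(ℝ, V) w₀).target)
  (hdf : ∀ w₀ : D, ∀ y ∈ (extChartAt 𝓘(ℝ, V) w₀).target, ∀ v,
    fderiv ℝ (f ∘ (extChartAt 𝓘(ℝ, V) w₀).symm) y v =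
      endFormInChart V e α w₀ (0, y) ![(Complex.I, 0), (0, v)])
include hE hα hinv hf hdf

/-- In the charts of `D`, the pullback of the invariant form `α` to the cylinder is
`pr^* α|_D + ddᶜF`, with `F` the potential `endPotential`. -/
theorem endFormInChart_eq_section_add_ddc (w₀ : D) (ζ : ℂ) {y : V}
    (hy : y ∈ (extChartAt 𝓘(ℝ, V) w₀).target) :
    endFormInChart V e α w₀ (ζ, y) =
      (endFormInChart V e α w₀ (0, y)).compContinuousLinearMap (sndProj V) +
        extDeriv (dcLocal (cylinderFun V (endPotential V e α f) w₀)) (ζ, y) := by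
  set T := (extChartAt 𝓘(ℝ, V) w₀).target with hT
  set ψ := extChartAt 𝓘(ℝ, V) w₀ with hψ
  have hTo : IsOpen T := isOpen_extChartAt_target w₀
  set g := cylinderFun V (endPotential V e α f) w₀ with hg
  have hgs : ∀ ζ : ℂ, ∀ y ∈ T, ContDiffAt ℝ ∞ g (ζ, y) := fun ζ y hy =>
    (hE.isSmoothFamily_endPotential hα hf).contDiffAt w₀ ζ hy
  have hac : ∀ y ∈ T, Continuous fun s => axialPart V e α s (ψ.symm y) := fun y hy =>
    continuous_of_contDiffOn_prod hTo (hE.isSmoothFamily_axialPart hα w₀) hy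
  -- The first derivative of the potential along the axis.
  have hg' : ∀ ζ : ℂ, ∀ y ∈ T, fderiv ℝ g (ζ, y) (1, 0) =
      (∫ s in (0:ℝ)..ζ.re, axialPart V e α s (ψ.symm y)) - f (ψ.symm y) := by
    intro ζ y hy
    refine fderiv_apply_eq_of_hasDerivAt_line ((hgs ζ y hy).differentiableAt (by simp)) ?_
    have h1 : HasDerivAt (fun t => secondPrimitive (fun s => axialPart V e α s (ψ.symm y)) t -
        t * f (ψ.symm y)) ((∫ s in (0:ℝ)..ζ.re, axialPart V e α s (ψ.symm y)) -
          1 * f (ψ.symm y)) ζ.re :=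
      (hasDerivAt_secondPrimitive (hac y hy) ζ.re).sub
        ((hasDerivAt_id ζ.re).mul_const (f (ψ.symm y)))
    rw [one_mul] at h1
    refine (hasDerivAt_comp_const_add h1).congr_of_eventuallyEq (Eventually.of_forall fun s => ?_)
    change endPotential V e α f ((ζ, y) + s • ((1 : ℂ), (0 : V))).1.re
      (ψ.symm ((ζ, y) + s • ((1 : ℂ), (0 : V))).2) = _
    simp [endPotential]
  refine eq_restriction_add_ddc hTo (fun ζ y hy => hE.contDiffAt_endFormInChart hα w₀ ζ hy)
    (fun ζ y hy => hE.extDeriv_endFormInChart hα w₀ ζ hy)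
    (fun ζ y hy u v => hE.endFormInChart_cplxJ hα w₀ ζ hy u v)
    (fun ζ θ y hy => hE.endFormInChart_add_mul_I hinv w₀ ζ θ hy) hgs
    (fun ζ θ y hy => ?_) (fun ζ y hy => ?_) (fun y hy v => ?_) (fun y hy => ?_) ζ hy
  · simp [hg, cylinderFun]
  · have h1 : (fun q => fderiv ℝ g q (1, 0)) =ᶠ[𝓝 (ζ, y)] fun q =>
        (∫ s in (0:ℝ)..q.1.re, axialPart V e α s (ψ.symm q.2)) - f (ψ.symm q.2) := by
      filter_upwards [continuousAt_snd.eventually (hTo.mem_nhds hy)] with q hq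
        using hg' q.1 q.2 hq
    rw [fderiv_fderiv_apply (hgs ζ y hy), h1.fderiv_eq]
    refine fderiv_apply_eq_of_hasDerivAt_line (h1.differentiableAt_iff.1
      (differentiableAt_fderiv_apply (hgs ζ y hy) _)) ?_
    have h2 := (hasDerivAt_primitive (hac y hy) ζ.re).sub_const (f (ψ.symm y))
    have h3 : axialPart V e α ζ.re (ψ.symm y) = endFormInChart V e α w₀ (ζ, y)
        ![(1, 0), (Complex.I, 0)] := by
      have h4 := hE.endFormInChart_add_mul_I hinv w₀ ζ.re ζ.im hy
      rw [Complex.re_add_im] at h4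
      rw [h4, hE.endFormInChart_eq α w₀ _ hy, map_zero]
      rfl
    rw [← h3]
    refine (hasDerivAt_comp_const_add h2).congr_of_eventuallyEq (Eventually.of_forall fun s => ?_)
    simp
  · have h1 : (fun q => fderiv ℝ g q (1, 0)) =ᶠ[𝓝 ((0:ℂ), y)] fun q =>
        (∫ s in (0:ℝ)..q.1.re, axialPart V e α s (ψ.symm q.2)) - f (ψ.symm q.2) := by
      filter_upwards [continuousAt_snd.eventually (hTo.mem_nhds hy)] with q hq
        using hg' q.1 q.2 hq
    rw [fderiv_fderiv_apply (hgs 0 y hy), h1.fderiv_eq, ← hdf w₀ y hy v]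
    refine fderiv_apply_eq_of_hasDerivAt_line (h1.differentiableAt_iff.1
      (differentiableAt_fderiv_apply (hgs 0 y hy) _)) ?_
    have h2 : HasDerivAt (fun s : ℝ => y + s • v) v 0 := by
      simpa using ((hasDerivAt_id (0 : ℝ)).smul_const v).const_add y
    have h3 := HasFDerivAt.comp_hasDerivAt (0 : ℝ) (f := fun s : ℝ => y + s • v)
      (l := f ∘ ψ.symm) (l' := fderiv ℝ (f ∘ ψ.symm) y)
      (by
        rw [zero_smul, add_zero]
        exact (((hf w₀).contDiffAt (hTo.mem_nhds hy)).differentiableAt (by simp)).hasFDerivAt) h2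
    refine h3.neg.congr_of_eventuallyEq (Eventually.of_forall fun s => ?_)
    simp
  · simp [hg, cylinderFun, endPotential]

end IsCylindricalEnd

end PotentialFormula


/-! ### Cutoff functions and the profile of the cylindrical metric -/

section Profile

open Set Filter

theorem contDiff_smoothTransition_sub (c : ℝ) :
    ContDiff ℝ ∞ fun t : ℝ => Real.smoothTransition (t - c) :=
  (Real.smoothTransition.contDiff (n := ⊤)).comp (contDiff_id.sub contDiff_const)

theorem contDiff_secondPrimitive {a : ℝ → ℝ} (ha : ContDiff ℝ ∞ a) :
    ContDiff ℝ ∞ (secondPrimitive a) := by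
  have h := contDiffOn_secondPrimitive (E := ℝ) (T := univ) isOpen_univ
    (a := fun p : ℝ × ℝ => a p.1) (ha.comp contDiff_fst).contDiffOn
  rw [univ_prod_univ, contDiffOn_univ] at h
  exact h.comp (contDiff_id.prodMk contDiff_const : ContDiff ℝ ∞ fun t : ℝ => (t, (0 : ℝ)))

theorem secondPrimitive_of_nonpos {a : ℝ → ℝ} (ha : ∀ s ≤ 0, a s = 0) {t : ℝ} (ht : t ≤ 0) :
    secondPrimitive a t = 0 := by
  rw [secondPrimitive_eq, intervalIntegral.integral_congr (g := fun _ => 0)]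
  · simp
  · intro s hs
    rw [uIcc_of_ge ht] at hs
    simp only
    rw [ha s hs.2, mul_zero]

/-- A smooth cutoff function, equal to `1` for `t ≤ 1` and to `0` for `t ≥ 2`. -/
def endCutoff (t : ℝ) : ℝ := 1 - Real.smoothTransition (t - 1)

theorem contDiff_endCutoff : ContDiff ℝ ∞ endCutoff :=
  contDiff_const.sub (contDiff_smoothTransition_sub 1)

theorem endCutoff_of_le {t : ℝ} (ht : t ≤ 1) : endCutoff t = 1 := by
  rw [endCutoff, Real.smoothTransition.zero_of_nonpos (by linarith), sub_zero]

theorem endCutoff_of_ge {t : ℝ} (ht : 2 ≤ t) : endCutoff t = 0 := by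
  rw [endCutoff, Real.smoothTransition.one_of_one_le (by linarith), sub_self]

theorem endCutoff_nonneg (t : ℝ) : 0 ≤ endCutoff t :=
  sub_nonneg.2 (Real.smoothTransition.le_one _)

theorem endCutoff_le_one (t : ℝ) : endCutoff t ≤ 1 :=
  sub_le_self _ (Real.smoothTransition.nonneg _)

/-- A nonnegative density, equal to `0` for `t ≤ 0`, to `L` for `1 ≤ t ≤ 2` and to `1` for
`t ≥ 3`. -/
def endDensity (L t : ℝ) : ℝ :=
  L * (Real.smoothTransition t * (1 - Real.smoothTransition (t - 2))) +
    Real.smoothTransition (t - 2)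

theorem contDiff_endDensity (L : ℝ) : ContDiff ℝ ∞ (endDensity L) :=
  (contDiff_const.mul ((Real.smoothTransition.contDiff (n := ⊤)).mul
    (contDiff_const.sub (contDiff_smoothTransition_sub 2)))).add (contDiff_smoothTransition_sub 2)

theorem endDensity_of_nonpos (L : ℝ) {t : ℝ} (ht : t ≤ 0) : endDensity L t = 0 := by
  rw [endDensity, Real.smoothTransition.zero_of_nonpos ht,
    Real.smoothTransition.zero_of_nonpos (by linarith)]
  ring

theorem endDensity_nonneg {L : ℝ} (hL : 0 ≤ L) (t : ℝ) : 0 ≤ endDensity L t :=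
  add_nonneg (mul_nonneg hL (mul_nonneg (Real.smoothTransition.nonneg _)
    (sub_nonneg.2 (Real.smoothTransition.le_one _)))) (Real.smoothTransition.nonneg _)

theorem endDensity_of_mem (L : ℝ) {t : ℝ} (h1 : 1 ≤ t) (h2 : t ≤ 2) : endDensity L t = L := by
  rw [endDensity, Real.smoothTransition.one_of_one_le h1,
    Real.smoothTransition.zero_of_nonpos (by linarith)]
  ring

theorem endDensity_pos {L : ℝ} (hL : 0 ≤ L) {t : ℝ} (ht : 2 < t) : 0 < endDensity L t :=
  add_pos_of_nonneg_of_pos (mul_nonneg hL (mul_nonneg (Real.smoothTransition.nonneg _)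
    (sub_nonneg.2 (Real.smoothTransition.le_one _))))
    (Real.smoothTransition.pos_of_pos (by linarith))

theorem endDensity_of_ge (L : ℝ) {t : ℝ} (ht : 3 ≤ t) : endDensity L t = 1 := by
  rw [endDensity, Real.smoothTransition.one_of_one_le (x := t - 2) (by linarith)]
  ring

theorem hasDerivAt_endProfile (L t : ℝ) : HasDerivAt (secondPrimitive (endDensity L))
    (∫ s in (0:ℝ)..t, endDensity L s) t :=
  hasDerivAt_secondPrimitive (contDiff_endDensity L).continuous t

end Profile

/-! ### Functions on the end which extend to the whole manifold -/

section Descent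

open Set Filter

variable {D : Type*} [TopologicalSpace D]
  {V : Type*} [NormedAddCommGroup V] [NormedSpace ℂ V] [ChartedSpace V D]
  {W : Type*} [NormedAddCommGroup W] [NormedSpace ℂ W]
  {M : Type*} [TopologicalSpace M] [ChartedSpace W M]

theorem IsSmoothFamily.add {F G : ℝ → D → ℝ} (hF : IsSmoothFamily V F)
    (hG : IsSmoothFamily V G) : IsSmoothFamily V fun t w => F t w + G t w := fun w₀ =>
  (hF w₀).add (hG w₀)

theorem IsSmoothFamily.mul {F G : ℝ → D → ℝ} (hF : IsSmoothFamily V F)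
    (hG : IsSmoothFamily V G) : IsSmoothFamily V fun t w => F t w * G t w := fun w₀ =>
  (hF w₀).mul (hG w₀)

theorem isSmoothFamily_of_contDiff {k : ℝ → ℝ} (hk : ContDiff ℝ ∞ k) :
    IsSmoothFamily V fun t (_ : D) => k t := fun _ => (hk.comp contDiff_fst).contDiffOn

/-- A smooth `γ`-invariant function on `ℝ × D` which vanishes for `t ≤ 0` extends by `0` to a
smooth function on the manifold. -/
theorem IsCylindricalEnd.exists_extension {m : ℕ} {γ : Equiv.Perm D} {A : ℝ → M → M} {τ : M → ℝ}
    {e : ℂ × D → M} (hE : IsCylindricalEnd V W m γ A τ e) {F : ℝ → D → ℝ}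
    (hF : IsSmoothFamily V F) (hFγ : ∀ t w, F t (γ w) = F t w) (hF0 : ∀ t ≤ 0, ∀ w, F t w = 0) :
    ∃ G : M → ℝ, ContMDiff 𝓘(ℝ, W) 𝓘(ℝ, ℝ) ∞ G ∧ (∀ p, G (e p) = F p.1.re p.2) ∧
      ∀ x, τ x < 1 → G x = 0 := by
  classical
  have hpow : ∀ (t : ℝ) (k : ℤ) (w : D), F t ((γ ^ k) w) = F t w := by
    intro t k
    induction k with
    | zero => simp
    | succ k ih =>
      intro w
      rw [add_comm, zpow_add, zpow_one, Equiv.Perm.mul_apply, hFγ, ih]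
    | pred k ih =>
      intro w
      rw [sub_eq_neg_add, zpow_add, Equiv.Perm.mul_apply, zpow_neg_one, ← hFγ,
        Equiv.Perm.inv_def, Equiv.apply_symm_apply, ih]
  set G : M → ℝ := fun x => if h : 0 < τ x then
    F (Classical.choose (hE.exists_eq x h)).1.re (Classical.choose (hE.exists_eq x h)).2 else 0
    with hG
  have hGe : ∀ p, G (e p) = F p.1.re p.2 := by
    intro p
    have hp : 0 < τ (e p) := by rw [hE.apply_eq]; exact Real.exp_pos _
    obtain ⟨h1, k, h2⟩ := hE.exists_of_apply_eq (Classical.choose_spec (hE.exists_eq (e p) hp))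
    simp only [hG, dif_pos hp]
    rw [h1, h2, hpow]
  have hG0 : ∀ x, τ x < 1 → G x = 0 := by
    intro x hx
    by_cases h : 0 < τ x
    · obtain ⟨p, rfl⟩ := hE.exists_eq x h
      rw [hGe]
      rw [hE.apply_eq, Real.exp_lt_one_iff] at hx
      exact hF0 _ hx.le _
    · simp only [hG, dif_neg h]
  refine ⟨G, fun x => ?_, hGe, hG0⟩
  by_cases h : 0 < τ x
  · obtain ⟨⟨ζ, w⟩, rfl⟩ := hE.exists_eq x h
    have hy := mem_extChartAt_target (I := 𝓘(ℝ, V)) w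
    obtain ⟨Q, hQ, hQ1, hQ2⟩ := hE.exists_localInverse w ζ _ hy
    have h0 : inChartOfD V e w (ζ, extChartAt 𝓘(ℝ, V) w w) = e (ζ, w) := by
      simp [inChartOfD]
    have h1 := hQ1.self_of_nhds
    rw [h0] at hQ hQ2 h1
    have h2 : ContMDiffAt 𝓘(ℝ, W) 𝓘(ℝ, ℝ) ∞ (cylinderFun V F w ∘ Q) (e (ζ, w)) :=
      ContMDiffAt.comp (g := cylinderFun V F w) (f := Q) _
        (by rw [h1]; exact contMDiffAt_iff_contDiffAt.2 (hF.contDiffAt w ζ hy)) hQ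
    refine h2.congr_of_eventuallyEq ?_
    filter_upwards [hQ2] with x hx
    nth_rewrite 1 [← hx]
    exact hGe _
  · refine (contMDiffAt_const (c := (0 : ℝ))).congr_of_eventuallyEq ?_
    filter_upwards [hE.continuous.continuousAt.eventually
      (gt_mem_nhds (show τ x < 1 by linarith))] with z hz using hG0 z hz

end Descent


/-! ### Positivity of the corrected form -/

section QuadraticPositivity

open Set Filter

variable {V : Type*} [NormedAddCommGroup V] [NormedSpace ℂ V]

theorem cplxJ_smul_self_apply {E : Type*} [NormedAddCommGroup E] [NormedSpace ℂ E]
    (Z : E [⋀^Fin 2]→L[ℝ] ℝ) (c : ℝ) (u : E) :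
    Z ![c • u, cplxJ (c • u)] = c ^ 2 * Z ![u, cplxJ u] := by
  rw [cplxJ_smul, alternating_smul_left, alternating_smul_right]
  ring

/-- If the quadratic form `u ↦ B(u, Ju)` is positive on `{0} × V`, then `B(u, Ju) + L |u₁|²` is
positive for `L` large, uniformly near a given point. -/
theorem exists_forall_add_normSq_pos [FiniteDimensional ℂ V] {X : Type*} [TopologicalSpace X]
    {B : X → (ℂ × V) [⋀^Fin 2]→L[ℝ] ℝ} {x₀ : X} (hB : ContinuousAt B x₀)
    (hpos : ∀ v : V, v ≠ 0 → 0 < B x₀ ![(0, v), cplxJ (0, v)]) :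
    ∃ L₀ : ℝ, ∀ᶠ x in 𝓝 x₀, ∀ L ≥ L₀, ∀ u : ℂ × V, u ≠ 0 →
      0 < B x ![u, cplxJ u] + L * Complex.normSq u.1 := by
  have : FiniteDimensional ℝ V := FiniteDimensional.complexToReal V
  have : ProperSpace (ℂ × V) := FiniteDimensional.proper ℝ (ℂ × V)
  have hcont : ∀ u : ℂ × V, ContinuousAt
      (fun q : X × (ℂ × V) => B q.1 ![q.2, cplxJ q.2]) (x₀, u) := by
    intro u
    have h1 : ContinuousAt (fun q : X × (ℂ × V) => B q.1) (x₀, u) :=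
      ContinuousAt.comp (g := B) (f := Prod.fst) (x := (x₀, u)) hB continuousAt_fst
    have h2 : Continuous fun q : X × (ℂ × V) => (![q.2, cplxJ q.2] : Fin 2 → ℂ × V) := by
      refine continuous_pi fun i => ?_
      fin_cases i
      · exact continuous_snd
      · exact (cplxJL (ℂ × V)).continuous.comp continuous_snd
    exact ContinuousAt.eval h1 h2.continuousAt
  obtain ⟨L₀, hL₀⟩ : ∃ L₀ : ℝ, ∀ᶠ x in 𝓝 x₀, ∀ L ≥ L₀, ∀ u ∈ Metric.sphere (0 : ℂ × V) 1,
      0 < B x ![u, cplxJ u] + L * Complex.normSq u.1 := by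
    refine (isCompact_sphere (0 : ℂ × V) 1).induction_on (p := fun S => ∃ L₀ : ℝ, ∀ᶠ x in 𝓝 x₀,
      ∀ L ≥ L₀, ∀ u ∈ S, 0 < B x ![u, cplxJ u] + L * Complex.normSq u.1) ⟨0, by simp⟩ ?_ ?_ ?_
    · rintro s t hst ⟨L₀, h⟩
      exact ⟨L₀, h.mono fun x hx L hL u hu => hx L hL u (hst hu)⟩
    · rintro s t ⟨L₁, h₁⟩ ⟨L₂, h₂⟩
      refine ⟨max L₁ L₂, (h₁.and h₂).mono fun x hx L hL u hu => ?_⟩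
      rcases hu with hu | hu
      · exact hx.1 L ((le_max_left _ _).trans hL) u hu
      · exact hx.2 L ((le_max_right _ _).trans hL) u hu
    · intro u hu
      have hlocal : ∃ L₀ : ℝ, 0 ≤ L₀ ∧ 0 < B x₀ ![u, cplxJ u] + L₀ * Complex.normSq u.1 := by
        rcases eq_or_ne u.1 0 with h0 | h0
        · refine ⟨0, le_rfl, ?_⟩
          have hu2 : u.2 ≠ 0 := by
            intro h2
            have : u = 0 := Prod.ext h0 h2
            simp [this] at hu
          have h3 := hpos u.2 hu2
          have h4 : u = (0, u.2) := Prod.ext h0 rfl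
          rw [← h4] at h3
          linarith
        · have h1 : 0 < Complex.normSq u.1 := Complex.normSq_pos.2 h0
          refine ⟨(|B x₀ ![u, cplxJ u]| + 1) / Complex.normSq u.1, by positivity, ?_⟩
          rw [div_mul_cancel₀ _ h1.ne']
          linarith [neg_abs_le (B x₀ ![u, cplxJ u])]
      obtain ⟨L₀, hL₀, hpos₀⟩ := hlocal
      have h1 : ContinuousAt (fun q : X × (ℂ × V) => B q.1 ![q.2, cplxJ q.2] +
          L₀ * Complex.normSq q.2.1) (x₀, u) :=
        (hcont u).add (Continuous.continuousAt (by fun_prop))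
      have h2 := h1.eventually (lt_mem_nhds hpos₀)
      rw [nhds_prod_eq, eventually_prod_iff] at h2
      obtain ⟨pa, ha, pb, hb, hab⟩ := h2
      refine ⟨{u | pb u}, mem_nhdsWithin_of_mem_nhds hb, L₀, ha.mono fun x hx L hL v hv => ?_⟩
      refine (hab hx hv).trans_le (add_le_add_right ?_ _)
      exact mul_le_mul_of_nonneg_right hL (Complex.normSq_nonneg _)
  refine ⟨L₀, hL₀.mono fun x hx L hL u hu => ?_⟩
  have hn : 0 < ‖u‖ := norm_pos_iff.2 hu
  have h1 := hx L hL (‖u‖⁻¹ • u) (by simp [norm_smul, hn.ne'])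
  rw [cplxJ_smul_self_apply] at h1
  have h2 : Complex.normSq (‖u‖⁻¹ • u).1 = (‖u‖⁻¹) ^ 2 * Complex.normSq u.1 := by
    rw [Prod.smul_fst, Complex.real_smul, Complex.normSq_mul, Complex.normSq_ofReal]
    ring
  rw [h2] at h1
  have h3 : 0 < (‖u‖⁻¹) ^ 2 := by positivity
  refine (mul_pos_iff_of_pos_left h3).1 ?_
  linarith

end QuadraticPositivity

section Correction

open Set Filter

variable {D : Type*} [TopologicalSpace D]
  {V : Type*} [NormedAddCommGroup V] [NormedSpace ℂ V] [ChartedSpace V D]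
  {W : Type*} [NormedAddCommGroup W] [NormedSpace ℂ W]
  {M : Type*} [TopologicalSpace M] [ChartedSpace W M]

/-- The function whose `ddᶜ` turns the form `α = pr^* α|_D + ddᶜF` into the product form
`pr^* α|_D + dt ∧ dθ` for `t ≥ 3`: it cuts off `F`, and adds a function of `t` which
is very convex where the cutoff takes place. -/
def endCorrection (V : Type*) [NormedAddCommGroup V] [NormedSpace ℂ V] [ChartedSpace V D]
    (e : ℂ × D → M) (α : DiffForm W M 2) (f : D → ℝ) (L t : ℝ) (w : D) : ℝ :=
  (endCutoff t - 1) * endPotential V e α f t w + secondPrimitive (endDensity L) t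

/-- The form `pr^* α|_D + ddᶜ(χF)` in the chart of `D` at `w₀`, with `F` the potential of `α` and
`χ` the cutoff function. -/
def cutoffForm (V : Type*) [NormedAddCommGroup V] [NormedSpace ℂ V] [ChartedSpace V D]
    (e : ℂ × D → M) (α : DiffForm W M 2) (f : D → ℝ) (w₀ : D) (p : ℂ × V) :
    (ℂ × V) [⋀^Fin 2]→L[ℝ] ℝ :=
  (endFormInChart V e α w₀ (0, p.2)).compContinuousLinearMap (sndProj V) +
    extDeriv (dcLocal fun q : ℂ × V =>
      endCutoff q.1.re * cylinderFun V (endPotential V e α f) w₀ q) p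

namespace IsCylindricalEnd

variable {m : ℕ} {γ : Equiv.Perm D} {A : ℝ → M → M} {τ : M → ℝ} {e : ℂ × D → M}
  (hE : IsCylindricalEnd V W m γ A τ e) [IsManifold 𝓘(ℂ, V) ω D] [IsManifold 𝓘(ℂ, W) ω M]
  [FiniteDimensional ℂ V] {α : DiffForm W M 2} (hα : IsKahlerForm α)
  {f : D → ℝ} (hf : ∀ w₀ : D, ContDiffOn ℝ ∞ (f ∘ (extChartAt 𝓘(ℝ, V) w₀).symm)
        (extChartAt 𝓘(ℝ, V) w₀).target)
include hE hα hf

theorem isSmoothFamily_endCorrection (L : ℝ) : IsSmoothFamily V (endCorrection V e α f L) :=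
  ((isSmoothFamily_of_contDiff (contDiff_endCutoff.sub contDiff_const)).mul
    (hE.isSmoothFamily_endPotential hα hf)).add
    (isSmoothFamily_of_contDiff (contDiff_secondPrimitive (contDiff_endDensity L)))

omit hα hf [IsManifold 𝓘(ℂ, W) ω M] [FiniteDimensional ℂ V] in
theorem endCorrection_deck (hinv : ∀ s, DiffForm.pullback 𝓘(ℝ, W) 𝓘(ℝ, W) (A s) α = α)
    (hγ : ContMDiff 𝓘(ℂ, V) 𝓘(ℂ, V) ω γ) (hfγ : ∀ w, f (γ w) = f w) (L t : ℝ) (w : D) :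
    endCorrection V e α f L t (γ w) = endCorrection V e α f L t w := by
  simp only [endCorrection, endPotential, hfγ, hE.axialPart_deck hinv hγ]

omit hE hα hf [IsManifold 𝓘(ℂ, V) ω D] [IsManifold 𝓘(ℂ, W) ω M] [FiniteDimensional ℂ V] in
theorem endCorrection_of_nonpos (L : ℝ) {t : ℝ}
    (ht : t ≤ 0) (w : D) : endCorrection V e α f L t w = 0 := by
  rw [endCorrection, endCutoff_of_le (by linarith), secondPrimitive_of_nonpos
    (fun s hs => endDensity_of_nonpos L hs) ht]
  ring

theorem contDiffAt_cutoff_mul (w₀ : D) (ζ : ℂ) {y : V}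
    (hy : y ∈ (extChartAt 𝓘(ℝ, V) w₀).target) : ContDiffAt ℝ ∞ (fun q : ℂ × V =>
      endCutoff q.1.re * cylinderFun V (endPotential V e α f) w₀ q) (ζ, y) :=
  ((isSmoothFamily_of_contDiff contDiff_endCutoff).mul
    (hE.isSmoothFamily_endPotential hα hf)).contDiffAt w₀ ζ hy

theorem continuousAt_cutoffForm (w₀ : D) (ζ : ℂ) {y : V}
    (hy : y ∈ (extChartAt 𝓘(ℝ, V) w₀).target) :
    ContinuousAt (cutoffForm V e α f w₀) (ζ, y) := by
  have h1 : ContinuousAt (fun p : ℂ × V => endFormInChart V e α w₀ (0, p.2)) (ζ, y) :=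
    ContinuousAt.comp (g := endFormInChart V e α w₀) (f := fun p : ℂ × V => ((0 : ℂ), p.2)) (x := (ζ, y))
      (hE.contDiffAt_endFormInChart hα w₀ 0 hy).continuousAt (by fun_prop)
  have h2 := contDiffAt_extDeriv (contDiffAt_dcLocal (hE.contDiffAt_cutoff_mul hα hf w₀ ζ hy))
  exact ((ContinuousAlternatingMap.compContinuousLinearMapCLM (ι := Fin 2) (F := ℝ)
    (sndProj V)).continuous.continuousAt.comp h1).add h2.continuousAt

variable (hinv : ∀ s, DiffForm.pullback 𝓘(ℝ, W) 𝓘(ℝ, W) (A s) α = α)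
  (hdf : ∀ w₀ : D, ∀ y ∈ (extChartAt 𝓘(ℝ, V) w₀).target, ∀ v,
    fderiv ℝ (f ∘ (extChartAt 𝓘(ℝ, V) w₀).symm) y v =
      endFormInChart V e α w₀ (0, y) ![(Complex.I, 0), (0, v)])
include hinv hdf

/-- In the directions of `D`, the cut off form interpolates between the Kähler form and its
restriction to the cross-section. -/
theorem cutoffForm_vertical_pos (w₀ : D) (ζ : ℂ) {y : V}
    (hy : y ∈ (extChartAt 𝓘(ℝ, V) w₀).target) {v : V} (hv : v ≠ 0) :
    0 < cutoffForm V e α f w₀ (ζ, y) ![(0, v), cplxJ (0, v)] := by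
  have hJ : cplxJ ((0 : ℂ), v) = ((0 : ℂ), cplxJ v) := by simp [cplxJ]
  have hpos : ∀ ζ, 0 < endFormInChart V e α w₀ (ζ, y) ![(0, v), (0, cplxJ v)] := by
    intro ζ
    rw [← hJ, endFormInChart_apply, hE.isJLinear_inChartOfD w₀ ζ hy]
    refine hα.pos _ _ fun h0 => hv ?_
    obtain ⟨Q, hQ, hQ1, -⟩ := hE.exists_localInverse w₀ ζ _ hy
    have h := realDeriv_comp (hQ.mdifferentiableAt (by simp))
      (hE.mdifferentiableAt_inChartOfD w₀ ζ hy)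
    rw [realDeriv_congr (f := Q ∘ inChartOfD V e w₀) (g := id) hQ1, realDeriv_id] at h
    have h1 := congrArg (fun L : ℂ × V →L[ℝ] ℂ × V => L (0, v)) h
    simp only [ContinuousLinearMap.comp_apply, h0, map_zero] at h1
    exact congrArg Prod.snd h1
  have hF := hE.isSmoothFamily_endPotential hα hf
  have h1 : cutoffForm V e α f w₀ (ζ, y) ![(0, v), (0, cplxJ v)] =
      endFormInChart V e α w₀ (0, y) ![(0, v), (0, cplxJ v)] +
        endCutoff ζ.re * extDeriv (dcLocal (cylinderFun V (endPotential V e α f) w₀)) (ζ, y)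
          ![(0, v), (0, cplxJ v)] := by
    have h2 := ddc_re_mul_apply contDiff_endCutoff (hF.eventually_contDiffAt w₀ ζ hy) v (cplxJ v)
    rw [← h2]
    change (endFormInChart V e α w₀ (0, y)).compContinuousLinearMap (sndProj V)
      ![(0, v), (0, cplxJ v)] + _ = _
    rw [compContinuousLinearMap_two]
    rfl
  have h3 := congrArg (fun Z : (ℂ × V) [⋀^Fin 2]→L[ℝ] ℝ => Z ![(0, v), (0, cplxJ v)])
    (hE.endFormInChart_eq_section_add_ddc hα hinv hf hdf w₀ ζ hy)
  have h4 : endFormInChart V e α w₀ (ζ, y) ![(0, v), (0, cplxJ v)] =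
      endFormInChart V e α w₀ (0, y) ![(0, v), (0, cplxJ v)] +
        extDeriv (dcLocal (cylinderFun V (endPotential V e α f) w₀)) (ζ, y)
          ![(0, v), (0, cplxJ v)] := by
    refine h3.trans ?_
    change (endFormInChart V e α w₀ (0, y)).compContinuousLinearMap (sndProj V)
      ![(0, v), (0, cplxJ v)] + _ = _
    rw [compContinuousLinearMap_two]
    rfl
  have h5 := hpos ζ
  have h6 := hpos 0
  rw [h4] at h5
  rw [hJ, h1]
  rcases (endCutoff_nonneg ζ.re).eq_or_lt with h0 | h0
  · rwa [← h0, zero_mul, add_zero]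
  · have h7 := mul_pos h0 h5
    have h8 := mul_nonneg (sub_nonneg.2 (endCutoff_le_one ζ.re)) h6.le
    linarith

/-- The corrected form in the charts. -/
theorem pullback_correction {L : ℝ} {G : M → ℝ} (hG : ContMDiff 𝓘(ℝ, W) 𝓘(ℝ, ℝ) ∞ G)
    (hGe : ∀ p, G (e p) = endCorrection V e α f L p.1.re p.2) (w₀ : D) (ζ : ℂ) {y : V}
    (hy : y ∈ (extChartAt 𝓘(ℝ, V) w₀).target) (u v : ℂ × V) :
    DiffForm.pullback 𝓘(ℝ, ℂ × V) 𝓘(ℝ, W) (inChartOfD V e w₀)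
      (α + extD 𝓘(ℝ, W) (dcForm G)) (ζ, y) ![u, v] =
      cutoffForm V e α f w₀ (ζ, y) ![u, v] +
        endDensity L ζ.re * (u.1.re * v.1.im - u.1.im * v.1.re) := by
  set g := cylinderFun V (endPotential V e α f) w₀ with hg
  set k : ℂ × V → ℝ := fun p => secondPrimitive (endDensity L) p.1.re with hk
  have hgs : ContDiffAt ℝ ∞ g (ζ, y) := (hE.isSmoothFamily_endPotential hα hf).contDiffAt w₀ ζ hy
  have hks : ContDiffAt ℝ ∞ k (ζ, y) := (isSmoothFamily_of_contDiff (D := D) (V := V)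
    (contDiff_secondPrimitive (contDiff_endDensity L))).contDiffAt w₀ ζ hy
  have hcs : ContDiffAt ℝ ∞ (cylinderFun V (endCorrection V e α f L) w₀) (ζ, y) :=
    (hE.isSmoothFamily_endCorrection hα hf L).contDiffAt w₀ ζ hy
  have hGP : G ∘ inChartOfD V e w₀ = cylinderFun V (endCorrection V e α f L) w₀ :=
    funext fun p => hGe _
  have hsum : g + cylinderFun V (endCorrection V e α f L) w₀ =
      (fun q : ℂ × V => endCutoff q.1.re * g q) + k := by
    funext q
    simp only [Pi.add_apply, hg, hk, cylinderFun, endCorrection]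
    ring
  have h1 : DiffForm.pullback 𝓘(ℝ, ℂ × V) 𝓘(ℝ, W) (inChartOfD V e w₀)
      (α + extD 𝓘(ℝ, W) (dcForm G)) (ζ, y) =
      endFormInChart V e α w₀ (ζ, y) +
        DiffForm.pullback 𝓘(ℝ, ℂ × V) 𝓘(ℝ, W) (inChartOfD V e w₀)
          (extD 𝓘(ℝ, W) (dcForm G)) (ζ, y) := rfl
  have h2 := ddc_add hgs hcs
  rw [hsum, ddc_add (hE.contDiffAt_cutoff_mul hα hf w₀ ζ hy) hks] at h2
  have h3 : DiffForm.pullback 𝓘(ℝ, ℂ × V) 𝓘(ℝ, W) (inChartOfD V e w₀)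
      (α + extD 𝓘(ℝ, W) (dcForm G)) (ζ, y) =
      cutoffForm V e α f w₀ (ζ, y) + extDeriv (dcLocal k) (ζ, y) := by
    rw [h1, pullback_extD_dcForm hG (hE.contMDiffAt_inChartOfD w₀ ζ hy), hGP,
      hE.endFormInChart_eq_section_add_ddc hα hinv hf hdf w₀ ζ hy, add_assoc, ← h2, ← add_assoc]
    rfl
  have h4 := ddc_re_apply (V := V) (contDiff_secondPrimitive (contDiff_endDensity L))
    (hasDerivAt_endProfile L) (hasDerivAt_primitive (contDiff_endDensity L).continuous) (ζ, y) u v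
  rw [h3, ← h4]
  rfl

theorem cutoffForm_of_lt (w₀ : D) {ζ : ℂ} {y : V} (hy : y ∈ (extChartAt 𝓘(ℝ, V) w₀).target)
    (hζ : ζ.re < 1) : cutoffForm V e α f w₀ (ζ, y) = endFormInChart V e α w₀ (ζ, y) := by
  rw [hE.endFormInChart_eq_section_add_ddc hα hinv hf hdf w₀ ζ hy, cutoffForm]
  congr 1
  refine ddc_congr ?_
  have h : ContinuousAt (fun q : ℂ × V => q.1.re) (ζ, y) := by fun_prop
  filter_upwards [h.eventually (gt_mem_nhds hζ)] with q hq
  rw [endCutoff_of_le (le_of_lt hq), one_mul]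

omit hE hα hf hinv hdf [IsManifold 𝓘(ℂ, V) ω D] [IsManifold 𝓘(ℂ, W) ω M]
  [FiniteDimensional ℂ V] in
theorem cutoffForm_of_gt (w₀ : D) {ζ : ℂ} {y : V} (hζ : 2 < ζ.re) (u v : ℂ × V) :
    cutoffForm V e α f w₀ (ζ, y) ![u, v] =
      endFormInChart V e α w₀ (0, y) ![(0, u.2), (0, v.2)] := by
  have h : ContinuousAt (fun q : ℂ × V => q.1.re) (ζ, y) := by fun_prop
  have h1 : extDeriv (dcLocal fun q : ℂ × V =>
      endCutoff q.1.re * cylinderFun V (endPotential V e α f) w₀ q) (ζ, y) = 0 := by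
    rw [← ddc_const (E := ℂ × V) 0 (ζ, y)]
    refine ddc_congr ?_
    filter_upwards [h.eventually (lt_mem_nhds hζ)] with q hq
    rw [endCutoff_of_ge (le_of_lt hq), zero_mul]
  rw [cutoffForm, h1, add_zero, compContinuousLinearMap_two]
  rfl

end IsCylindricalEnd

end Correction


section CorrectedForm

open Set Filter

variable {D : Type*} [TopologicalSpace D]
  {V : Type*} [NormedAddCommGroup V] [NormedSpace ℂ V] [ChartedSpace V D]
  {W : Type*} [NormedAddCommGroup W] [NormedSpace ℂ W]
  {M : Type*} [TopologicalSpace M] [ChartedSpace W M]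

theorem extD_dcForm_eq_zero [IsManifold 𝓘(ℂ, W) ω M] {G : M → ℝ}
    (hG : ContMDiff 𝓘(ℝ, W) 𝓘(ℝ, ℝ) ∞ G) {x : M} (h : ∀ᶠ z in 𝓝 x, G z = 0) :
    extD 𝓘(ℝ, W) (dcForm G) x = 0 := by
  have h1 : extD 𝓘(ℝ, W) (dcForm G) x =
      extDeriv (dcLocal (G ∘ (extChartAt 𝓘(ℝ, W) x).symm)) (extChartAt 𝓘(ℝ, W) x x) := by
    refine Filter.EventuallyEq.extDeriv_eq ?_
    filter_upwards [extChartAt_target_mem_nhds x] with y hy using formInChart_dcForm hG x hy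
  rw [h1, ← ddc_const (E := W) 0 (extChartAt 𝓘(ℝ, W) x x)]
  refine ddc_congr ?_
  have hc : ContinuousAt (extChartAt 𝓘(ℝ, W) x).symm (extChartAt 𝓘(ℝ, W) x x) :=
    continuousAt_extChartAt_symm x
  rw [ContinuousAt, extChartAt_to_inv] at hc
  exact hc.eventually h

namespace IsCylindricalEnd

variable {m : ℕ} {γ : Equiv.Perm D} {A : ℝ → M → M} {τ : M → ℝ} {e : ℂ × D → M}
  (hE : IsCylindricalEnd V W m γ A τ e) [IsManifold 𝓘(ℂ, V) ω D]
include hE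

theorem pos_of_chart_pos {σ : DiffForm W M 2} (w₀ : D) (ζ : ℂ) {y : V}
    (hy : y ∈ (extChartAt 𝓘(ℝ, V) w₀).target)
    (h : ∀ v : ℂ × V, v ≠ 0 → 0 < DiffForm.pullback 𝓘(ℝ, ℂ × V) 𝓘(ℝ, W)
      (inChartOfD V e w₀) σ (ζ, y) ![v, cplxJ v]) {u : W} (hu : u ≠ 0) :
    0 < σ (inChartOfD V e w₀ (ζ, y)) ![u, cplxJ u] := by
  obtain ⟨v, rfl⟩ := hE.realDeriv_inChartOfD_surjective w₀ ζ hy u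
  have h1 := h v fun h0 => hu (by rw [h0, map_zero])
  rwa [DiffForm.pullback_eq, compContinuousLinearMap_two, hE.isJLinear_inChartOfD w₀ ζ hy] at h1

variable [IsManifold 𝓘(ℂ, W) ω M]
  [FiniteDimensional ℂ V] {α : DiffForm W M 2} (hα : IsKahlerForm α)
  {f : D → ℝ} (hf : ∀ w₀ : D, ContDiffOn ℝ ∞ (f ∘ (extChartAt 𝓘(ℝ, V) w₀).symm)
        (extChartAt 𝓘(ℝ, V) w₀).target)
  (hinv : ∀ s, DiffForm.pullback 𝓘(ℝ, W) 𝓘(ℝ, W) (A s) α = α)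
  (hdf : ∀ w₀ : D, ∀ y ∈ (extChartAt 𝓘(ℝ, V) w₀).target, ∀ v,
    fderiv ℝ (f ∘ (extChartAt 𝓘(ℝ, V) w₀).symm) y v =
      endFormInChart V e α w₀ (0, y) ![(Complex.I, 0), (0, v)])
include hα hf hinv hdf

/-- In the region `1 ≤ t ≤ 2`, where the potential is cut off, the corrected form is positive as
soon as the convex function of `t` is convex enough. -/
theorem exists_forall_pos_of_mem : ∃ L₀ : ℝ, ∀ L ≥ L₀, ∀ G : M → ℝ,
    ContMDiff 𝓘(ℝ, W) 𝓘(ℝ, ℝ) ∞ G → (∀ p, G (e p) = endCorrection V e α f L p.1.re p.2) →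
      ∀ x, Real.exp 1 ≤ τ x → τ x ≤ Real.exp 2 → ∀ u : W, u ≠ 0 →
        0 < (α + extD 𝓘(ℝ, W) (dcForm G)) x ![u, cplxJ u] := by
  have hK : IsCompact {x | Real.exp 1 ≤ τ x ∧ τ x ≤ Real.exp 2} := by
    have h := (hE.isCompact_le (Real.exp 2)).inter_left
      (isClosed_le (continuous_const (y := Real.exp 1)) hE.continuous)
    exact h
  have hp := hK.induction_on (p := fun S => ∃ L₀ : ℝ, ∀ L ≥ L₀, ∀ G : M → ℝ,
    ContMDiff 𝓘(ℝ, W) 𝓘(ℝ, ℝ) ∞ G → (∀ p, G (e p) = endCorrection V e α f L p.1.re p.2) →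
      ∀ x ∈ S, Real.exp 1 ≤ τ x → τ x ≤ Real.exp 2 → ∀ u : W, u ≠ 0 →
        0 < (α + extD 𝓘(ℝ, W) (dcForm G)) x ![u, cplxJ u]) ⟨0, by simp⟩ ?_ ?_ ?_
  · obtain ⟨L₀, h⟩ := hp
    exact ⟨L₀, fun L hL G hG hGe x h1 h2 => h L hL G hG hGe x ⟨h1, h2⟩ h1 h2⟩
  · rintro s t hst ⟨L₀, h⟩
    exact ⟨L₀, fun L hL G hG hGe x hx => h L hL G hG hGe x (hst hx)⟩
  · rintro s t ⟨L₁, h₁⟩ ⟨L₂, h₂⟩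
    refine ⟨max L₁ L₂, fun L hL G hG hGe x hx => ?_⟩
    rcases hx with hx | hx
    · exact h₁ L ((le_max_left _ _).trans hL) G hG hGe x hx
    · exact h₂ L ((le_max_right _ _).trans hL) G hG hGe x hx
  · rintro x ⟨hx1, hx2⟩
    obtain ⟨⟨ζ, w⟩, rfl⟩ := hE.exists_eq x ((Real.exp_pos 1).trans_le hx1)
    have hy := mem_extChartAt_target (I := 𝓘(ℝ, V)) w
    set y := extChartAt 𝓘(ℝ, V) w w with hydef
    obtain ⟨Q, hQ, hQ1, hQ2⟩ := hE.exists_localInverse w ζ _ hy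
    have h0 : inChartOfD V e w (ζ, y) = e (ζ, w) := by simp [inChartOfD, hydef]
    have h1 := hQ1.self_of_nhds
    rw [h0] at hQ hQ2 h1
    obtain ⟨L₀, hL₀⟩ := exists_forall_add_normSq_pos (hE.continuousAt_cutoffForm hα hf w ζ hy)
      fun v hv => hE.cutoffForm_vertical_pos hα hf hinv hdf w ζ hy hv
    have h2 : ∀ᶠ p : ℂ × V in 𝓝 (ζ, y), p.2 ∈ (extChartAt 𝓘(ℝ, V) w).target :=
      continuousAt_snd.eventually ((isOpen_extChartAt_target w).mem_nhds hy)
    have h3 := hL₀.and h2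
    rw [← h1] at h3
    refine ⟨_, mem_nhdsWithin_of_mem_nhds (hQ2.and (hQ.continuousAt.eventually h3)), L₀,
      fun L hL G hG hGe x hx hx1 hx2 u hu => ?_⟩
    obtain ⟨hx, hpos, hxT⟩ := hx
    have hτ : τ x = Real.exp (Q x).1.re := by
      nth_rewrite 1 [← hx]
      exact hE.apply_eq _
    rw [hτ, Real.exp_le_exp] at hx1 hx2
    rw [← hx]
    refine hE.pos_of_chart_pos w (Q x).1 hxT (fun v hv => ?_) hu
    rw [hE.pullback_correction hα hf hinv hdf hG hGe w _ hxT, endDensity_of_mem L hx1 hx2]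
    have h4 := hpos L hL v hv
    rw [Complex.normSq_apply] at h4
    simpa [cplxJ] using h4

/-- For a suitable `L`, the corrected form is a Kähler form. -/
theorem exists_isKahlerForm_correction : ∃ L : ℝ, ∀ G : M → ℝ,
    ContMDiff 𝓘(ℝ, W) 𝓘(ℝ, ℝ) ∞ G → (∀ p, G (e p) = endCorrection V e α f L p.1.re p.2) →
      (∀ x, τ x < 1 → G x = 0) → IsKahlerForm (α + extD 𝓘(ℝ, W) (dcForm G)) := by
  obtain ⟨L₀, hL₀⟩ := hE.exists_forall_pos_of_mem hα hf hinv hdf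
  refine ⟨max L₀ 0, fun G hG hGe hG0 => ?_⟩
  have hdc := isSmoothForm_dcForm hG
  refine ⟨⟨hα.closed.1.add hdc.extD, ?_⟩, fun x u v => ?_, fun x u hu => ?_⟩
  · have h0 : extD 𝓘(ℝ, W) α = 0 := hα.closed.2
    rw [extD_add hα.closed.1 hdc.extD, h0, hdc.extD_extD, add_zero]
  · have h1 := hα.invariant x u v
    have h2 := extD_dcForm_cplxJ hG x u v
    change α x ![cplxJ u, cplxJ v] + extD 𝓘(ℝ, W) (dcForm G) x ![cplxJ u, cplxJ v] =
      α x ![u, v] + extD 𝓘(ℝ, W) (dcForm G) x ![u, v]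
    rw [h1, h2]
  by_cases hx : 0 < τ x
  swap
  · have h1 : extD 𝓘(ℝ, W) (dcForm G) x = 0 := by
      refine extD_dcForm_eq_zero hG ?_
      filter_upwards [hE.continuous.continuousAt.eventually
        (gt_mem_nhds (show τ x < 1 by linarith))] with z hz using hG0 z hz
    change 0 < α x ![u, cplxJ u] + extD 𝓘(ℝ, W) (dcForm G) x ![u, cplxJ u]
    rw [h1]
    have h2 := hα.pos x u hu
    rwa [← add_zero (α x ![u, cplxJ u])] at h2
  obtain ⟨⟨ζ, w⟩, rfl⟩ := hE.exists_eq x hx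
  by_cases hmid : 1 ≤ ζ.re ∧ ζ.re ≤ 2
  · exact hL₀ _ (le_max_left _ _) G hG hGe _ (by rw [hE.apply_eq, Real.exp_le_exp]; exact hmid.1)
      (by rw [hE.apply_eq, Real.exp_le_exp]; exact hmid.2) u hu
  have hy := mem_extChartAt_target (I := 𝓘(ℝ, V)) w
  have hxe : inChartOfD V e w (ζ, extChartAt 𝓘(ℝ, V) w w) = e (ζ, w) := by simp [inChartOfD]
  rw [← hxe]
  refine hE.pos_of_chart_pos w ζ hy (fun v hv => ?_) hu
  rw [hE.pullback_correction hα hf hinv hdf hG hGe w ζ hy]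
  have hL : (0 : ℝ) ≤ max L₀ 0 := le_max_right _ _
  have hJ : v.1.re * (cplxJ v).1.im - v.1.im * (cplxJ v).1.re = Complex.normSq v.1 := by
    simp [cplxJ, Complex.normSq_apply]
  have hpos : ∀ ζ : ℂ, ∀ v : ℂ × V, v ≠ 0 →
      0 < endFormInChart V e α w (ζ, extChartAt 𝓘(ℝ, V) w w) ![v, cplxJ v] := by
    intro ζ v hv
    have h1 := hE.endForm_pos hα (ζ, w) hv
    rw [endForm_apply] at h1
    rw [endFormInChart_apply, hE.realDeriv_inChartOfD_self, hE.realDeriv_inChartOfD_self]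
    have hxe : inChartOfD V e w (ζ, extChartAt 𝓘(ℝ, V) w w) = e (ζ, w) := by simp [inChartOfD]
    rwa [hxe]
  rw [hJ]
  rcases lt_or_ge ζ.re 1 with h1 | h1
  · rw [hE.cutoffForm_of_lt hα hf hinv hdf w hy h1]
    exact add_pos_of_pos_of_nonneg (hpos ζ v hv)
      (mul_nonneg (endDensity_nonneg hL _) (Complex.normSq_nonneg _))
  · have h2 : 2 < ζ.re := not_le.1 fun h => hmid ⟨h1, h⟩
    rw [cutoffForm_of_gt w h2]
    rcases eq_or_ne v.2 0 with h3 | h3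
    · have h4 : v.1 ≠ 0 := fun h => hv (Prod.ext h h3)
      have h5 : (0, v.2) = (0 : ℂ × V) := by rw [h3]; rfl
      rw [h5, alternating_zero_left, zero_add]
      exact mul_pos (endDensity_pos hL h2) (Complex.normSq_pos.2 h4)
    · have h4 := hpos 0 (0, v.2) fun h => h3 (congrArg Prod.snd h)
      have h5 : cplxJ ((0 : ℂ), v.2) = (0, (cplxJ v).2) := by simp [cplxJ]
      rw [h5] at h4
      exact add_pos_of_pos_of_nonneg h4
        (mul_nonneg (endDensity_nonneg hL _) (Complex.normSq_nonneg _))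

/-- For `t ≥ 3`, the corrected form is the product form `dt ∧ dθ + pr^* α|_D`. -/
theorem endForm_correction_of_ge
    {L : ℝ} {G : M → ℝ} (hG : ContMDiff 𝓘(ℝ, W) 𝓘(ℝ, ℝ) ∞ G)
    (hGe : ∀ p, G (e p) = endCorrection V e α f L p.1.re p.2) {ζ : ℂ} (hζ : 3 ≤ ζ.re) (w : D)
    (u v : ℂ × V) :
    endForm V e (α + extD 𝓘(ℝ, W) (dcForm G)) (ζ, w) ![u, v] =
      (u.1.re * v.1.im - u.1.im * v.1.re) + sectionForm V e α w ![u.2, v.2] := by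
  have hy := mem_extChartAt_target (I := 𝓘(ℝ, V)) w
  have hxe : ∀ ζ, inChartOfD V e w (ζ, extChartAt 𝓘(ℝ, V) w w) = e (ζ, w) := by
    simp [inChartOfD]
  have h1 := hE.pullback_correction hα hf hinv hdf hG hGe w ζ hy u v
  rw [DiffForm.pullback_eq, compContinuousLinearMap_two, hE.realDeriv_inChartOfD_self,
    hE.realDeriv_inChartOfD_self, hxe, cutoffForm_of_gt w (by linarith), endFormInChart_apply,
    hE.realDeriv_inChartOfD_self, hE.realDeriv_inChartOfD_self, hxe, endDensity_of_ge L hζ,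
    one_mul, add_comm (α _ _)] at h1
  rw [endForm_apply, sectionForm_apply, endForm_apply]
  exact h1

end IsCylindricalEnd

end CorrectedForm


/-! ### Completeness and asymptotics of product metrics -/

section Asymptotics

open Set Filter

theorem iterCovDeriv_eq_zero {E : Type*} [NormedAddCommGroup E] [NormedSpace ℝ E]
    {H : Type*} [TopologicalSpace H] {I : ModelWithCorners ℝ E H}
    {N : Type*} [TopologicalSpace N] [ChartedSpace H N] (g : CovTensor E N 2) {r : ℕ}
    {T : CovTensor E N r} {U : Set N} (hU : IsOpen U) (hT : ∀ p ∈ U, ∀ v, T p v = 0) (k : ℕ) :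
    ∀ p ∈ U, ∀ v, iterCovDeriv I g T k p v = 0 := by
  induction k with
  | zero => exact hT
  | succ k ih =>
    intro p hp v
    have hc : ContinuousAt (extChartAt I p).symm (extChartAt I p p) := continuousAt_extChartAt_symm p
    rw [ContinuousAt, extChartAt_to_inv] at hc
    have h1 : ∀ w, (fun y => tensorInChart I (iterCovDeriv I g T k) p y w) =ᶠ[𝓝 (extChartAt I p p)]
        fun _ => 0 := by
      intro w
      filter_upwards [hc.eventually (hU.mem_nhds hp)] with y hy using ih _ hy _
    have h2 : covDeriv I g (iterCovDeriv I g T k) p v = 0 := by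
      simp only [covDeriv, chartDeriv, ih p hp, Finset.sum_const_zero, sub_zero]
      rw [(h1 _).fderiv_eq]
      simp
    exact h2

variable {D : Type*} [TopologicalSpace D]
  {V : Type*} [NormedAddCommGroup V] [NormedSpace ℂ V] [ChartedSpace V D]
  {W : Type*} [NormedAddCommGroup W] [NormedSpace ℂ W]
  {M : Type*} [TopologicalSpace M] [ChartedSpace W M]

/-- A metric which is equal to the model far out on the end is asymptotic to it. -/
theorem Resolution.isAsymptotic_of_eq {m : ℕ} {γ : Equiv.Perm D} (R : Resolution V W m γ M)
    {g : CovTensor W M 2} {gc : CovTensor (ℂ × V) (ℂ × D) 2} {t₀ : ℝ}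
    (h : ∀ p : ℂ × D, p.1 ≠ 0 → t₀ ≤ cylParam p → ∀ v,
      CovTensor.pullback (𝓘(ℝ, ℂ).prod 𝓘(ℝ, V)) 𝓘(ℝ, W) R.lift g p v = gc p v) :
    R.IsAsymptotic g gc := by
  refine ⟨1, one_pos, fun k => ⟨0, t₀ + 1, fun p hp ht v => ?_⟩⟩
  have hU : IsOpen {p : ℂ × D | Real.exp t₀ < ‖p.1‖} :=
    isOpen_lt continuous_const (continuous_norm.comp continuous_fst)
  have hT : ∀ q ∈ {p : ℂ × D | Real.exp t₀ < ‖p.1‖}, ∀ w,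
      (CovTensor.pullback (𝓘(ℝ, ℂ).prod 𝓘(ℝ, V)) 𝓘(ℝ, W) R.lift g - gc) q w = 0 := by
    intro q hq w
    have hq0 : 0 < ‖q.1‖ := (Real.exp_pos _).trans hq
    have h1 := h q (norm_pos_iff.1 hq0) ((Real.le_log_iff_exp_le hq0).2 (le_of_lt hq)) w
    rw [Pi.sub_apply, Pi.sub_apply, h1, sub_self]
  have hpU : p ∈ {p : ℂ × D | Real.exp t₀ < ‖p.1‖} := by
    have h1 : t₀ + 1 ≤ Real.log ‖p.1‖ := ht
    exact (Real.lt_log_iff_exp_lt (norm_pos_iff.2 hp)).1 (by linarith)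
  rw [iterCovDeriv_eq_zero gc hU hT k p hpU v]
  simp

/-- A Kähler metric on the resolution which is a product for `t ≥ t₀`, in the coordinate
`ζ = log z`, is asymptotic to the cylinder `e^{-2t} g_ℂ + g_D`. -/
theorem Resolution.isAsymptotic_cylMetric {m : ℕ} {γ : Equiv.Perm D} (R : Resolution V W m γ M)
    (hm : 0 < m) (hγ : orderOf γ = m) [IsManifold 𝓘(ℂ, V) ω D] {σ : DiffForm W M 2}
    {σD : DiffForm V D 2} {t₀ : ℝ}
    (h : ∀ ζ : ℂ, t₀ ≤ ζ.re → ∀ (w : D) (u v : ℂ × V), endForm V R.expLift σ (ζ, w) ![u, v] =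
      (u.1.re * v.1.im - u.1.im * v.1.re) + σD w ![u.2, v.2]) :
    R.IsAsymptotic (kahlerMetric σ) (cylMetric (kahlerMetric σD)) := by
  refine R.isAsymptotic_of_eq (t₀ := t₀) fun p hp ht v => ?_
  obtain ⟨z, w⟩ := p
  have hz : z ≠ 0 := hp
  set ζ := Complex.log z with hζ
  have hexp : Complex.exp ζ = z := Complex.exp_log hz
  have hre : t₀ ≤ ζ.re := by rw [hζ, Complex.log_re]; exact ht
  have hlift := (R.lift_biholomorphic ⟨(z, w), mk_notMem_singularPart hm hγ hz⟩).contMDiffAt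
  have hld : MDifferentiableAt (𝓘(ℝ, ℂ).prod 𝓘(ℝ, V)) 𝓘(ℝ, W) R.lift (z, w) :=
    (((sameModel_self ℂ).prod (sameModel_self V)).contMDiffAt (sameModel_self W)
      hlift).mdifferentiableAt (by simp)
  have hJ : IsJLinear (endDeriv V W R.lift (z, w)) :=
    ((sameModel_self ℂ).prod (sameModel_self V)).isJLinear_mfderiv (sameModel_self W)
      (hlift.mdifferentiableAt (by simp))
  -- The derivatives of the two coverings differ by the factor `z` on `ℂ`.
  have hd : ∀ u : ℂ × V, endDeriv V W R.lift (z, w) u =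
      endDeriv V W R.expLift (ζ, w) (u.1 / z, u.2) := by
    intro u
    have h1 : HasMFDerivAt 𝓘(ℝ, ℂ) 𝓘(ℝ, ℂ) Complex.exp ζ
        (ContinuousLinearMap.toSpanSingleton ℂ (Complex.exp ζ) |>.restrictScalars ℝ) :=
      ((Complex.hasDerivAt_exp ζ).hasFDerivAt.restrictScalars ℝ).hasMFDerivAt
    have h2 : HasMFDerivAt (𝓘(ℝ, ℂ).prod 𝓘(ℝ, V)) (𝓘(ℝ, ℂ).prod 𝓘(ℝ, V))
        (Prod.map Complex.exp (id : D → D)) (ζ, w) _ :=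
      h1.prodMap (p := (ζ, w)) (hasMFDerivAt_id (I := 𝓘(ℝ, V)) w)
    have h3 := HasMFDerivAt.comp (g := R.lift) (f := Prod.map Complex.exp (id : D → D)) (ζ, w)
      (by rw [Prod.map_apply, hexp]; exact hld.hasMFDerivAt) h2
    have h4 := congrArg (fun L : ℂ × V →L[ℝ] W => L (u.1 / z, u.2)) h3.mfderiv
    refine Eq.trans ?_ h4.symm
    have h5 : (mfderiv 𝓘(ℝ, ℂ) 𝓘(ℝ, ℂ) Complex.exp ζ : ℂ →L[ℝ] ℂ) (u.1 / z) = u.1 := by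
      rw [h1.mfderiv]
      change (u.1 / z) • Complex.exp ζ = u.1
      rw [hexp, smul_eq_mul, div_mul_cancel₀ _ hz]
    have h6 : (mfderiv 𝓘(ℝ, V) 𝓘(ℝ, V) (id : D → D) w : V →L[ℝ] V) u.2 = u.2 := by
      rw [mfderiv_id]; rfl
    change endDeriv V W R.lift (z, w) u = endDeriv V W R.lift (z, w)
      ((mfderiv 𝓘(ℝ, ℂ) 𝓘(ℝ, ℂ) Complex.exp ζ : ℂ →L[ℝ] ℂ) (u.1 / z),
        (mfderiv 𝓘(ℝ, V) 𝓘(ℝ, V) (id : D → D) w : V →L[ℝ] V) u.2)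
    rw [h5, h6]
  have he : R.expLift (ζ, w) = R.lift (z, w) := by rw [Resolution.expLift, hexp]
  change σ (R.lift (z, w)) ![endDeriv V W R.lift (z, w) (v 0),
    cplxJ (endDeriv V W R.lift (z, w) (v 1))] =
      Real.exp (-2 * Real.log ‖z‖) * inner ℝ (v 0).1 (v 1).1 + σD w ![(v 0).2, cplxJ (v 1).2]
  have h1 := h ζ hre w ((v 0).1 / z, (v 0).2) (Complex.I * (v 1).1 / z, cplxJ (v 1).2)
  have hJ1 : cplxJ (v 1) = (Complex.I * (v 1).1, cplxJ (v 1).2) := rfl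
  rw [endForm_apply, he] at h1
  rw [← hJ, hJ1, hd, hd]
  refine h1.trans ?_
  congr 1
  have h2 : Real.exp (-2 * Real.log ‖z‖) = (Complex.normSq z)⁻¹ := by
    rw [neg_mul, Real.exp_neg, mul_comm, Real.exp_mul, Real.exp_log (norm_pos_iff.2 hz),
      Complex.normSq_eq_norm_sq]
    norm_num
  have h3 : (v 0).1 / z = (Complex.normSq z)⁻¹ • ((v 0).1 * (starRingEnd ℂ) z) := by
    rw [div_eq_mul_inv, Complex.inv_def, Complex.real_smul]
    push_cast
    ring
  have h4 : Complex.I * (v 1).1 / z =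
      (Complex.normSq z)⁻¹ • (Complex.I * (v 1).1 * (starRingEnd ℂ) z) := by
    rw [div_eq_mul_inv, Complex.inv_def, Complex.real_smul]
    push_cast
    ring
  have h5 : Complex.normSq z ≠ 0 := by simpa using hz
  rw [h2, h3, h4, Complex.inner]
  simp only [Complex.real_smul, Complex.mul_re, Complex.mul_im, Complex.ofReal_re,
    Complex.ofReal_im, Complex.conj_re, Complex.conj_im, Complex.I_re, Complex.I_im]
  rw [Complex.normSq_apply] at h5 ⊢
  linear_combination ((z.re * z.re + z.im * z.im)⁻¹ *
    ((v 0).1.re * (v 1).1.re + (v 0).1.im * (v 1).1.im)) * inv_mul_cancel₀ h5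

end Asymptotics

section Completeness

open Set Filter

variable {D : Type*} [TopologicalSpace D]
  {V : Type*} [NormedAddCommGroup V] [NormedSpace ℂ V] [ChartedSpace V D]
  {W : Type*} [NormedAddCommGroup W] [NormedSpace ℂ W]
  {M : Type*} [TopologicalSpace M] [ChartedSpace W M]

/-- A Kähler metric which is a product for `t ≥ 3` is complete: a smooth function equal to `t`
far out on the end, up to a constant, is proper and has bounded differential. -/
theorem IsCylindricalEnd.isCompleteMetric {m : ℕ} {γ : Equiv.Perm D} {A : ℝ → M → M} {τ : M → ℝ}
    {e : ℂ × D → M} (hE : IsCylindricalEnd V W m γ A τ e) [IsManifold 𝓘(ℂ, V) ω D]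
    [IsManifold 𝓘(ℂ, W) ω M] [FirstCountableTopology M] {σ : DiffForm W M 2}
    (hσ : IsKahlerForm σ) {σD : DiffForm V D 2} (hσD : IsKahlerForm σD)
    (h : ∀ ζ : ℂ, 3 ≤ ζ.re → ∀ (w : D) (u v : ℂ × V), endForm V e σ (ζ, w) ![u, v] =
      (u.1.re * v.1.im - u.1.im * v.1.re) + σD w ![u.2, v.2]) :
    IsCompleteMetric 𝓘(ℝ, W) (kahlerMetric σ) := by
  set a : ℝ → ℝ := fun s => Real.smoothTransition (s - 3) with ha
  have has : ContDiff ℝ ∞ a := contDiff_smoothTransition_sub 3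
  have ha0 : ∀ s, 0 ≤ a s := fun s => Real.smoothTransition.nonneg _
  set k : ℝ → ℝ := fun t => ∫ s in (0:ℝ)..t, a s with hk
  have hkd : ∀ t, HasDerivAt k (a t) t := hasDerivAt_primitive has.continuous
  have hks : ContDiff ℝ ∞ k := by
    have h1 : deriv k = a := funext fun t => (hkd t).deriv
    rw [contDiff_infty_iff_deriv, h1]
    exact ⟨fun t => (hkd t).differentiableAt, has⟩
  have hk0 : ∀ t ≤ 0, k t = 0 := by
    intro t ht
    simp only [hk]
    rw [intervalIntegral.integral_congr (g := fun _ => (0 : ℝ))]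
    · simp
    · intro s hs
      rw [uIcc_of_ge ht] at hs
      exact Real.smoothTransition.zero_of_nonpos (by linarith [hs.2])
  have hkge : ∀ t, t - 4 ≤ k t := by
    intro t
    have hint : ∀ b c, IntervalIntegrable a MeasureTheory.volume b c := fun b c =>
      has.continuous.intervalIntegrable b c
    rcases le_total t 4 with ht | ht
    · rcases le_total 0 t with ht0 | ht0
      · have := intervalIntegral.integral_nonneg (μ := MeasureTheory.volume) ht0 fun s _ => ha0 s
        linarith
      · rw [hk0 t ht0]
        linarith
    · have h1 : k t = (∫ s in (0:ℝ)..4, a s) + ∫ s in (4:ℝ)..t, a s :=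
        (intervalIntegral.integral_add_adjacent_intervals (hint _ _) (hint _ _)).symm
      have h2 : ∫ s in (4:ℝ)..t, a s = t - 4 := by
        rw [intervalIntegral.integral_congr (g := fun _ => (1 : ℝ))]
        · simp
        · intro s hs
          rw [uIcc_of_le ht] at hs
          exact Real.smoothTransition.one_of_one_le (by linarith [hs.1])
      have := intervalIntegral.integral_nonneg (μ := MeasureTheory.volume) (a := 0) (b := 4)
        (by norm_num) fun s _ => ha0 s
      linarith
  obtain ⟨ρ, hρ, hρe, hρ0⟩ := hE.exists_extension (F := fun t _ => k t)
    (isSmoothFamily_of_contDiff hks) (fun _ _ => rfl) fun t ht _ => hk0 t ht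
  refine isCompleteMetric_of_proper hσ (hρ.of_le (by simp)) (fun x u => ?_) fun c => ?_
  · by_cases hx : 0 < τ x
    swap
    · have h1 : ρ =ᶠ[𝓝 x] fun _ => 0 := by
        filter_upwards [hE.continuous.continuousAt.eventually
          (gt_mem_nhds (show τ x < 1 by linarith))] with z hz using hρ0 z hz
      rw [realDeriv_congr h1, realDeriv_const]
      simp
    obtain ⟨⟨ζ, w⟩, rfl⟩ := hE.exists_eq x hx
    obtain ⟨v, rfl⟩ := hE.endDeriv_surjective (ζ, w) u
    have hy := mem_extChartAt_target (I := 𝓘(ℝ, V)) w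
    have hxe : inChartOfD V e w (ζ, extChartAt 𝓘(ℝ, V) w w) = e (ζ, w) := by simp [inChartOfD]
    have h1 : realDeriv 𝓘(ℝ, W) 𝓘(ℝ, ℝ) ρ (e (ζ, w)) (endDeriv V W e (ζ, w) v) =
        a ζ.re * v.1.re := by
      have h2 := realDeriv_comp (I := 𝓘(ℝ, ℂ × V)) (g := ρ) (f := inChartOfD V e w)
        (x := (ζ, extChartAt 𝓘(ℝ, V) w w)) (hρ.mdifferentiableAt (by simp))
        (hE.mdifferentiableAt_inChartOfD w ζ hy)
      have h3 : ρ ∘ inChartOfD V e w = fun p : ℂ × V => k p.1.re := funext fun p => hρe _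
      have h4 : HasFDerivAt (fun p : ℂ × V => k p.1.re)
          (a ζ.re • (Complex.reCLM ∘L ContinuousLinearMap.fst ℝ ℂ V))
          (ζ, extChartAt 𝓘(ℝ, V) w w) := by
        have hR : HasFDerivAt (fun p : ℂ × V => p.1.re)
            (Complex.reCLM ∘L ContinuousLinearMap.fst ℝ ℂ V) (ζ, extChartAt 𝓘(ℝ, V) w w) :=
          (Complex.reCLM ∘L ContinuousLinearMap.fst ℝ ℂ V).hasFDerivAt
        exact HasDerivAt.comp_hasFDerivAt (ζ, extChartAt 𝓘(ℝ, V) w w) (hkd ζ.re) hR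
      rw [h3, realDeriv_eq_fderiv, h4.fderiv, hxe] at h2
      have h5 := congrArg (fun L : ℂ × V →L[ℝ] ℝ => L v) h2
      simp only [ContinuousLinearMap.comp_apply, hE.realDeriv_inChartOfD_self] at h5
      rw [← h5]
      rfl
    rw [h1]
    rcases lt_or_ge ζ.re 3 with h3 | h3
    · have : a ζ.re = 0 := Real.smoothTransition.zero_of_nonpos (by linarith)
      rw [this, zero_mul, abs_zero]
      exact Real.sqrt_nonneg _
    · refine Real.le_sqrt_of_sq_le ?_
      have h4 := h ζ h3 w v (cplxJ v)
      rw [endForm_apply, hE.isJLinear_endDeriv] at h4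
      rw [kahlerMetric_apply, h4, sq_abs, mul_pow]
      have h5 : 0 ≤ σD w ![v.2, (cplxJ v).2] := hσD.nonneg w v.2
      have h6 : (cplxJ v).1.im = v.1.re := by simp [cplxJ]
      have h7 : (cplxJ v).1.re = -v.1.im := by simp [cplxJ]
      have h8 : a ζ.re ^ 2 ≤ 1 := pow_le_one₀ (ha0 _) (Real.smoothTransition.le_one _)
      rw [h6, h7]
      nlinarith [mul_le_mul_of_nonneg_right h8 (sq_nonneg v.1.re), sq_nonneg v.1.im]
  · refine ⟨_, hE.isCompact_le (Real.exp (c + 4)), fun x hx => ?_⟩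
    by_cases hx0 : 0 < τ x
    · obtain ⟨p, rfl⟩ := hE.exists_eq x hx0
      rw [hρe] at hx
      change τ (e p) ≤ _
      rw [hE.apply_eq, Real.exp_le_exp]
      linarith [hkge p.1.re]
    · exact (not_lt.1 hx0).trans (Real.exp_pos _).le

end Completeness

end ACylKahler

end

/-! ### Kähler classes on the resolution -/

theorem corollary4p4
    {V : Type*} [NormedAddCommGroup V] [NormedSpace ℂ V] [FiniteDimensional ℂ V]
    {D : Type*} [TopologicalSpace D] [T2Space D] [CompactSpace D] [ConnectedSpace D]
    [ChartedSpace V D] [IsManifold 𝓘(ℂ, V) ω D]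
    (hD : ∃ σ : ACylKahler.DiffForm V D 2, ACylKahler.IsKahlerForm σ)
    (γ : Diffeomorph 𝓘(ℂ, V) 𝓘(ℂ, V) D D ω) (m : ℕ) (hm : 1 < m)
    (hγ : orderOf (γ.toEquiv : Equiv.Perm D) = m)
    {W : Type*} [NormedAddCommGroup W] [NormedSpace ℂ W] [FiniteDimensional ℂ W]
    {M : Type*} [TopologicalSpace M] [T2Space M] [SecondCountableTopology M]
    [ChartedSpace W M] [IsManifold 𝓘(ℂ, W) ω M]
    (R : ACylKahler.Resolution V W m γ.toEquiv M)
    (hR : R.ActionExtends)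
    (hexact : ∀ α ∈ ACylKahler.closedForms 𝓘(ℝ, V) D 1,
      ACylKahler.DiffForm.pullback 𝓘(ℝ, V) 𝓘(ℝ, V) γ α = α →
        α ∈ ACylKahler.exactForms 𝓘(ℝ, V) D 0) :
    ∀ κ : ACylKahler.DeRhamH2 𝓘(ℝ, W) M,
      ACylKahler.IsKahlerClass κ → R.IsACylKahlerClass κ := by
  rintro κ ⟨σ₀, h₀, rfl⟩
  have hm0 : 0 < m := by omega
  have hγs : ContMDiff 𝓘(ℂ, V) 𝓘(ℂ, V) ω (γ.toEquiv : Equiv.Perm D) := γ.contMDiff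
  obtain ⟨A, hE⟩ := R.isCylindricalEnd_expLift hm0 hγ hR
  have hA := hE.circleAction
  have hs₀ : ACylKahler.IsSmoothForm 𝓘(ℝ, W) σ₀ := h₀.closed.1
  have hα := hA.isKahlerForm_average h₀
  have hinv := hA.pullback_average hs₀ h₀.closed.2
  set α := ACylKahler.average A σ₀ with hαdef
  -- The contraction of `α` with the generator of the action restricts to an exact form on `D`.
  obtain ⟨f, hf, hdf, hfγ⟩ := hE.exists_invariant_primitive hinv hm0 hγ hγs
    (hexact _ (hE.isClosed_sectionContract hα hinv) (hE.pullback_sectionContract hinv hγs))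
  obtain ⟨L, hL⟩ := hE.exists_isKahlerForm_correction hα hf hinv hdf
  obtain ⟨G, hG, hGe, hG0⟩ := hE.exists_extension (hE.isSmoothFamily_endCorrection hα hf L)
    (hE.endCorrection_deck hinv hγs hfγ L)
    (fun t ht w => ACylKahler.IsCylindricalEnd.endCorrection_of_nonpos L ht w)
  have hσ := hL G hG hGe hG0
  have hσD := hE.isKahlerForm_sectionForm hα
  have hend := fun (ζ : ℂ) (hζ : 3 ≤ ζ.re) => hE.endForm_correction_of_ge hα hf hinv hdf hG hGe hζ
  have hcore := R.core_eq hm0 hγ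
  have hconn : PreconnectedSpace M := R.preconnectedSpace hm0 hγ
  refine ⟨_, hσ, ?_, hE.isCompleteMetric hσ hσD hend, ?_,
    ACylKahler.isBoundedFor_of_isCompact hσ (R.isCompact_radius_le 1) ?_, _, hσD,
    hE.pullback_kahlerMetric_sectionForm hinv hγs, R.isAsymptotic_cylMetric hm0 hγ hend⟩
  · have hP := hA.isSmoothForm_averagePrimitive hs₀
    have hdG := ACylKahler.isSmoothForm_dcForm hG
    refine (Submodule.Quotient.eq _).2 ?_
    change α + ACylKahler.extD 𝓘(ℝ, W) (ACylKahler.dcForm G) - σ₀ ∈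
      ACylKahler.exactForms 𝓘(ℝ, W) M 1
    refine ⟨ACylKahler.averagePrimitive A σ₀ + ACylKahler.dcForm G, hP.add hdG, ?_⟩
    rw [ACylKahler.extD_add hP hdG, hαdef, ACylKahler.average]
    abel
  · rw [hcore]
    exact isOpen_lt R.continuous_radius continuous_const
  · rw [hcore]
    exact fun x (hx : R.radius x < 1) => hx.le
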